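/- Notation: $\partial=\tfrac12(\partial_x-i\partial_y)$, $\overline\partial=\tfrac12(\partial_x+i\partial_y)$ on $\mathbb C$, $dm$ is Lebesgue measure, and $e_k(z)=\exp(i(kz+\bar k\bar z))$. Fix $p\in(2,\infty)$. For a potential $u:\mathbb C\to\mathbb C$, a point $k\in\mathbb C$ is called exceptional if there is a $2\times2$ matrix-valued function $M\in L^p(\mathbb C)$, not almost everywhere zero, which solves in the sense of distributions $$\begin{pmatrix}\overline\partial M_{11} & (\overline\partial-i\bar k)M_{12}\\ (\partial+ik)M_{21} & \partial M_{22}\end{pmatrix}=\frac12\begin{pmatrix}0&u\\-\bar u&0\end{pmatrix}M .$$ The set of exceptional points is the exceptional set $Z(u)$ of the focusing Davey–Stewartson II (fDSII) scattering problem. For $k_0,\nu_0,\mu_0\in\mathbb C$ with $\nu_0\ne0$ let $$u_0(z)=\frac{2\overline{\nu_0}\,e_{k_0}(z)}{|z+\mu_0|^2+|\nu_0|^2}$$ be the Arkadiev–Pogrebkov–Polivanov one-soliton potential. **Theorem 1.1.** (i) $Z(u_0)=\{k_0\}$. (ii) Let $\varphi\in C_0^\infty(\mathbb C)$ be complex-valued,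 put $\chi=e_{-k_0}\varphi$, and suppose that $$\int_{\mathbb C}\frac{\nu_0^2\,\chi(z)+|z+\mu_0|^2\,\overline{\chi(z)}}{(|z+\mu_0|^2+|\nu_0|^2)^{2}}\,dm(z)\neq0 .$$ Then there is $\varepsilon_0>0$ such that $Z(u_0+\varepsilon\varphi)=\emptyset$ for all $0<\varepsilon<\varepsilon_0$. (For $\mu_0=0$ the condition in (ii) reads $\int(\chi-|z|^2\overline\chi)(1+|z|^2)^{-2}\,dm\ne0$ if $\nu_0=\pm i$, and $\int(\chi+|z|^2\overline\chi)(1+|z|^2)^{-2}\,dm\ne0$ if $\nu_0=1$.) -/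

import Mathlib

open MeasureTheory

noncomputable section

namespace DSII

/-- Test functions: complex-valued functions on the plane, smooth in the real sense and with
compact support. -/
def IsTestFunction (η : ℂ → ℂ) : Prop :=
  ContDiff ℝ (⊤ : ℕ∞) η ∧ HasCompactSupport η

/-- The operator `∂ = (∂_x - i ∂_y) / 2` on (real-differentiable) functions. -/
def wirtingerD (η : ℂ → ℂ) (z : ℂ) : ℂ :=
  (1 / 2) * (fderiv ℝ η z 1 - Complex.I * fderiv ℝ η z Complex.I)

/-- The operator `∂̄ = (∂_x + i ∂_y) / 2` on (real-differentiable) functions. -/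
def wirtingerDbar (η : ℂ → ℂ) (z : ℂ) : ℂ :=
  (1 / 2) * (fderiv ℝ η z 1 + Complex.I * fderiv ℝ η z Complex.I)

/-- `∂ f = g` in the sense of distributions, for locally integrable `f` and `g`. -/
def HasWeakD (f g : ℂ → ℂ) : Prop :=
  LocallyIntegrable f volume ∧ LocallyIntegrable g volume ∧
    ∀ η : ℂ → ℂ, IsTestFunction η →
      ∫ z, f z * wirtingerD η z = -∫ z, g z * η z

/-- `∂̄ f = g` in the sense of distributions, for locally integrable `f` and `g`. -/
def HasWeakDbar (f g : ℂ → ℂ) : Prop :=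
  LocallyIntegrable f volume ∧ LocallyIntegrable g volume ∧
    ∀ η : ℂ → ℂ, IsTestFunction η →
      ∫ z, f z * wirtingerDbar η z = -∫ z, g z * η z

/-- The unimodular exponential `e_k(z) = exp (i (k z + k̄ z̄))`. -/
def ek (k z : ℂ) : ℂ :=
  Complex.exp (Complex.I * (k * z + star k * star z))

/-- The matrix potential `Q = (0, u; -ū, 0)` of the focusing problem. -/
def potentialMatrix (u : ℂ → ℂ) (z : ℂ) : Matrix (Fin 2) (Fin 2) ℂ :=
  !![0, u z; -star (u z), 0]

/-- The right-hand side `(1/2) Q M` of the spectral problem. -/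
def rhs (u : ℂ → ℂ) (M : ℂ → Matrix (Fin 2) (Fin 2) ℂ) (z : ℂ) : Matrix (Fin 2) (Fin 2) ℂ :=
  (1 / 2 : ℂ) • (potentialMatrix u z * M z)

/-- `M` is a distributional solution of the spectral problem for the potential `u` at `k`:
`∂̄ M₁₁`, `(∂̄ - i k̄) M₁₂`, `(∂ + i k) M₂₁` and `∂ M₂₂` are the entries of `(1/2) Q M`. -/
def IsSpectralSolution (u : ℂ → ℂ) (k : ℂ) (M : ℂ → Matrix (Fin 2) (Fin 2) ℂ) : Prop :=
  HasWeakDbar (fun z => M z 0 0) (fun z => rhs u M z 0 0) ∧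
  HasWeakDbar (fun z => M z 0 1) (fun z => Complex.I * star k * M z 0 1 + rhs u M z 0 1) ∧
  HasWeakD (fun z => M z 1 0) (fun z => -(Complex.I * k * M z 1 0) + rhs u M z 1 0) ∧
  HasWeakD (fun z => M z 1 1) (fun z => rhs u M z 1 1)

/-- The exceptional set: all `k` at which the spectral problem has a solution in `L^p` that does
not vanish almost everywhere. -/
def exceptionalSet (p : ℝ) (u : ℂ → ℂ) : Set ℂ :=
  {k | ∃ M : ℂ → Matrix (Fin 2) (Fin 2) ℂ,
    (∀ i j, MemLp (fun z => M z i j) (ENNReal.ofReal p) volume) ∧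
    ¬ (M =ᵐ[volume] fun _ => 0) ∧
    IsSpectralSolution u k M}

/-- The one-soliton potential `u₀(z) = 2 ν̄₀ e_{k₀}(z) / (|z + μ₀|² + |ν₀|²)`. -/
def soliton (k₀ ν₀ μ₀ z : ℂ) : ℂ :=
  2 * star ν₀ * ek k₀ z / ((‖z + μ₀‖ ^ 2 + ‖ν₀‖ ^ 2 : ℝ) : ℂ)

/-- The integral `∫ (ν₀² χ + |z + μ₀|² χ̄) (|z + μ₀|² + |ν₀|²)⁻² dm`, where
`χ = e_{-k₀} φ`. For `ν₀² = -1` and `μ₀ = 0` it is `-∫ (χ - |z|² χ̄) (1 + |z|²)⁻² dm`. -/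
def splittingIntegral (k₀ ν₀ μ₀ : ℂ) (φ : ℂ → ℂ) : ℂ :=
  ∫ z, (ν₀ ^ 2 * (ek (-k₀) z * φ z) +
      ((‖z + μ₀‖ ^ 2 : ℝ) : ℂ) * star (ek (-k₀) z * φ z)) /
    (((‖z + μ₀‖ ^ 2 + ‖ν₀‖ ^ 2) ^ 2 : ℝ) : ℂ)

end DSII

end

/-! The two columns of M decouple. After conjugations and multiplication by an exponential, a
nonzero column becomes a nonzero pair (f, w) in L^p with ∂̄f = q w̄ and ∂̄w = -q f̄, where q = ½ c u
e_{-k} and c is a free unimodular constant (`exists_pair_of_mem_exceptionalSet`). Put ℓ = k - k₀, ρ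
= |z+μ|² + |ν|² and E(z) = e_{-ℓ}(z+μ). A suitable c gives q = E ν̄/ρ for the soliton, and q = E
(ν̄/ρ + ½ εχ) for the perturbed potential. Since q = O(|z|⁻²) and p > 2, f and w are the Cauchy
transforms of their right-hand sides. After normalisation in L^p they satisfy decay bounds A/(1+|z|)
and Hölder bounds of exponent 1/2, with A independent of k and of ε in [0,1]
(`exists_isRegularPair`).

For the soliton, the combinations X = (z+μ) f + ν̄ E w̄ and Y = ν f - conj(z+μ) E w̄ are bounded and
annihilated by (∂ + iℓ)∂̄. A Liouville theorem (`liouville_weak`) puts them in the span of 1 and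
e_{-ℓ}. Substitution back into the system leaves only zero when ℓ ≠ 0, so only k₀ can be
exceptional. When ℓ = 0 it leaves an explicit family with two complex parameters, all obtained from
the bound state (conj(z+μ)/ρ, ν̄/ρ) by the symmetry `IsRegularPair.rotate`.

For (ii), suppose that exceptional points k_n exist for some ε_n → 0. Normalised pairs converge
along a subsequence (Arzelà–Ascoli), and the decay bound prevents loss of mass, so the limit is
nonzero. Frequencies ℓ_n = k_n - k₀ going to infinity are excluded by the Riemann–Lebesgue lemma,
and a limit ℓ₀ ≠ 0 by the soliton analysis. Hence ℓ_n → 0 along a subsequence, and after a rotation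
the limit is the bound state.

Pairing the equations with the two cokernel elements of the soliton problem
(`IsRegularPair.solvability`) gives two homogeneous linear relations. If ℓ_n ≠ 0 their unknowns are
(|ℓ_n|, ε_n), so a 2×2 determinant vanishes. In the limit the frequency column is (nonzero, 0): the
first entry is a positivity statement, the second vanishes by oddness. The second entry of the ε
column must then vanish, and it is half the splitting integral. If ℓ_n = 0 infinitely often, the
second relation alone gives the same conclusion. -/

open scoped ComplexConjugate ContDiff Real
open Filter Topology

namespace DSII

/-! ### Wirtinger calculus -/

section Wirtinger

variable {f g : ℂ → ℂ} {z : ℂ}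

theorem wirtingerDbar_eq_of_hasFDerivAt {f' : ℂ →L[ℝ] ℂ} (h : HasFDerivAt f f' z) :
    wirtingerDbar f z = (1 / 2) * (f' 1 + Complex.I * f' Complex.I) := by
  rw [wirtingerDbar, h.fderiv]

theorem wirtingerD_eq_of_hasFDerivAt {f' : ℂ →L[ℝ] ℂ} (h : HasFDerivAt f f' z) :
    wirtingerD f z = (1 / 2) * (f' 1 - Complex.I * f' Complex.I) := by
  rw [wirtingerD, h.fderiv]

theorem fderiv_apply_eq_wirtinger (v : ℂ) :
    fderiv ℝ f z v = v * wirtingerD f z + conj v * wirtingerDbar f z := by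
  have h : v = v.re • (1 : ℂ) + v.im • Complex.I := by
    simp [Complex.re_add_im]
  have h1 : fderiv ℝ f z v = v.re * fderiv ℝ f z 1 + v.im * fderiv ℝ f z Complex.I := by
    conv_lhs => rw [h]
    rw [map_add, map_smul, map_smul]
    simp
  have hc : conj v = v.re - v.im * Complex.I := by
    apply Complex.ext <;> simp
  rw [h1, wirtingerD, wirtingerDbar, hc]
  conv_rhs => rw [← Complex.re_add_im v]
  simp only [Complex.add_re, Complex.ofReal_re, Complex.mul_re, Complex.I_re, mul_zero,
    Complex.ofReal_im, Complex.I_im, mul_one, sub_self, add_zero, Complex.add_im, Complex.mul_im,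
    zero_add]
  linear_combination (v.im * fderiv ℝ f z Complex.I) * Complex.I_sq

theorem wirtingerDbar_mul (hf : DifferentiableAt ℝ f z) (hg : DifferentiableAt ℝ g z) :
    wirtingerDbar (fun x => f x * g x) z = f z * wirtingerDbar g z + wirtingerDbar f z * g z := by
  have h : HasFDerivAt (fun x => f x * g x) _ z := hf.hasFDerivAt.mul hg.hasFDerivAt
  rw [wirtingerDbar_eq_of_hasFDerivAt h, wirtingerDbar, wirtingerDbar]
  simp
  ring

theorem wirtingerD_mul (hf : DifferentiableAt ℝ f z) (hg : DifferentiableAt ℝ g z) :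
    wirtingerD (fun x => f x * g x) z = f z * wirtingerD g z + wirtingerD f z * g z := by
  have h : HasFDerivAt (fun x => f x * g x) _ z := hf.hasFDerivAt.mul hg.hasFDerivAt
  rw [wirtingerD_eq_of_hasFDerivAt h, wirtingerD, wirtingerD]
  simp
  ring

theorem wirtingerDbar_add (hf : DifferentiableAt ℝ f z) (hg : DifferentiableAt ℝ g z) :
    wirtingerDbar (fun x => f x + g x) z = wirtingerDbar f z + wirtingerDbar g z := by
  have h : HasFDerivAt (fun x => f x + g x) _ z := hf.hasFDerivAt.add hg.hasFDerivAt
  rw [wirtingerDbar_eq_of_hasFDerivAt h, wirtingerDbar, wirtingerDbar]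
  simp
  ring

theorem wirtingerD_add (hf : DifferentiableAt ℝ f z) (hg : DifferentiableAt ℝ g z) :
    wirtingerD (fun x => f x + g x) z = wirtingerD f z + wirtingerD g z := by
  have h : HasFDerivAt (fun x => f x + g x) _ z := hf.hasFDerivAt.add hg.hasFDerivAt
  rw [wirtingerD_eq_of_hasFDerivAt h, wirtingerD, wirtingerD]
  simp
  ring

theorem wirtingerDbar_const (c : ℂ) : wirtingerDbar (fun _ => c) z = 0 := by
  simp [wirtingerDbar]

theorem wirtingerD_const (c : ℂ) : wirtingerD (fun _ => c) z = 0 := by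
  simp [wirtingerD]

theorem wirtingerDbar_const_mul (c : ℂ) (hf : DifferentiableAt ℝ f z) :
    wirtingerDbar (fun x => c * f x) z = c * wirtingerDbar f z := by
  rw [wirtingerDbar_mul (differentiableAt_const c) hf, wirtingerDbar_const]
  ring

theorem wirtingerD_const_mul (c : ℂ) (hf : DifferentiableAt ℝ f z) :
    wirtingerD (fun x => c * f x) z = c * wirtingerD f z := by
  rw [wirtingerD_mul (differentiableAt_const c) hf, wirtingerD_const]
  ring

theorem hasFDerivAt_conj (hf : DifferentiableAt ℝ f z) :
    HasFDerivAt (fun x => conj (f x)) (Complex.conjCLE.toContinuousLinearMap.comp (fderiv ℝ f z))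
      z :=
  Complex.conjCLE.toContinuousLinearMap.hasFDerivAt.comp z hf.hasFDerivAt

theorem wirtingerD_conj (hf : DifferentiableAt ℝ f z) :
    wirtingerD (fun x => conj (f x)) z = conj (wirtingerDbar f z) := by
  rw [wirtingerD_eq_of_hasFDerivAt (hasFDerivAt_conj hf), wirtingerDbar]
  simp [sub_eq_add_neg, map_ofNat]

theorem wirtingerDbar_conj (hf : DifferentiableAt ℝ f z) :
    wirtingerDbar (fun x => conj (f x)) z = conj (wirtingerD f z) := by
  rw [wirtingerDbar_eq_of_hasFDerivAt (hasFDerivAt_conj hf), wirtingerD]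
  simp [sub_eq_add_neg, map_ofNat]

theorem wirtingerDbar_of_differentiableAt (hf : DifferentiableAt ℂ f z) :
    wirtingerDbar f z = 0 := by
  rw [wirtingerDbar_eq_of_hasFDerivAt (hf.hasFDerivAt.restrictScalars ℝ)]
  have : fderiv ℂ f z Complex.I = Complex.I * fderiv ℂ f z 1 := by
    rw [← smul_eq_mul, ← map_smul]; simp
  simp only [ContinuousLinearMap.coe_restrictScalars', this]
  linear_combination (1 / 2 * fderiv ℂ f z 1) * Complex.I_sq

theorem wirtingerD_of_differentiableAt (hf : DifferentiableAt ℂ f z) :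
    wirtingerD f z = deriv f z := by
  rw [wirtingerD_eq_of_hasFDerivAt (hf.hasFDerivAt.restrictScalars ℝ)]
  have : fderiv ℂ f z Complex.I = Complex.I * fderiv ℂ f z 1 := by
    rw [← smul_eq_mul, ← map_smul]; simp
  simp only [ContinuousLinearMap.coe_restrictScalars', this, ← fderiv_apply_one_eq_deriv]
  linear_combination (- 1 / 2 * fderiv ℂ f z 1) * Complex.I_sq

/-- With ∂̄f = 0 the real differential is multiplication by ∂f, hence complex linear. -/
theorem differentiableAt_complex_of_wirtingerDbar_eq_zero (hf : DifferentiableAt ℝ f z)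
    (h : wirtingerDbar f z = 0) : DifferentiableAt ℂ f z := by
  have h' : ((wirtingerD f z) • ContinuousLinearMap.id ℂ ℂ).restrictScalars ℝ = fderiv ℝ f z := by
    ext v
    simp [fderiv_apply_eq_wirtinger, h, mul_comm]
  exact (hasFDerivAt_of_restrictScalars ℝ hf.hasFDerivAt h').differentiableAt

theorem wirtingerDbar_comp_add (c : ℂ) :
    wirtingerDbar (fun x => f (x + c)) z = wirtingerDbar f (z + c) := by
  simp only [wirtingerDbar, fderiv_comp_add_right]

theorem wirtingerD_comp_add (c : ℂ) :
    wirtingerD (fun x => f (x + c)) z = wirtingerD f (z + c) := by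
  simp only [wirtingerD, fderiv_comp_add_right]

theorem contDiff_wirtingerDbar (hf : ContDiff ℝ (⊤ : ℕ∞) f) :
    ContDiff ℝ (⊤ : ℕ∞) (wirtingerDbar f) := by
  have h : ContDiff ℝ (⊤ : ℕ∞) (fderiv ℝ f) := hf.fderiv_right (by norm_cast)
  unfold wirtingerDbar
  fun_prop

theorem contDiff_wirtingerD (hf : ContDiff ℝ (⊤ : ℕ∞) f) :
    ContDiff ℝ (⊤ : ℕ∞) (wirtingerD f) := by
  have h : ContDiff ℝ (⊤ : ℕ∞) (fderiv ℝ f) := hf.fderiv_right (by norm_cast)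
  unfold wirtingerD
  fun_prop

theorem contDiff_conj_comp (hf : ContDiff ℝ (⊤ : ℕ∞) f) :
    ContDiff ℝ (⊤ : ℕ∞) (fun x => conj (f x)) :=
  Complex.conjCLE.contDiff.comp hf

theorem differentiableAt_of_contDiff (hf : ContDiff ℝ (⊤ : ℕ∞) f) : DifferentiableAt ℝ f z :=
  hf.contDiffAt.differentiableAt (by simp)

theorem wirtinger_comm (hf : ContDiff ℝ (⊤ : ℕ∞) f) :
    wirtingerD (wirtingerDbar f) z = wirtingerDbar (wirtingerD f) z := by
  have h : ContDiff ℝ (⊤ : ℕ∞) (fderiv ℝ f) := hf.fderiv_right (by norm_cast)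
  have hd : DifferentiableAt ℝ (fderiv ℝ f) z := h.contDiffAt.differentiableAt (by simp)
  have hsymm : IsSymmSndFDerivAt ℝ f z := by
    refine (hf.contDiffAt).isSymmSndFDerivAt ?_
    simp only [minSmoothness_of_isRCLikeNormedField]
    exact WithTop.coe_le_coe.2 le_top
  have key (v : ℂ) : HasFDerivAt (fun x => fderiv ℝ f x v)
      ((ContinuousLinearMap.apply ℝ ℂ v).comp (fderiv ℝ (fderiv ℝ f) z)) z :=
    (ContinuousLinearMap.apply ℝ ℂ v).hasFDerivAt.comp z hd.hasFDerivAt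
  have h1 : HasFDerivAt (wirtingerDbar f) _ z :=
    ((key 1).add ((key Complex.I).const_mul Complex.I)).const_mul (1 / 2)
  have h2 : HasFDerivAt (wirtingerD f) _ z :=
    ((key 1).sub ((key Complex.I).const_mul Complex.I)).const_mul (1 / 2)
  rw [wirtingerD_eq_of_hasFDerivAt h1, wirtingerDbar_eq_of_hasFDerivAt h2]
  have := hsymm 1 Complex.I
  simp
  rw [this]
  ring

end Wirtinger

/-! ### Test functions -/

namespace IsTestFunction

variable {η S : ℂ → ℂ}

theorem hasCompactSupport (h : IsTestFunction η) : HasCompactSupport η := h.2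

theorem differentiableAt (h : IsTestFunction η) {z : ℂ} : DifferentiableAt ℝ η z :=
  differentiableAt_of_contDiff h.1

theorem continuous (h : IsTestFunction η) : Continuous η := h.1.continuous

theorem integrable (h : IsTestFunction η) : Integrable η :=
  h.continuous.integrable_of_hasCompactSupport h.2

theorem mul (h : IsTestFunction η) (hS : ContDiff ℝ (⊤ : ℕ∞) S) :
    IsTestFunction (fun z => S z * η z) :=
  ⟨hS.mul h.1, h.2.mul_left⟩

theorem add {η' : ℂ → ℂ} (h : IsTestFunction η) (h' : IsTestFunction η') :
    IsTestFunction (fun z => η z + η' z) :=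
  ⟨h.1.add h'.1, h.2.add h'.2⟩

theorem star (h : IsTestFunction η) : IsTestFunction (fun z => conj (η z)) :=
  ⟨contDiff_conj_comp h.1, h.2.comp_left (map_zero _)⟩

theorem wirtingerDbar (h : IsTestFunction η) : IsTestFunction (wirtingerDbar η) := by
  refine ⟨contDiff_wirtingerDbar h.1, ?_⟩
  refine (h.2.fderiv (𝕜 := ℝ)).mono ?_
  intro x hx h0
  apply hx
  simp [DSII.wirtingerDbar, h0]

theorem wirtingerD (h : IsTestFunction η) : IsTestFunction (wirtingerD η) := by
  refine ⟨contDiff_wirtingerD h.1, ?_⟩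
  refine (h.2.fderiv (𝕜 := ℝ)).mono ?_
  intro x hx h0
  apply hx
  simp [DSII.wirtingerD, h0]

theorem integrable_mul (h : IsTestFunction η) {f : ℂ → ℂ} (hf : LocallyIntegrable f) :
    Integrable (fun z => f z * η z) := by
  simpa [mul_comm] using hf.integrable_smul_left_of_hasCompactSupport h.continuous h.2

end IsTestFunction

/-! ### Weak Wirtinger derivatives -/

theorem integral_mul_wirtingerDbar {S η : ℂ → ℂ} (hS : ContDiff ℝ (⊤ : ℕ∞) S)
    (hη : IsTestFunction η) :
    ∫ z, S z * wirtingerDbar η z = -∫ z, wirtingerDbar S z * η z := by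
  have hη1 : ContDiff ℝ (⊤ : ℕ∞) (fderiv ℝ η) := hη.1.fderiv_right (by norm_cast)
  have hS1 : ContDiff ℝ (⊤ : ℕ∞) (fderiv ℝ S) := hS.fderiv_right (by norm_cast)
  have i1 (v : ℂ) : Integrable (fun z => S z * fderiv ℝ η z v) := by
    refine Continuous.integrable_of_hasCompactSupport ?_ ?_
    · exact hS.continuous.mul (hη1.continuous.clm_apply continuous_const)
    · exact (hη.2.fderiv_apply (𝕜 := ℝ) v).mul_left
  have i2 (v : ℂ) : Integrable (fun z => fderiv ℝ S z v * η z) := by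
    refine Continuous.integrable_of_hasCompactSupport ?_ ?_
    · exact (hS1.continuous.clm_apply continuous_const).mul hη.continuous
    · exact hη.2.mul_left
  have i3 : Integrable (fun z => S z * η z) :=
    Continuous.integrable_of_hasCompactSupport (hS.continuous.mul hη.continuous) hη.2.mul_left
  have key (v : ℂ) : ∫ z, S z * fderiv ℝ η z v = -∫ z, fderiv ℝ S z v * η z :=
    integral_mul_fderiv_eq_neg_fderiv_mul_of_integrable (i2 v) (i1 v) i3
      (fun x _ => hS.differentiable (by simp) x) (fun x _ => hη.1.differentiable (by simp) x)
  have e1 : ∀ z, S z * wirtingerDbar η z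
      = (1 / 2) * (S z * fderiv ℝ η z 1 + Complex.I * (S z * fderiv ℝ η z Complex.I)) := by
    intro z; simp only [wirtingerDbar]; ring
  have e2 : ∀ z, wirtingerDbar S z * η z
      = (1 / 2) * (fderiv ℝ S z 1 * η z + Complex.I * (fderiv ℝ S z Complex.I * η z)) := by
    intro z; simp only [wirtingerDbar]; ring
  simp_rw [e1, e2]
  rw [integral_const_mul, integral_const_mul, integral_add (i1 1) ((i1 _).const_mul _),
    integral_add (i2 1) ((i2 _).const_mul _), integral_const_mul, integral_const_mul, key, key]
  ring

theorem hasWeakDbar_of_contDiff {S : ℂ → ℂ} (hS : ContDiff ℝ (⊤ : ℕ∞) S) :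
    HasWeakDbar S (wirtingerDbar S) :=
  ⟨hS.continuous.locallyIntegrable, (contDiff_wirtingerDbar hS).continuous.locallyIntegrable,
    fun _ hη => integral_mul_wirtingerDbar hS hη⟩

theorem locallyIntegrable_continuous_mul {f S : ℂ → ℂ} (hf : LocallyIntegrable f)
    (hS : Continuous S) : LocallyIntegrable (fun z => S z * f z) := by
  rw [← locallyIntegrableOn_univ] at hf ⊢
  exact hf.continuousOn_mul hS.continuousOn isOpen_univ.isLocallyClosed

theorem locallyIntegrable_conj {f : ℂ → ℂ} (hf : LocallyIntegrable f) :
    LocallyIntegrable (fun z => conj (f z)) := fun x => by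
  obtain ⟨s, hs, h⟩ := hf x
  exact ⟨s, hs, (Complex.conjCLE.toContinuousLinearMap.integrable_comp h : _)⟩

theorem HasWeakDbar.mul {f g S : ℂ → ℂ} (h : HasWeakDbar f g) (hS : ContDiff ℝ (⊤ : ℕ∞) S) :
    HasWeakDbar (fun z => S z * f z) (fun z => S z * g z + wirtingerDbar S z * f z) := by
  have hc := (contDiff_wirtingerDbar hS).continuous
  refine ⟨locallyIntegrable_continuous_mul h.1 hS.continuous,
    (locallyIntegrable_continuous_mul h.2.1 hS.continuous).add
      (locallyIntegrable_continuous_mul h.1 hc), fun η hη => ?_⟩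
  have h1 := h.2.2 _ (hη.mul hS)
  have e1 : ∀ z, f z * wirtingerDbar (fun z => S z * η z) z
      = S z * f z * wirtingerDbar η z + wirtingerDbar S z * f z * η z := by
    intro z
    rw [wirtingerDbar_mul (differentiableAt_of_contDiff hS) hη.differentiableAt]
    ring
  have i0 := hη.integrable_mul (locallyIntegrable_continuous_mul h.1 hc)
  have i1 := hη.wirtingerDbar.integrable_mul (locallyIntegrable_continuous_mul h.1 hS.continuous)
  have i2 := hη.integrable_mul (locallyIntegrable_continuous_mul h.2.1 hS.continuous)
  simp_rw [e1] at h1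
  rw [integral_add i1 i0] at h1
  simp_rw [add_mul]
  rw [integral_add i2 i0]
  have e2 : ∀ z, g z * (S z * η z) = S z * g z * η z := fun z => by ring
  simp_rw [e2] at h1
  linear_combination h1

theorem HasWeakDbar.conj {f g : ℂ → ℂ} (h : HasWeakDbar f g) :
    HasWeakD (fun z => conj (f z)) (fun z => conj (g z)) := by
  refine ⟨locallyIntegrable_conj h.1, locallyIntegrable_conj h.2.1, fun η hη => ?_⟩
  have h1 := congrArg conj (h.2.2 _ hη.star)
  rw [map_neg, ← integral_conj, ← integral_conj] at h1
  simpa only [map_mul, wirtingerDbar_conj hη.differentiableAt, Complex.conj_conj] using h1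

theorem HasWeakD.conj {f g : ℂ → ℂ} (h : HasWeakD f g) :
    HasWeakDbar (fun z => conj (f z)) (fun z => conj (g z)) := by
  refine ⟨locallyIntegrable_conj h.1, locallyIntegrable_conj h.2.1, fun η hη => ?_⟩
  have h1 := congrArg conj (h.2.2 _ hη.star)
  rw [map_neg, ← integral_conj, ← integral_conj] at h1
  simpa only [map_mul, wirtingerD_conj hη.differentiableAt, Complex.conj_conj] using h1

theorem HasWeakDbar.congr_ae {f g f' g' : ℂ → ℂ} (h : HasWeakDbar f g) (hf : f =ᵐ[volume] f')
    (hg : g =ᵐ[volume] g') : HasWeakDbar f' g' := by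
  refine ⟨h.1.congr hf, h.2.1.congr hg, fun η hη => ?_⟩
  have e1 : (fun z => f z * wirtingerDbar η z) =ᵐ[volume] fun z => f' z * wirtingerDbar η z :=
    hf.mono fun z hz => by simp only [hz]
  have e2 : (fun z => g z * η z) =ᵐ[volume] fun z => g' z * η z :=
    hg.mono fun z hz => by simp only [hz]
  rw [← integral_congr_ae e1, ← integral_congr_ae e2]
  exact h.2.2 η hη

theorem HasWeakDbar.add {f g f' g' : ℂ → ℂ} (h : HasWeakDbar f g) (h' : HasWeakDbar f' g') :
    HasWeakDbar (fun z => f z + f' z) (fun z => g z + g' z) := by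
  refine ⟨h.1.add h'.1, h.2.1.add h'.2.1, fun η hη => ?_⟩
  simp_rw [add_mul]
  rw [integral_add (hη.wirtingerDbar.integrable_mul h.1) (hη.wirtingerDbar.integrable_mul h'.1),
    integral_add (hη.integrable_mul h.2.1) (hη.integrable_mul h'.2.1), h.2.2 η hη, h'.2.2 η hη]
  ring

theorem HasWeakDbar.const_mul {f g : ℂ → ℂ} (h : HasWeakDbar f g) (c : ℂ) :
    HasWeakDbar (fun z => c * f z) (fun z => c * g z) := by
  simpa [wirtingerDbar_const] using h.mul (contDiff_const (c := c))

/-! ### Integrability of power weights on the plane -/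

/-- In polar coordinates the radial density is r^{1-s}(1+r)^{-t}: s < 2 gives convergence at the
origin, s + t > 2 at infinity. -/
theorem integrable_norm_rpow_mul {s t : ℝ} (hs : s < 2) (hst : 2 < s + t) :
    Integrable (fun z : ℂ => ‖z‖ ^ (-s) * (1 + ‖z‖) ^ (-t)) := by
  refine (integrable_fun_norm_addHaar (volume : Measure ℂ)
    (f := fun y : ℝ => y ^ (-s) * (1 + y) ^ (-t))).2 ?_
  have hm : Measurable (fun y : ℝ => y ^ (Module.finrank ℝ ℂ - 1) •
    (y ^ (-s) * (1 + y) ^ (-t))) := by fun_prop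
  rw [← Set.Ioc_union_Ioi_eq_Ioi (zero_le_one (α := ℝ))]
  refine IntegrableOn.union ?_ ?_
  · have h : IntegrableOn (fun y : ℝ => y ^ (1 - s)) (Set.Ioc 0 1) := by
      have := intervalIntegral.intervalIntegrable_rpow' (a := 0) (b := 1) (r := 1 - s)
        (by linarith)
      rwa [intervalIntegrable_iff_integrableOn_Ioc_of_le zero_le_one] at this
    refine Integrable.mono' h hm.aestronglyMeasurable ?_
    refine (ae_restrict_iff' measurableSet_Ioc).2 (.of_forall fun y hy => ?_)
    have hy0 : 0 < y := hy.1
    have h1 : (1 + y) ^ (-t) ≤ 1 := Real.rpow_le_one_of_one_le_of_nonpos (by linarith) (by linarith)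
    have h2 : 0 < y ^ (-s) := Real.rpow_pos_of_pos hy0 _
    rw [Real.norm_of_nonneg (by simp; positivity), Complex.finrank_real_complex,
      sub_eq_add_neg, Real.rpow_add hy0]
    simp only [Nat.add_one_sub_one, pow_one, smul_eq_mul, Real.rpow_one]
    exact mul_le_mul_of_nonneg_left (mul_le_of_le_one_right h2.le h1) hy0.le
  · have h : IntegrableOn (fun y : ℝ => y ^ (1 - s - t)) (Set.Ioi 1) :=
      integrableOn_Ioi_rpow_of_lt (by linarith) one_pos
    refine Integrable.mono' h hm.aestronglyMeasurable ?_
    refine (ae_restrict_iff' measurableSet_Ioi).2 (.of_forall fun y hy => ?_)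
    have hy0 : 0 < y := zero_lt_one.trans hy
    have h1 : (1 + y) ^ (-t) ≤ y ^ (-t) :=
      Real.rpow_le_rpow_of_nonpos hy0 (by linarith) (by linarith)
    have h2 : 0 < y ^ (-s) := Real.rpow_pos_of_pos hy0 _
    rw [Real.norm_of_nonneg (by simp; positivity), Complex.finrank_real_complex,
      sub_eq_add_neg, Real.rpow_add hy0, sub_eq_add_neg, Real.rpow_add hy0]
    simp only [Nat.add_one_sub_one, pow_one, smul_eq_mul, Real.rpow_one, mul_assoc]
    exact mul_le_mul_of_nonneg_left (mul_le_mul_of_nonneg_left h1 h2.le) hy0.le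

theorem integrable_one_add_norm_rpow {t : ℝ} (ht : 2 < t) :
    Integrable (fun z : ℂ => (1 + ‖z‖) ^ (-t)) := by
  simpa using integrable_norm_rpow_mul (s := 0) (t := t) (by norm_num) (by linarith)

theorem integrable_const_div_one_add_norm_pow (K : ℝ) {n : ℕ} (hn : 2 < n) :
    Integrable (fun z : ℂ => K / (1 + ‖z‖) ^ n) := by
  have h := (integrable_one_add_norm_rpow (t := n) (by exact_mod_cast hn)).const_mul K
  refine h.congr (.of_forall fun z => ?_)
  simp only [Real.rpow_neg (show (0 : ℝ) ≤ 1 + ‖z‖ by positivity), Real.rpow_natCast]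
  rfl

theorem locallyIntegrable_inv : LocallyIntegrable (fun z : ℂ => z⁻¹) := by
  refine (locallyIntegrable_iff).2 fun K hK => ?_
  obtain ⟨R, hR⟩ := hK.isBounded.exists_norm_le
  have h := (integrable_norm_rpow_mul (s := 1) (t := 2) (by norm_num)
    (by norm_num)).const_mul ((1 + R) ^ 2)
  refine Integrable.mono' h.integrableOn measurable_inv.aestronglyMeasurable ?_
  refine (ae_restrict_iff' hK.measurableSet).2 (.of_forall fun z hz => ?_)
  have hz1 := hR z hz
  rw [norm_inv, Real.rpow_neg_one, Real.rpow_neg (by positivity), Real.rpow_two]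
  have h2 : (1 + ‖z‖) ^ 2 ≤ (1 + R) ^ 2 := by gcongr
  have h3 : 1 ≤ (1 + R) ^ 2 * ((1 + ‖z‖) ^ 2)⁻¹ := by
    rw [← div_eq_mul_inv, one_le_div (by positivity)]; exact h2
  have := mul_le_mul_of_nonneg_left h3 (inv_nonneg.2 (norm_nonneg z))
  linarith

/-! ### The Cauchy kernel in conjugate Lebesgue spaces -/

/-- The model for the Cauchy kernel that decays quadratically. -/
noncomputable def decayKernel (z : ℂ) : ℝ := ‖z‖ ^ (-1 : ℝ) * (1 + ‖z‖) ^ (-1 : ℝ)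

theorem decayKernel_nonneg (z : ℂ) : 0 ≤ decayKernel z := by unfold decayKernel; positivity

theorem memLp_decayKernel {q : ℝ} (h1 : 1 < q) (h2 : q < 2) :
    MemLp decayKernel (ENNReal.ofReal q) := by
  have hm : Measurable decayKernel := by unfold decayKernel; fun_prop
  rw [← integrable_norm_rpow_iff hm.aestronglyMeasurable (by simp; linarith) (by simp)]
  refine (integrable_norm_rpow_mul (s := q) (t := q) h2 (by linarith)).congr
    (.of_forall fun z => ?_)
  simp only
  rw [Real.norm_of_nonneg (decayKernel_nonneg z), ENNReal.toReal_ofReal (by linarith),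
    decayKernel, Real.mul_rpow (by positivity) (by positivity), ← Real.rpow_mul (by positivity),
    ← Real.rpow_mul (by positivity)]
  simp

theorem memLp_one_add_norm_rpow {q t : ℝ} (hq : 0 < q) (h1 : 2 < t * q) :
    MemLp (fun z : ℂ => (1 + ‖z‖) ^ (-t)) (ENNReal.ofReal q) := by
  have hm : Measurable (fun z : ℂ => (1 + ‖z‖) ^ (-t)) := by fun_prop
  rw [← integrable_norm_rpow_iff hm.aestronglyMeasurable (by simp; linarith) (by simp)]
  refine (integrable_one_add_norm_rpow h1).congr (.of_forall fun z => ?_)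
  simp only
  rw [Real.norm_of_nonneg (by positivity), ENNReal.toReal_ofReal (by linarith),
    ← Real.rpow_mul (by positivity)]
  simp

/-- Writing 1+|z| ≤ (1+|ζ|) + |z-ζ| trades the weight in z for two kernels in ζ, each in L^q for 1 <
q < 2, with norms independent of z. This is what turns Hölder's inequality into decay of the Cauchy
transform. -/
theorem one_add_norm_div_le (z ζ : ℂ) :
    (1 + ‖z‖) / ((1 + ‖ζ‖) ^ 2 * ‖z - ζ‖)
      ≤ 2 * decayKernel (z - ζ) + 2 * (1 + ‖ζ‖) ^ (-2 : ℝ) := by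
  rcases eq_or_ne z ζ with rfl | hne
  · have := decayKernel_nonneg (z - z)
    simp only [sub_self, norm_zero, mul_zero, div_zero] at this ⊢
    positivity
  have hb : 0 < ‖z - ζ‖ := norm_pos_iff.2 (sub_ne_zero.2 hne)
  have hz : ‖z‖ ≤ ‖ζ‖ + ‖z - ζ‖ := by
    simpa using norm_add_le ζ (z - ζ)
  rw [decayKernel, Real.rpow_neg_one, Real.rpow_neg_one, Real.rpow_neg (by positivity),
    Real.rpow_two]
  set a := ‖ζ‖
  set b := ‖z - ζ‖
  have ha : 0 ≤ a := norm_nonneg _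
  have e1 : (1 + ‖z‖) / ((1 + a) ^ 2 * b) ≤ (1 + a + b) / ((1 + a) ^ 2 * b) := by
    gcongr ?_ / _; linarith
  refine e1.trans ?_
  rw [div_le_iff₀ (by positivity)]
  have e2 : (2 * (b⁻¹ * (1 + b)⁻¹) + 2 * ((1 + a) ^ 2)⁻¹) * ((1 + a) ^ 2 * b)
    = (2 * (1 + a) ^ 2 + 2 * b * (1 + b)) / (1 + b) := by field_simp
  rw [e2, le_div_iff₀ (by positivity)]
  nlinarith [sq_nonneg (1 + a - b), mul_nonneg ha hb.le]

theorem integral_norm_mul_le {p q : ℝ} (hpq : p.HolderConjugate q) {w : ℂ → ℂ}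
    (hw : MemLp w (ENNReal.ofReal p)) (hw1 : ∫ z, ‖w z‖ ^ p ≤ 1) {κ : ℂ → ℝ}
    (hκ : MemLp κ (ENNReal.ofReal q)) (h0 : ∀ z, 0 ≤ κ z) :
    Integrable (fun z => ‖w z‖ * κ z) ∧
      ∫ z, ‖w z‖ * κ z ≤ (∫ z, κ z ^ q) ^ (1 / q) := by
  have : (ENNReal.ofReal p).HolderConjugate (ENNReal.ofReal q) := hpq.ennrealOfReal
  refine ⟨hw.norm.integrable_mul hκ, ?_⟩
  refine (integral_mul_le_Lp_mul_Lq_of_nonneg hpq (.of_forall fun z => norm_nonneg _)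
    (.of_forall h0) hw.norm hκ).trans ?_
  refine mul_le_of_le_one_left (Real.rpow_nonneg (integral_nonneg fun z =>
    Real.rpow_nonneg (h0 z) _) _) ?_
  refine Real.rpow_le_one (integral_nonneg fun z => by positivity) hw1 ?_
  have := hpq.pos
  positivity

/-- Weighted bound for the Cauchy transform of `g` when `|g| ≤ K |w| / (1 + |ζ|)²` and `w` has
`L^p` norm at most one. -/
theorem exists_cauchyKernel_bound {p : ℝ} (hp : 2 < p) {K : ℝ} (hK : 0 ≤ K) :
    ∃ A : ℝ, 0 ≤ A ∧ ∀ w g : ℂ → ℂ, MemLp w (ENNReal.ofReal p) → ∫ z, ‖w z‖ ^ p ≤ 1 →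
      AEStronglyMeasurable g → (∀ᵐ z, ‖g z‖ ≤ K * ‖w z‖ / (1 + ‖z‖) ^ 2) →
      ∀ z, Integrable (fun ζ => g ζ / (z - ζ)) ∧ ∫ ζ, ‖g ζ / (z - ζ)‖ ≤ A / (1 + ‖z‖) := by
  set q := p.conjExponent with hq
  have hpq : p.HolderConjugate q := Real.HolderConjugate.conjExponent (by linarith)
  have hq1 : 1 < q := hpq.symm.lt
  -- Here p > 2 is decisive: |z|⁻¹ is locally q-integrable in the plane only for q < 2.
  have hq2 : q < 2 := by
    rw [hq, Real.conjExponent, div_lt_iff₀ (by linarith)]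
    linarith
  set C1 := (∫ z : ℂ, decayKernel z ^ q) ^ (1 / q)
  set C2 := (∫ z : ℂ, ((1 + ‖z‖) ^ (-2 : ℝ)) ^ q) ^ (1 / q)
  have hC1 : 0 ≤ C1 := Real.rpow_nonneg (integral_nonneg fun z =>
    Real.rpow_nonneg (decayKernel_nonneg z) _) _
  have hC2 : 0 ≤ C2 := Real.rpow_nonneg (integral_nonneg fun z => by positivity) _
  refine ⟨K * (2 * C1 + 2 * C2), by positivity, fun w g hw hw1 hg hgw z => ?_⟩
  have hk : MemLp (fun ζ => decayKernel (z - ζ)) (ENNReal.ofReal q) :=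
    (memLp_decayKernel hq1 hq2).comp_measurePreserving (Measure.measurePreserving_sub_left volume z)
  obtain ⟨i1, b1⟩ := integral_norm_mul_le hpq hw hw1 hk (fun ζ => decayKernel_nonneg _)
  obtain ⟨i2, b2⟩ := integral_norm_mul_le hpq hw hw1
    (memLp_one_add_norm_rpow (q := q) (t := 2) (by linarith) (by linarith))
    (fun ζ => by positivity)
  rw [integral_sub_left_eq_self (fun ζ => decayKernel ζ ^ q) volume z] at b1
  have i3 : Integrable (fun ζ => K / (1 + ‖z‖) *
      (2 * (‖w ζ‖ * decayKernel (z - ζ)) + 2 * (‖w ζ‖ * (1 + ‖ζ‖) ^ (-2 : ℝ)))) :=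
    ((i1.const_mul 2).add (i2.const_mul 2)).const_mul _
  have hbound : ∀ᵐ ζ, ‖g ζ / (z - ζ)‖ ≤ K / (1 + ‖z‖) *
      (2 * (‖w ζ‖ * decayKernel (z - ζ)) + 2 * (‖w ζ‖ * (1 + ‖ζ‖) ^ (-2 : ℝ))) := by
    filter_upwards [hgw] with ζ hζ
    have h1 := one_add_norm_div_le z ζ
    calc ‖g ζ / (z - ζ)‖ = ‖g ζ‖ / ‖z - ζ‖ := norm_div _ _
      _ ≤ (K * ‖w ζ‖ / (1 + ‖ζ‖) ^ 2) / ‖z - ζ‖ := by gcongr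
      _ = (K * ‖w ζ‖ / (1 + ‖z‖)) * ((1 + ‖z‖) / ((1 + ‖ζ‖) ^ 2 * ‖z - ζ‖)) := by
        have : (1 + ‖z‖) ≠ 0 := by positivity
        rcases eq_or_ne (‖z - ζ‖) 0 with h | h
        · simp [h]
        · field_simp
      _ ≤ (K * ‖w ζ‖ / (1 + ‖z‖)) *
          (2 * decayKernel (z - ζ) + 2 * (1 + ‖ζ‖) ^ (-2 : ℝ)) := by gcongr
      _ = _ := by ring
  have hm : AEStronglyMeasurable (fun ζ => g ζ / (z - ζ)) :=
    (hg.mul ((measurable_id.const_sub z).inv).aestronglyMeasurable).congr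
      (.of_forall fun ζ => (div_eq_mul_inv _ _).symm)
  have i4 := i3.mono' hm hbound
  refine ⟨i4, (integral_mono_ae i4.norm i3 hbound).trans ?_⟩
  rw [integral_const_mul, integral_add (i1.const_mul 2) (i2.const_mul 2), integral_const_mul,
    integral_const_mul, div_mul_eq_mul_div]
  gcongr

/-- The difference is |z-z'| over the product of the two distances. The triangle inequality spends
half a power of |z-z'| on the distances and leaves the kernels |·|^{-3/2}, still locally integrable
in the plane. -/
theorem inv_sub_inv_norm_le (z z' ζ : ℂ) (h : ζ ≠ z) (h' : ζ ≠ z') :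
    ‖(z - ζ)⁻¹ - (z' - ζ)⁻¹‖ ≤ 2 * ‖z - z'‖ ^ (1 / 2 : ℝ) *
      (‖z - ζ‖ ^ (-(3 / 2) : ℝ) + ‖z' - ζ‖ ^ (-(3 / 2) : ℝ)) := by
  have ha : 0 < ‖z - ζ‖ := norm_pos_iff.2 (sub_ne_zero.2 h.symm)
  have hb : 0 < ‖z' - ζ‖ := norm_pos_iff.2 (sub_ne_zero.2 h'.symm)
  have e : (z - ζ)⁻¹ - (z' - ζ)⁻¹ = (z' - z) / ((z - ζ) * (z' - ζ)) := by
    have h1 := sub_ne_zero.2 h.symm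
    have h2 := sub_ne_zero.2 h'.symm
    field_simp
    ring
  have htri : ‖z - z'‖ ≤ ‖z - ζ‖ + ‖z' - ζ‖ := by
    have := norm_sub_le (z - ζ) (z' - ζ); simpa using this
  rw [e, norm_div, norm_mul, norm_sub_rev z' z]
  set a := ‖z - ζ‖
  set b := ‖z' - ζ‖
  set d := ‖z - z'‖
  have hd : 0 ≤ d := norm_nonneg _
  -- Square roots as new variables turn the half-integer powers into polynomials.
  obtain ⟨x, hx, hxa⟩ : ∃ x, 0 < x ∧ a = x ^ 2 := ⟨√a, Real.sqrt_pos.2 ha, (Real.sq_sqrt ha.le).symm⟩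
  obtain ⟨y, hy, hyb⟩ : ∃ y, 0 < y ∧ b = y ^ 2 := ⟨√b, Real.sqrt_pos.2 hb, (Real.sq_sqrt hb.le).symm⟩
  obtain ⟨t, ht, htd⟩ : ∃ t, 0 ≤ t ∧ d = t ^ 2 := ⟨√d, Real.sqrt_nonneg _, (Real.sq_sqrt hd).symm⟩
  have r1 : d ^ (1 / 2 : ℝ) = t := by
    rw [htd, ← Real.sqrt_eq_rpow, Real.sqrt_sq ht]
  have r2 (u : ℝ) (hu : 0 < u) : (u ^ 2) ^ (-(3 / 2) : ℝ) = (u ^ 3)⁻¹ := by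
    rw [← Real.rpow_natCast u 2, ← Real.rpow_mul hu.le, ← Real.rpow_natCast u 3,
      ← Real.rpow_neg hu.le]
    norm_num
  rw [r1, hxa, hyb, r2 x hx, r2 y hy, htd]
  have ht2 : t ≤ x + y := by
    rw [htd, hxa, hyb] at htri
    nlinarith [mul_pos hx hy]
  have e2 : 2 * t * ((x ^ 3)⁻¹ + (y ^ 3)⁻¹) = 2 * t * (x ^ 3 + y ^ 3) / (x ^ 3 * y ^ 3) := by
    field_simp
    ring
  rw [e2, div_le_div_iff₀ (by positivity) (by positivity)]
  have h3 : t * (x * y) ≤ 2 * (x ^ 3 + y ^ 3) := by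
    have h4 : t * (x * y) ≤ (x + y) * (x * y) := by gcongr
    nlinarith [sq_nonneg (x - y), mul_pos hx hy]
  have h5 : t ^ 2 * (x ^ 3 * y ^ 3) = (t * (x * y)) * (t * (x ^ 2 * y ^ 2)) := by ring
  rw [h5]
  calc (t * (x * y)) * (t * (x ^ 2 * y ^ 2)) ≤ (2 * (x ^ 3 + y ^ 3)) * (t * (x ^ 2 * y ^ 2)) := by
        gcongr
    _ = _ := by ring

/-- The Cauchy transform `(1/π) ∫ g(ζ) / (z - ζ) dm(ζ)`. -/
noncomputable def cauchyTransform (g : ℂ → ℂ) (z : ℂ) : ℂ := (π : ℂ)⁻¹ * ∫ ζ, g ζ / (z - ζ)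

/-! ### Hölder regularity of the Cauchy transform -/

theorem norm_pi_inv_mul_le (x : ℂ) : ‖(π : ℂ)⁻¹ * x‖ ≤ ‖x‖ := by
  rw [norm_mul, norm_inv, Complex.norm_real, Real.norm_of_nonneg Real.pi_pos.le]
  refine mul_le_of_le_one_left (norm_nonneg _) (inv_le_one_of_one_le₀ ?_)
  linarith [Real.pi_gt_three]

/-- The kernel estimate `inv_sub_inv_norm_le` is integrated against the cubic weight. Splitting at
|z-ζ| = 1 bounds each resulting integral independently of z by translation invariance, so one
constant C serves all g. -/
theorem exists_cauchyTransform_holder :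
    ∃ C : ℝ, 0 ≤ C ∧ ∀ (B : ℝ) (g : ℂ → ℂ), 0 ≤ B → AEStronglyMeasurable g →
      (∀ᵐ z, ‖g z‖ ≤ B / (1 + ‖z‖) ^ 3) →
      (∀ z, Integrable (fun ζ => g ζ / (z - ζ))) →
      ∀ z z', ‖cauchyTransform g z - cauchyTransform g z'‖ ≤ C * B * ‖z - z'‖ ^ (1 / 2 : ℝ) := by
  set m : ℂ → ℝ := fun z => ‖z‖ ^ (-(3 / 2) : ℝ) * (1 + ‖z‖) ^ (-1 : ℝ) with hm
  have im : Integrable m :=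
    integrable_norm_rpow_mul (by norm_num) (by norm_num)
  set j : ℂ → ℝ := fun z => 1 / (1 + ‖z‖) ^ 3
  have ij : Integrable j := integrable_const_div_one_add_norm_pow 1 (by norm_num)
  set D := ∫ z, (2 * m z)
  set D' := ∫ z, j z
  have hm0 : ∀ z, 0 ≤ m z := fun z => by simp only [hm]; positivity
  have hD : 0 ≤ D := integral_nonneg fun z => by have := hm0 z; positivity
  have hD' : 0 ≤ D' := integral_nonneg fun z => by simp only [j]; positivity
  have key (z ζ : ℂ) : ‖z - ζ‖ ^ (-(3 / 2) : ℝ) * j ζ ≤ 2 * m (z - ζ) + j ζ := by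
    have hj0 : 0 ≤ j ζ := by simp only [j]; positivity
    have hj1 : j ζ ≤ 1 := by
      simp only [j]
      rw [div_le_one (by positivity)]
      exact one_le_pow₀ (by linarith [norm_nonneg ζ])
    have hr : 0 ≤ ‖z - ζ‖ ^ (-(3 / 2) : ℝ) := by positivity
    rcases le_total (‖z - ζ‖) 1 with h | h
    · have h1 : (2 : ℝ)⁻¹ ≤ (1 + ‖z - ζ‖) ^ (-1 : ℝ) := by
        rw [Real.rpow_neg_one]
        gcongr
        linarith
      have h2 := mul_le_mul_of_nonneg_left h1 hr
      have h3 := mul_le_mul_of_nonneg_left hj1 hr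
      simp only [hm]
      linarith
    · have h1 : ‖z - ζ‖ ^ (-(3 / 2) : ℝ) ≤ 1 :=
        Real.rpow_le_one_of_one_le_of_nonpos h (by norm_num)
      have h2 := mul_le_mul_of_nonneg_right h1 hj0
      have h3 := hm0 (z - ζ)
      linarith
  refine ⟨2 * (2 * (D + D')), by positivity, fun B g hB hg hgB hint z z' => ?_⟩
  have ims (z : ℂ) : Integrable (fun ζ => 2 * m (z - ζ) + j ζ) :=
    ((im.comp_sub_left z).const_mul 2).add ij
  have vms (z : ℂ) : ∫ ζ, (2 * m (z - ζ) + j ζ) = D + D' := by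
    rw [integral_add ((im.comp_sub_left z).const_mul 2) ij,
      integral_sub_left_eq_self (fun ζ => 2 * m ζ) volume z]
  rw [cauchyTransform, cauchyTransform, ← mul_sub, ← integral_sub (hint z) (hint z')]
  refine (norm_pi_inv_mul_le _).trans ?_
  have hae : ∀ᵐ ζ : ℂ, ζ ≠ z ∧ ζ ≠ z' := by
    have h1 : ∀ᵐ ζ : ℂ, ζ ≠ z := by simp [ae_iff, measure_singleton]
    have h2 : ∀ᵐ ζ : ℂ, ζ ≠ z' := by simp [ae_iff, measure_singleton]
    exact h1.and h2
  have hb : ∀ᵐ ζ, ‖g ζ / (z - ζ) - g ζ / (z' - ζ)‖ ≤ (2 * B * ‖z - z'‖ ^ (1 / 2 : ℝ)) *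
      ((2 * m (z - ζ) + j ζ) + (2 * m (z' - ζ) + j ζ)) := by
    filter_upwards [hgB, hae] with ζ h1 h2
    have h3 := inv_sub_inv_norm_le z z' ζ h2.1 h2.2
    rw [div_eq_mul_inv, div_eq_mul_inv, ← mul_sub, norm_mul]
    have h1' : ‖g ζ‖ ≤ B * j ζ := by rw [mul_one_div]; exact h1
    calc ‖g ζ‖ * ‖(z - ζ)⁻¹ - (z' - ζ)⁻¹‖
        ≤ (B * j ζ) * (2 * ‖z - z'‖ ^ (1 / 2 : ℝ) *
      (‖z - ζ‖ ^ (-(3 / 2) : ℝ) + ‖z' - ζ‖ ^ (-(3 / 2) : ℝ))) := by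
          gcongr
      _ = (2 * B * ‖z - z'‖ ^ (1 / 2 : ℝ)) *
        (‖z - ζ‖ ^ (-(3 / 2) : ℝ) * j ζ + ‖z' - ζ‖ ^ (-(3 / 2) : ℝ) * j ζ) := by ring
      _ ≤ _ := by
        gcongr
        · exact key z ζ
        · exact key z' ζ
  refine (norm_integral_le_of_norm_le (((ims z).add (ims z')).const_mul _) hb).trans ?_
  rw [integral_const_mul]
  simp only [Pi.add_apply]
  rw [integral_add (ims z) (ims z'), vms, vms]
  apply le_of_eq
  ring

/-! ### The Cauchy–Pompeiu formula for test functions -/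

/-- In polar coordinates the area factor r cancels the singularity, and the integrand becomes ½(∂_r
η + (i/r) ∂_θ η). The functions A and B below are these radial and angular derivatives. B integrates
to 0 over each circle by periodicity, and A integrates to -η(0) along each ray. -/
theorem integral_wirtingerDbar_div {η : ℂ → ℂ} (hη : IsTestFunction η) :
    ∫ t, wirtingerDbar η t / t = -π * η 0 := by
  set e : ℝ → ℂ := fun θ => Real.cos θ + Real.sin θ * Complex.I with he
  set A : ℝ × ℝ → ℂ := fun x => fderiv ℝ η (x.1 * e x.2) (e x.2) with hA
  set B : ℝ × ℝ → ℂ := fun x => fderiv ℝ η (x.1 * e x.2) (Complex.I * e x.2) with hB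
  have hη1 : Continuous (fderiv ℝ η) := hη.1.continuous_fderiv (by simp)
  have hec : Continuous e := by fun_prop
  have hAc : Continuous A := by
    refine Continuous.clm_apply (hη1.comp (by fun_prop)) (by fun_prop)
  have hBc : Continuous B := by
    refine Continuous.clm_apply (hη1.comp (by fun_prop)) (by fun_prop)
  have hnorm (θ : ℝ) : ‖e θ‖ = 1 := by
    simp only [he]
    push_cast
    rw [← Complex.exp_mul_I, Complex.norm_exp_ofReal_mul_I]
  have hee (θ : ℝ) : e θ * conj (e θ) = 1 := by
    rw [Complex.mul_conj, Complex.normSq_eq_norm_sq, hnorm]; simp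
  obtain ⟨R, hR⟩ : ∃ R, ∀ z : ℂ, R < ‖z‖ → fderiv ℝ η z = 0 := by
    obtain ⟨R, hR⟩ := (hη.2.fderiv (𝕜 := ℝ)).isCompact.isBounded.exists_norm_le
    refine ⟨R, fun z hz => ?_⟩
    by_contra h0
    exact absurd (hR z (subset_tsupport _ h0)) (not_le.2 hz)
  have hzero (r θ : ℝ) (hr : R < r) : fderiv ℝ η (r * e θ) = 0 := by
    apply hR
    rw [norm_mul, hnorm, mul_one, Complex.norm_real]
    exact hr.trans_le (le_abs_self r)
  have hcpt : IsCompact (Set.Icc 0 R ×ˢ Set.Icc (-π) π) := isCompact_Icc.prod isCompact_Icc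
  have htm : MeasurableSet (Set.Ioi (0 : ℝ) ×ˢ Set.Ioo (-π) π) :=
    measurableSet_Ioi.prod measurableSet_Ioo
  have hdiff : ∀ x ∈ (Set.Ioi (0 : ℝ) ×ˢ Set.Ioo (-π) π) \ (Set.Icc 0 R ×ˢ Set.Icc (-π) π),
      R < x.1 := by
    rintro ⟨r, θ⟩ ⟨⟨h1, h2⟩, h3⟩
    by_contra h4
    exact h3 ⟨⟨le_of_lt h1, not_lt.1 h4⟩, ⟨h2.1.le, h2.2.le⟩⟩
  have iA : IntegrableOn A (Set.Ioi (0 : ℝ) ×ˢ Set.Ioo (-π) π) :=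
    (hAc.continuousOn.integrableOn_compact hcpt).of_forall_sdiff_eq_zero htm
      fun x hx => by simp only [hA, hzero _ _ (hdiff x hx)]; rfl
  have iB : IntegrableOn B (Set.Ioi (0 : ℝ) ×ˢ Set.Ioo (-π) π) :=
    (hBc.continuousOn.integrableOn_compact hcpt).of_forall_sdiff_eq_zero htm
      fun x hx => by simp only [hB, hzero _ _ (hdiff x hx)]; rfl
  have hηd (z : ℂ) : HasFDerivAt η (fderiv ℝ η z) z := hη.differentiableAt.hasFDerivAt
  have vB : ∫ x in Set.Ioi (0 : ℝ) ×ˢ Set.Ioo (-π) π, B x = 0 := by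
    rw [Measure.volume_eq_prod, setIntegral_prod _ iB]
    refine (setIntegral_congr_fun measurableSet_Ioi fun r hr => ?_).trans (integral_zero' _ _)
    have hr0 : (r : ℂ) ≠ 0 := by exact_mod_cast (ne_of_gt hr)
    have hder (θ : ℝ) : HasDerivAt (fun θ : ℝ => (r : ℂ)⁻¹ * η (r * e θ)) (B (r, θ)) θ := by
      have h1 : HasDerivAt e (Complex.I * e θ) θ := by
        have h2 : HasDerivAt (fun θ : ℝ => ((Real.cos θ : ℝ) : ℂ)) ((-Real.sin θ : ℝ) : ℂ) θ :=
          (Real.hasDerivAt_cos θ).ofReal_comp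
        have h3 : HasDerivAt (fun θ : ℝ => ((Real.sin θ : ℝ) : ℂ)) ((Real.cos θ : ℝ) : ℂ) θ :=
          (Real.hasDerivAt_sin θ).ofReal_comp
        convert! h2.add (h3.mul_const Complex.I) using 1
        simp only [he]
        push_cast
        linear_combination (Complex.sin θ) * Complex.I_sq
      have h4 := ((hηd (r * e θ)).comp_hasDerivAt θ (h1.const_mul (r : ℂ))).const_mul (r : ℂ)⁻¹
      convert! h4 using 1
      have h5 : (r : ℂ) * (Complex.I * e θ) = r • (Complex.I * e θ) := by simp
      rw [h5, map_smul, Complex.real_smul, inv_mul_cancel_left₀ hr0]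
    have hcont : Continuous (fun θ => B (r, θ)) := hBc.comp (by fun_prop)
    have h6 := intervalIntegral.integral_eq_sub_of_hasDerivAt (fun θ _ => hder θ)
      (hcont.intervalIntegrable (-π) π)
    simp only [Pi.zero_apply]
    rw [← integral_Ioc_eq_integral_Ioo, ← intervalIntegral.integral_of_le (by
      linarith [Real.pi_pos]), h6]
    simp [he]
  have vA : ∫ x in Set.Ioi (0 : ℝ) ×ˢ Set.Ioo (-π) π, A x = -(2 * π) * η 0 := by
    rw [Measure.volume_eq_prod, ← Measure.prod_restrict,
      integral_prod_symm _ (by rw [Measure.prod_restrict]; exact iA)]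
    have hin (θ : ℝ) : ∫ r in Set.Ioi (0 : ℝ), A (r, θ) = - η 0 := by
      have hder (r : ℝ) : HasDerivAt (fun r : ℝ => η (r * e θ)) (A (r, θ)) r := by
        have h1 : HasDerivAt (fun r : ℝ => (r : ℂ) * e θ) (e θ) r := by
          have := (Complex.ofRealCLM.hasDerivAt (x := r)).mul_const (e θ)
          simpa using! this
        exact (hηd (r * e θ)).comp_hasDerivAt r h1
      have hcont : Continuous (fun r => A (r, θ)) := hAc.comp (by fun_prop)
      have hint : IntegrableOn (fun r => A (r, θ)) (Set.Ioi 0) :=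
        (hcont.continuousOn.integrableOn_compact (isCompact_Icc (a := 0)
          (b := R))).of_forall_sdiff_eq_zero measurableSet_Ioi fun x hx => by
            have : R < x := by
              by_contra h4
              exact hx.2 ⟨le_of_lt hx.1, not_lt.1 h4⟩
            simp only [hA, hzero _ _ this]; rfl
      have hlim : Tendsto (fun r : ℝ => η (r * e θ)) atTop (𝓝 0) := by
        obtain ⟨R', hR'⟩ := hη.2.isCompact.isBounded.exists_norm_le
        refine tendsto_const_nhds.congr' ?_
        filter_upwards [eventually_gt_atTop R'] with r hr
        by_contra h0
        have := hR' _ (subset_tsupport _ (Ne.symm h0))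
        rw [norm_mul, hnorm, mul_one, Complex.norm_real] at this
        exact absurd (this.trans_lt hr) (not_lt.2 (le_abs_self r))
      rw [integral_Ioi_of_hasDerivAt_of_tendsto' (fun r _ => hder r) hint hlim]
      simp
    simp_rw [hin]
    rw [setIntegral_const]
    simp only [Measure.real, Real.volume_Ioo, Complex.real_smul]
    rw [ENNReal.toReal_ofReal (by linarith [Real.pi_pos])]
    push_cast
    ring
  rw [← Complex.integral_comp_polarCoord_symm, polarCoord_target]
  have hfun : ∀ x ∈ Set.Ioi (0 : ℝ) ×ˢ Set.Ioo (-π) π,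
      x.1 • (wirtingerDbar η (Complex.polarCoord.symm x) / Complex.polarCoord.symm x)
        = (1 / 2 : ℂ) * (A x + Complex.I * B x) := by
    rintro ⟨r, θ⟩ ⟨hr, -⟩
    have hr0 : (r : ℂ) ≠ 0 := by exact_mod_cast (ne_of_gt hr)
    have he0 : e θ ≠ 0 := by rw [← norm_pos_iff, hnorm]; exact one_pos
    have hP : Complex.polarCoord.symm (r, θ) = r * e θ := by
      rw [Complex.polarCoord_symm_apply]
    rw [hP]
    simp only [hA, hB]
    rw [fderiv_apply_eq_wirtinger, fderiv_apply_eq_wirtinger, Complex.real_smul, map_mul,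
      Complex.conj_I]
    have hc : conj (e θ) = (e θ)⁻¹ := eq_inv_of_mul_eq_one_right (hee θ)
    rw [hc, div_eq_mul_inv, mul_inv]
    have : (r : ℂ) * (wirtingerDbar η (r * e θ) * ((r : ℂ)⁻¹ * (e θ)⁻¹))
      = wirtingerDbar η (r * e θ) * (e θ)⁻¹ := by field_simp
    rw [this]
    linear_combination (-1 / 2 * e θ * wirtingerD η (r * e θ)
      + 1 / 2 * (e θ)⁻¹ * wirtingerDbar η (r * e θ)) * Complex.I_sq
  rw [setIntegral_congr_fun htm hfun, integral_const_mul, integral_add iA (iB.const_mul _),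
    integral_const_mul, vA, vB]
  ring

theorem cauchyTransform_wirtingerDbar {η : ℂ → ℂ} (hη : IsTestFunction η) (z : ℂ) :
    cauchyTransform (wirtingerDbar η) z = η z := by
  have hη' : IsTestFunction (fun t => η (t + z)) :=
    ⟨hη.1.comp (contDiff_id.add contDiff_const),
      hη.2.comp_homeomorph (Homeomorph.addRight z)⟩
  have h := integral_wirtingerDbar_div hη'
  simp only [wirtingerDbar_comp_add, zero_add] at h
  have h2 : ∫ ζ, wirtingerDbar η ζ / (z - ζ) = ∫ t, -(wirtingerDbar η (t + z) / t) := by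
    rw [← integral_add_right_eq_self _ z]
    congr 1
    funext t
    rw [show z - (t + z) = -t by ring, div_neg]
  rw [cauchyTransform, h2, integral_neg, h]
  have : (π : ℂ) ≠ 0 := by exact_mod_cast Real.pi_ne_zero
  field_simp

theorem cauchyTransform_eq_convolution (η : ℂ → ℂ) :
    cauchyTransform η = fun z => (π : ℂ)⁻¹ *
      MeasureTheory.convolution η (fun z : ℂ => z⁻¹) (ContinuousLinearMap.mul ℝ ℂ) volume z := by
  funext z
  simp [cauchyTransform, MeasureTheory.convolution, div_eq_mul_inv]

theorem wirtinger_convolution {η k : ℂ → ℂ} (hη : IsTestFunction η) (hk : LocallyIntegrable k)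
    (z : ℂ) :
    wirtingerDbar (MeasureTheory.convolution η k (ContinuousLinearMap.mul ℝ ℂ) volume) z =
      MeasureTheory.convolution (wirtingerDbar η) k (ContinuousLinearMap.mul ℝ ℂ) volume z ∧
    wirtingerD (MeasureTheory.convolution η k (ContinuousLinearMap.mul ℝ ℂ) volume) z =
      MeasureTheory.convolution (wirtingerD η) k (ContinuousLinearMap.mul ℝ ℂ) volume z := by
  have h1 : ContDiff ℝ 1 η := hη.1.of_le (by norm_cast)
  have hd := hη.2.hasFDerivAt_convolution_left (ContinuousLinearMap.mul ℝ ℂ) h1 hk z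
  have key (v : ℂ) : (MeasureTheory.convolution (fderiv ℝ η) k
      ((ContinuousLinearMap.mul ℝ ℂ).precompL ℂ) volume z) v =
      MeasureTheory.convolution (fun x => fderiv ℝ η x v) k
      (ContinuousLinearMap.mul ℝ ℂ) volume z := by
    rw [MeasureTheory.convolution, ContinuousLinearMap.integral_apply]
    · rfl
    · exact (hη.2.fderiv (𝕜 := ℝ)).convolutionExists_left _ (h1.continuous_fderiv one_ne_zero) hk z
  have i (v : ℂ) : Integrable (fun t => fderiv ℝ η t v * k (z - t)) :=
    (hη.2.fderiv_apply (𝕜 := ℝ) v).convolutionExists_left (ContinuousLinearMap.mul ℝ ℂ)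
      ((h1.continuous_fderiv one_ne_zero).clm_apply continuous_const) hk z
  rw [wirtingerDbar_eq_of_hasFDerivAt hd, wirtingerD_eq_of_hasFDerivAt hd, key, key]
  simp only [MeasureTheory.convolution, ContinuousLinearMap.mul_apply', wirtingerDbar, wirtingerD]
  rw [← integral_const_mul, ← integral_add (i 1) ((i _).const_mul _), ← integral_const_mul,
    ← integral_sub (i 1) ((i _).const_mul _), ← integral_const_mul]
  constructor <;>
  · congr 1
    funext t
    ring

theorem contDiff_convolution {η k : ℂ → ℂ} (hη : IsTestFunction η) (hk : LocallyIntegrable k) :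
    ContDiff ℝ (⊤ : ℕ∞)
      (MeasureTheory.convolution η k (ContinuousLinearMap.mul ℝ ℂ) volume) :=
  hη.2.contDiff_convolution_left (ContinuousLinearMap.mul ℝ ℂ) hη.1 hk

theorem contDiff_cauchyTransform {η : ℂ → ℂ} (hη : IsTestFunction η) :
    ContDiff ℝ (⊤ : ℕ∞) (cauchyTransform η) := by
  rw [cauchyTransform_eq_convolution]
  exact contDiff_const.mul (contDiff_convolution hη locallyIntegrable_inv)

/-- Differentiation of the convolution falls on the test function, and the Cauchy–Pompeiu formula
finishes. -/
theorem wirtingerDbar_cauchyTransform {η : ℂ → ℂ} (hη : IsTestFunction η) (z : ℂ) :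
    wirtingerDbar (cauchyTransform η) z = η z := by
  rw [← cauchyTransform_wirtingerDbar hη z, cauchyTransform_eq_convolution (wirtingerDbar η),
    cauchyTransform_eq_convolution η, wirtingerDbar_const_mul _
      (differentiableAt_of_contDiff (contDiff_convolution hη locallyIntegrable_inv)),
    (wirtinger_convolution hη locallyIntegrable_inv z).1]

/-! ### Weak derivatives tested against decaying functions -/

theorem exists_bound_of_hasCompactSupport {η : ℂ → ℂ} (hc : Continuous η)
    (hs : HasCompactSupport η) (n : ℕ) :
    ∃ B : ℝ, 0 ≤ B ∧ ∀ z, ‖η z‖ ≤ B / (1 + ‖z‖) ^ n := by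
  have h1 : Continuous (fun z => ‖η z‖ * (1 + ‖z‖) ^ n) := by fun_prop
  have h2 : HasCompactSupport (fun z => ‖η z‖ * (1 + ‖z‖) ^ n) := hs.norm.mul_right
  obtain ⟨B, hB⟩ := h2.exists_bound_of_continuous h1
  have hB' (z : ℂ) : ‖η z‖ * (1 + ‖z‖) ^ n ≤ B := (le_abs_self _).trans (hB z)
  refine ⟨B, le_trans (by positivity) (hB' 0), fun z => ?_⟩
  rw [le_div_iff₀ (by positivity)]
  exact hB' z

theorem wirtingerDbar_comp_real_mul {Θ : ℂ → ℂ} (hΘ : Differentiable ℝ Θ) (c : ℝ) (z : ℂ) :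
    wirtingerDbar (fun x => Θ (c * x)) z = c * wirtingerDbar Θ (c * z) := by
  have h1 : HasFDerivAt (fun x : ℂ => (c : ℂ) * x) (c • ContinuousLinearMap.id ℝ ℂ) z := by
    have := (c • ContinuousLinearMap.id ℝ ℂ).hasFDerivAt (x := z)
    simpa using! this
  have h2 : HasFDerivAt (fun x => Θ (c * x)) _ z := (hΘ (c * z)).hasFDerivAt.comp z h1
  rw [wirtingerDbar_eq_of_hasFDerivAt h2, wirtingerDbar]
  simp
  ring

/-- The compactly supported cutoffs Θ(z/(n+1)) are inserted and removed by dominated convergence.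
The commutator term f η ∂̄Θ_n is dominated because both η and ∂̄Θ_n are O((1+|z|)⁻¹), uniformly in
n, and it tends to 0 pointwise. Such η are needed because Cauchy transforms of test functions are
not compactly supported. -/
theorem HasWeakDbar.integral_mul_of_decay {f g η : ℂ → ℂ} {C : ℝ} (h : HasWeakDbar f g)
    (hη : ContDiff ℝ (⊤ : ℕ∞) η) (hb : ∀ z, ‖η z‖ ≤ C / (1 + ‖z‖))
    (hf : Integrable (fun z => ‖f z‖ * (1 + ‖z‖) ^ (-2 : ℝ)))
    (h1 : Integrable (fun z => f z * wirtingerDbar η z))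
    (h2 : Integrable (fun z => g z * η z)) :
    ∫ z, f z * wirtingerDbar η z = -∫ z, g z * η z := by
  let θ : ContDiffBump (0 : ℂ) := ⟨1, 2, one_pos, one_lt_two⟩
  set Θ : ℂ → ℂ := fun z => ((θ z : ℝ) : ℂ)
  have hΘ : IsTestFunction Θ := by
    refine ⟨Complex.ofRealCLM.contDiff.comp θ.contDiff, ?_⟩
    exact θ.hasCompactSupport.comp_left (g := fun x : ℝ => (x : ℂ)) (by simp)
  have hΘ1 (z : ℂ) : ‖Θ z‖ ≤ 1 := by
    simp only [Θ, Complex.norm_real, Real.norm_of_nonneg θ.nonneg]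
    exact θ.le_one
  obtain ⟨D, hD0, hD⟩ := exists_bound_of_hasCompactSupport hΘ.wirtingerDbar.continuous
    hΘ.wirtingerDbar.hasCompactSupport 1
  have hC : 0 ≤ C := by simpa using (norm_nonneg _).trans (hb 0)
  set c : ℕ → ℝ := fun n => 1 / ((n : ℝ) + 1) with hc
  have hc0 (n : ℕ) : 0 < c n := by simp only [hc]; positivity
  have hc1 (n : ℕ) : c n ≤ 1 := by
    simp only [hc]; rw [div_le_one (by positivity)]; linarith [(n.cast_nonneg : (0 : ℝ) ≤ n)]
  have hlim : Tendsto c atTop (𝓝 0) := tendsto_one_div_add_atTop_nhds_zero_nat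
  set Θn : ℕ → ℂ → ℂ := fun n z => Θ (c n * z)
  have hΘn (n : ℕ) : IsTestFunction (Θn n) := by
    refine ⟨hΘ.1.comp (contDiff_const.mul contDiff_id), ?_⟩
    have : (c n : ℂ) ≠ 0 := by exact_mod_cast (hc0 n).ne'
    exact hΘ.2.comp_homeomorph (Homeomorph.mulLeft₀ _ this)
  have hΘnd (n : ℕ) (z : ℂ) : wirtingerDbar (Θn n) z = c n * wirtingerDbar Θ (c n * z) :=
    wirtingerDbar_comp_real_mul (hΘ.1.differentiable (by simp)) _ _
  have hbd (n : ℕ) (z : ℂ) : ‖wirtingerDbar (Θn n) z‖ ≤ c n * D := by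
    rw [hΘnd, norm_mul, Complex.norm_real, Real.norm_of_nonneg (hc0 n).le]
    refine mul_le_mul_of_nonneg_left ((hD _).trans ?_) (hc0 n).le
    exact div_le_self hD0 (by rw [pow_one]; linarith [norm_nonneg (c n * z)])
  -- Since c_n ≤ 1, c_n/(1 + c_n|z|) ≤ 1/(1+|z|): the scaling factor pays for the shrinking
  -- argument.
  have hbd2 (n : ℕ) (z : ℂ) : ‖wirtingerDbar (Θn n) z‖ ≤ D / (1 + ‖z‖) := by
    rw [hΘnd, norm_mul, Complex.norm_real, Real.norm_of_nonneg (hc0 n).le]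
    refine (mul_le_mul_of_nonneg_left (hD _) (hc0 n).le).trans ?_
    rw [norm_mul, Complex.norm_real, Real.norm_of_nonneg (hc0 n).le, pow_one, mul_div_assoc',
      div_le_div_iff₀ (by have := hc0 n; positivity) (by positivity)]
    have := mul_le_mul_of_nonneg_left (hc1 n) hD0
    have h5 := hc0 n
    nlinarith [norm_nonneg z]
  have h0lim (z : ℂ) : Tendsto (fun n => Θn n z) atTop (𝓝 1) := by
    have h3 : Tendsto (fun n => (c n : ℂ) * z) atTop (𝓝 0) := by
      simpa using ((Complex.continuous_ofReal.tendsto 0).comp hlim).mul_const z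
    have h4 := (hΘ.continuous.tendsto 0).comp h3
    have h5 : Θ 0 = 1 := by
      simp only [Θ, θ.one_of_mem_closedBall (Metric.mem_closedBall_self zero_le_one)]; simp
    rwa [h5] at h4
  have key (n : ℕ) : ∫ z, (f z * η z * wirtingerDbar (Θn n) z + f z * wirtingerDbar η z * Θn n z)
      = -∫ z, g z * η z * Θn n z := by
    have h3 := h.2.2 _ ((hΘn n).mul hη)
    simp_rw [wirtingerDbar_mul (differentiableAt_of_contDiff hη) (hΘn n).differentiableAt,
      mul_add, ← mul_assoc] at h3
    exact h3
  have hfm : AEStronglyMeasurable f := h.1.aestronglyMeasurable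
  have lim1 : Tendsto (fun n => ∫ z, (f z * η z * wirtingerDbar (Θn n) z
      + f z * wirtingerDbar η z * Θn n z)) atTop (𝓝 (∫ z, f z * wirtingerDbar η z)) := by
    refine tendsto_integral_of_dominated_convergence
      (fun z => C * D * (‖f z‖ * (1 + ‖z‖) ^ (-2 : ℝ)) + ‖f z * wirtingerDbar η z‖) (fun n => ?_)
      ((hf.const_mul _).add h1.norm) (fun n => .of_forall fun z => ?_) (.of_forall fun z => ?_)
    · exact ((hfm.mul hη.continuous.aestronglyMeasurable).mul
        (hΘn n).wirtingerDbar.continuous.aestronglyMeasurable).add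
        (h1.aestronglyMeasurable.mul (hΘn n).continuous.aestronglyMeasurable)
    · refine (norm_add_le _ _).trans (add_le_add ?_ ?_)
      · rw [norm_mul, norm_mul]
        calc ‖f z‖ * ‖η z‖ * ‖wirtingerDbar (Θn n) z‖
            ≤ ‖f z‖ * (C / (1 + ‖z‖)) * (D / (1 + ‖z‖)) := by
              gcongr
              exacts [hb z, hbd2 n z]
          _ = _ := by
            rw [Real.rpow_neg (by positivity), Real.rpow_two]
            field_simp
      · rw [norm_mul]
        exact mul_le_of_le_one_right (norm_nonneg _) (hΘ1 _)
    · have h3 : Tendsto (fun n => wirtingerDbar (Θn n) z) atTop (𝓝 0) := by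
        refine squeeze_zero_norm (fun n => hbd n z) ?_
        simpa using hlim.mul_const D
      simpa using (h3.const_mul (f z * η z)).add ((h0lim z).const_mul (f z * wirtingerDbar η z))
  have lim2 : Tendsto (fun n => -∫ z, g z * η z * Θn n z) atTop (𝓝 (-∫ z, g z * η z)) := by
    refine (tendsto_integral_of_dominated_convergence (fun z => ‖g z * η z‖) (fun n => ?_)
      h2.norm (fun n => .of_forall fun z => ?_) (.of_forall fun z => ?_)).neg
    · exact h2.aestronglyMeasurable.mul (hΘn n).continuous.aestronglyMeasurable
    · rw [norm_mul]
      exact mul_le_of_le_one_right (norm_nonneg _) (hΘ1 _)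
    · simpa using (h0lim z).const_mul (g z * η z)
  simp_rw [key] at lim1
  exact tendsto_nhds_unique lim1 lim2

/-! ### The integral equation -/

theorem MemLp.integrable_norm_mul_rpow {p : ℝ} (hp : 2 < p) {f : ℂ → ℂ}
    (hf : MemLp f (ENNReal.ofReal p)) :
    Integrable (fun z => ‖f z‖ * (1 + ‖z‖) ^ (-2 : ℝ)) := by
  have hpq : p.HolderConjugate p.conjExponent := Real.HolderConjugate.conjExponent (by linarith)
  have : (ENNReal.ofReal p).HolderConjugate (ENNReal.ofReal p.conjExponent) := hpq.ennrealOfReal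
  exact hf.norm.integrable_mul
    (memLp_one_add_norm_rpow hpq.symm.pos (by linarith [hpq.symm.lt]))

/-- A positive function in the unit ball of L^p, serving as the comparison function w in
`exists_cauchyKernel_bound` when the density is a test function. -/
theorem exists_decay_memLp {p : ℝ} (hp : 2 < p) :
    ∃ c : ℝ, 0 < c ∧ MemLp (fun z : ℂ => ((c * (1 + ‖z‖)⁻¹ : ℝ) : ℂ)) (ENNReal.ofReal p) ∧
      ∫ z : ℂ, ‖((c * (1 + ‖z‖)⁻¹ : ℝ) : ℂ)‖ ^ p ≤ 1 := by
  have hp0 : 0 < p := by linarith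
  set J := ∫ z : ℂ, (1 + ‖z‖) ^ (-p) with hJ
  have hJ0 : 0 ≤ J := integral_nonneg fun z => by positivity
  refine ⟨(1 + J) ^ (-(1 / p)), by positivity, ?_, ?_⟩
  · have := (memLp_one_add_norm_rpow (q := p) (t := 1) hp0 (by linarith)).const_mul
      ((1 + J) ^ (-(1 / p)))
    refine (this.ofReal (K := ℂ)).congr_norm ?_ (.of_forall fun z => ?_)
    · exact Continuous.aestronglyMeasurable (by
        refine Complex.continuous_ofReal.comp (continuous_const.mul (Continuous.inv₀ (by fun_prop)
          fun z => by positivity)))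
    · simp [Real.rpow_neg_one]
  · have e (z : ℂ) : ‖(((1 + J) ^ (-(1 / p)) * (1 + ‖z‖)⁻¹ : ℝ) : ℂ)‖ ^ p
        = (1 + J)⁻¹ * (1 + ‖z‖) ^ (-p) := by
      rw [Complex.norm_real, Real.norm_of_nonneg (by positivity),
        Real.mul_rpow (by positivity) (by positivity), ← Real.rpow_mul (by positivity),
        Real.inv_rpow (by positivity), Real.rpow_neg (by positivity : (0 : ℝ) ≤ 1 + ‖z‖)]
      congr 1
      rw [show -(1 / p) * p = -1 by field_simp, Real.rpow_neg_one]
    simp_rw [e]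
    rw [integral_const_mul, ← hJ, inv_mul_le_iff₀ (by positivity)]
    linarith

theorem exists_norm_cauchyTransform_le {η : ℂ → ℂ} (hη : IsTestFunction η) :
    ∃ C : ℝ, ∀ z, ‖cauchyTransform η z‖ ≤ C / (1 + ‖z‖) := by
  -- The exponent 3 is auxiliary; any exponent above 2 would do.
  obtain ⟨c, hc, h1, h2⟩ := exists_decay_memLp (p := 3) (by norm_num)
  obtain ⟨B, hB0, hB⟩ := exists_bound_of_hasCompactSupport hη.continuous hη.2 3
  obtain ⟨A, hA0, hA⟩ := exists_cauchyKernel_bound (p := 3) (by norm_num)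
    (show 0 ≤ B / c by positivity)
  refine ⟨A, fun z => (norm_pi_inv_mul_le _).trans ((norm_integral_le_integral_norm _).trans
    (hA _ η h1 h2 hη.continuous.aestronglyMeasurable (.of_forall fun z => ?_) z).2)⟩
  refine (hB z).trans_eq ?_
  rw [Complex.norm_real, Real.norm_of_nonneg (by positivity)]
  field_simp

/-- Fubini together with the antisymmetry of the kernel 1/(z-ζ), which produces the sign. -/
theorem integral_mul_cauchyTransform {p : ℝ} (hp : 2 < p) {K : ℝ} (hK : 0 ≤ K) {w g η : ℂ → ℂ}
    (hw : MemLp w (ENNReal.ofReal p)) (hw1 : ∫ z, ‖w z‖ ^ p ≤ 1)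
    (hg : AEStronglyMeasurable g) (hgw : ∀ᵐ z, ‖g z‖ ≤ K * ‖w z‖ / (1 + ‖z‖) ^ 2)
    (hη : IsTestFunction η) :
    ∫ z, cauchyTransform g z * η z = -∫ z, g z * cauchyTransform η z := by
  obtain ⟨A, hA0, hA⟩ := exists_cauchyKernel_bound hp hK
  have hA' := hA w g hw hw1 hg hgw
  have hmeas : AEStronglyMeasurable (fun x : ℂ × ℂ => η x.1 * (g x.2 / (x.1 - x.2)))
      (volume.prod volume) := by
    refine (hη.continuous.aestronglyMeasurable.comp_fst).mul ?_
    refine ((hg.comp_snd (μ := volume)).mul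
      (((measurable_fst.sub measurable_snd).inv).aestronglyMeasurable)).congr
      (.of_forall fun x => (div_eq_mul_inv _ _).symm)
  have hint : Integrable (fun x : ℂ × ℂ => η x.1 * (g x.2 / (x.1 - x.2)))
      (volume.prod volume) := by
    rw [integrable_prod_iff hmeas]
    refine ⟨.of_forall fun z => (hA' z).1.const_mul (η z), ?_⟩
    refine (hη.integrable.norm.mul_const A).mono' hmeas.norm.integral_prod_right'
      (.of_forall fun z => ?_)
    rw [Real.norm_of_nonneg (integral_nonneg fun _ => norm_nonneg _)]
    simp_rw [norm_mul]
    rw [integral_const_mul]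
    refine mul_le_mul_of_nonneg_left ((hA' z).2.trans (div_le_self hA0 ?_)) (norm_nonneg _)
    linarith [norm_nonneg z]
  have e1 (z : ℂ) : cauchyTransform g z * η z
      = (π : ℂ)⁻¹ * ∫ ζ, η z * (g ζ / (z - ζ)) := by
    rw [integral_const_mul, cauchyTransform]; ring
  have e2 (ζ : ℂ) : g ζ * cauchyTransform η ζ
      = -((π : ℂ)⁻¹ * ∫ z, η z * (g ζ / (z - ζ))) := by
    have : ∀ z, η z * (g ζ / (z - ζ)) = -(g ζ) * (η z / (ζ - z)) := fun z => by
      rw [← neg_sub ζ z, div_neg]; ring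
    simp_rw [this]
    rw [integral_const_mul, cauchyTransform]; ring
  simp_rw [e1, e2]
  rw [integral_neg, neg_neg, integral_const_mul, integral_const_mul,
    integral_integral_swap hint]

/-- By duality: a test function η is ∂̄ of its own Cauchy transform, which decays like |z|⁻¹ and is
therefore admissible in the weak equation. Moving ∂̄ onto f and then the Cauchy transform onto g
identifies the two distributions. Membership of f in L^p leaves no room for an added entire
function. -/
theorem HasWeakDbar.ae_eq_cauchyTransform {p : ℝ} (hp : 2 < p) {K : ℝ} (hK : 0 ≤ K)
    {f g w : ℂ → ℂ} (hf : MemLp f (ENNReal.ofReal p)) (hw : MemLp w (ENNReal.ofReal p))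
    (hw1 : ∫ z, ‖w z‖ ^ p ≤ 1) (hfg : HasWeakDbar f g)
    (hgw : ∀ᵐ z, ‖g z‖ ≤ K * ‖w z‖ / (1 + ‖z‖) ^ 2)
    (hC : LocallyIntegrable (cauchyTransform g)) :
    f =ᵐ[volume] cauchyTransform g := by
  have hg : AEStronglyMeasurable g := hfg.2.1.aestronglyMeasurable
  have key (η : ℂ → ℂ) (hη : IsTestFunction η) :
      ∫ z, f z * η z = ∫ z, cauchyTransform g z * η z := by
    obtain ⟨C, hCη⟩ := exists_norm_cauchyTransform_le hη
    have hC0 : 0 ≤ C := by simpa using (norm_nonneg _).trans (hCη 0)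
    have h1 := hfg.integral_mul_of_decay (contDiff_cauchyTransform hη) hCη
      (MemLp.integrable_norm_mul_rpow hp hf) ?_ ?_
    · simp_rw [wirtingerDbar_cauchyTransform hη] at h1
      rw [h1, integral_mul_cauchyTransform hp hK hw hw1 hg hgw hη]
    · simp_rw [wirtingerDbar_cauchyTransform hη]
      exact hη.integrable_mul hfg.1
    · refine ((MemLp.integrable_norm_mul_rpow hp hw).const_mul (K * C)).mono'
        (hg.mul (contDiff_cauchyTransform hη).continuous.aestronglyMeasurable) ?_
      filter_upwards [hgw] with z hz
      rw [norm_mul]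
      have h2 : ‖cauchyTransform η z‖ ≤ C :=
        (hCη z).trans (div_le_self hC0 (by linarith [norm_nonneg z]))
      calc ‖g z‖ * ‖cauchyTransform η z‖ ≤ (K * ‖w z‖ / (1 + ‖z‖) ^ 2) * C := by gcongr
        _ = _ := by rw [Real.rpow_neg (by positivity), Real.rpow_two]; ring
  have h0 : (fun z => f z - cauchyTransform g z) =ᵐ[volume] 0 := by
    refine ae_eq_zero_of_integral_contDiff_smul_eq_zero (hfg.1.sub hC) fun θ hθ hθc => ?_
    have hη : IsTestFunction (fun z => ((θ z : ℝ) : ℂ)) :=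
      ⟨Complex.ofRealCLM.contDiff.comp hθ,
        hθc.comp_left (g := fun x : ℝ => (x : ℂ)) (by simp)⟩
    have h2 := key _ hη
    rw [← sub_eq_zero, ← integral_sub (hη.integrable_mul hfg.1) (hη.integrable_mul hC)] at h2
    rw [← h2]
    congr 1
    funext z
    simp only [Complex.real_smul]
    ring
  filter_upwards [h0] with z hz
  exact sub_eq_zero.1 hz

/-! ### Regular solutions of the reduced system -/

/-- A solution of `∂̄ f = q w̄`, `∂̄ w = -q f̄` with decay and Hölder bounds of size `A`. -/
structure IsRegularPair (A : ℝ) (q f w : ℂ → ℂ) : Prop where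
  norm_fst_le : ∀ z, ‖f z‖ ≤ A / (1 + ‖z‖)
  norm_snd_le : ∀ z, ‖w z‖ ≤ A / (1 + ‖z‖)
  holder_fst : ∀ z z', ‖f z - f z'‖ ≤ A * ‖z - z'‖ ^ (1 / 2 : ℝ)
  holder_snd : ∀ z z', ‖w z - w z'‖ ≤ A * ‖z - z'‖ ^ (1 / 2 : ℝ)
  dbar_fst : HasWeakDbar f (fun z => q z * conj (w z))
  dbar_snd : HasWeakDbar w (fun z => -(q z * conj (f z)))

theorem continuous_of_holder {A : ℝ} {f : ℂ → ℂ}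
    (h : ∀ z z', ‖f z - f z'‖ ≤ A * ‖z - z'‖ ^ (1 / 2 : ℝ)) : Continuous f := by
  rw [continuous_iff_continuousAt]
  intro z
  rw [ContinuousAt, tendsto_iff_norm_sub_tendsto_zero]
  refine squeeze_zero (fun _ => norm_nonneg _) (fun y => h y z) ?_
  have : Continuous (fun y => A * ‖y - z‖ ^ (1 / 2 : ℝ)) := by
    refine continuous_const.mul (Continuous.rpow_const (by fun_prop) fun x => Or.inr (by norm_num))
  simpa using! this.tendsto z

theorem memLp_integral_norm_rpow_eq_zero {p : ℝ} (hp : 0 < p) {f : ℂ → ℂ}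
    (hf : MemLp f (ENNReal.ofReal p)) (h : ∫ z, ‖f z‖ ^ p = 0) : f =ᵐ[volume] 0 := by
  have hi : Integrable (fun z => ‖f z‖ ^ p) := by
    have := hf.integrable_norm_rpow (by simp; linarith) (by simp)
    rwa [ENNReal.toReal_ofReal hp.le] at this
  have h1 := (integral_eq_zero_iff_of_nonneg (fun z => by positivity) hi).1 h
  filter_upwards [h1] with z hz
  have h2 : ‖f z‖ ^ p = 0 := hz
  rw [Real.rpow_eq_zero (norm_nonneg _) hp.ne'] at h2
  simpa using h2

/-- A bootstrap: the unit L^p bound gives decay A/(1+|z|) of the Cauchy transforms, hence right-hand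
sides bounded by KA/(1+|z|)³, hence Hölder continuity with constant CKA. The representatives chosen
are the Cauchy transforms themselves. -/
theorem exists_isRegularPair_of_normalized {p : ℝ} (hp : 2 < p) {K : ℝ} (hK : 0 ≤ K) :
    ∃ A : ℝ, 0 ≤ A ∧ ∀ q f w : ℂ → ℂ, (∀ z, ‖q z‖ ≤ K / (1 + ‖z‖) ^ 2) →
      MemLp f (ENNReal.ofReal p) → MemLp w (ENNReal.ofReal p) →
      ∫ z, ‖f z‖ ^ p ≤ 1 → ∫ z, ‖w z‖ ^ p ≤ 1 →
      HasWeakDbar f (fun z => q z * conj (w z)) →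
      HasWeakDbar w (fun z => -(q z * conj (f z))) →
      ∃ f' w' : ℂ → ℂ, f =ᵐ[volume] f' ∧ w =ᵐ[volume] w' ∧ IsRegularPair A q f' w' := by
  obtain ⟨A, hA0, hA⟩ := exists_cauchyKernel_bound hp hK
  obtain ⟨C, hC0, hC⟩ := exists_cauchyTransform_holder
  refine ⟨A + C * (K * A), by positivity, fun q f w hq hf hw hf1 hw1 h1 h2 => ?_⟩
  set g₁ : ℂ → ℂ := fun z => q z * conj (w z)
  set g₂ : ℂ → ℂ := fun z => -(q z * conj (f z))
  have bound (v : ℂ → ℂ) (z : ℂ) : ‖q z * conj (v z)‖ ≤ K * ‖v z‖ / (1 + ‖z‖) ^ 2 := by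
    rw [norm_mul, RCLike.norm_conj, mul_div_right_comm]
    exact mul_le_mul_of_nonneg_right (hq z) (norm_nonneg _)
  have b1 : ∀ᵐ z, ‖g₁ z‖ ≤ K * ‖w z‖ / (1 + ‖z‖) ^ 2 := .of_forall (bound w)
  have b2 : ∀ᵐ z, ‖g₂ z‖ ≤ K * ‖f z‖ / (1 + ‖z‖) ^ 2 :=
    .of_forall fun z => by simpa only [g₂, norm_neg] using bound f z
  have m1 := h1.2.1.aestronglyMeasurable
  have m2 := h2.2.1.aestronglyMeasurable
  have k1 := hA w g₁ hw hw1 m1 b1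
  have k2 := hA f g₂ hf hf1 m2 b2
  have d1 (z : ℂ) : ‖cauchyTransform g₁ z‖ ≤ A / (1 + ‖z‖) :=
    (norm_pi_inv_mul_le _).trans ((norm_integral_le_integral_norm _).trans (k1 z).2)
  have d2 (z : ℂ) : ‖cauchyTransform g₂ z‖ ≤ A / (1 + ‖z‖) :=
    (norm_pi_inv_mul_le _).trans ((norm_integral_le_integral_norm _).trans (k2 z).2)
  have meas (g : ℂ → ℂ) (hg : AEStronglyMeasurable g) :
      AEStronglyMeasurable (cauchyTransform g) := by
    have : AEStronglyMeasurable (fun x : ℂ × ℂ => g x.2 / (x.1 - x.2)) (volume.prod volume) :=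
      ((hg.comp_snd (μ := volume)).mul
      (((measurable_fst.sub measurable_snd).inv).aestronglyMeasurable)).congr
      (.of_forall fun x => (div_eq_mul_inv _ _).symm)
    exact (this.integral_prod_right').const_mul _
  have loc (g : ℂ → ℂ) (hg : AEStronglyMeasurable g)
      (hb : ∀ z, ‖cauchyTransform g z‖ ≤ A / (1 + ‖z‖)) :
      LocallyIntegrable (cauchyTransform g) := by
    refine (continuous_const (y := A)).locallyIntegrable.mono (meas g hg) (.of_forall fun z => ?_)
    exact (hb z).trans ((div_le_self hA0 (by linarith [norm_nonneg z])).trans (le_abs_self A))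
  have e1 := h1.ae_eq_cauchyTransform hp hK hf hw hw1 b1 (loc g₁ m1 d1)
  have e2 := h2.ae_eq_cauchyTransform hp hK hw hf hf1 b2 (loc g₂ m2 d2)
  have cube (x : ℂ) (z : ℂ) (hx : ‖x‖ ≤ A / (1 + ‖z‖)) :
      K * ‖x‖ / (1 + ‖z‖) ^ 2 ≤ K * A / (1 + ‖z‖) ^ 3 := by
    calc K * ‖x‖ / (1 + ‖z‖) ^ 2 ≤ K * (A / (1 + ‖z‖)) / (1 + ‖z‖) ^ 2 := by gcongr
      _ = _ := by field_simp
  have c1 : ∀ᵐ z, ‖g₁ z‖ ≤ K * A / (1 + ‖z‖) ^ 3 := by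
    filter_upwards [b1, e2] with z hz hz'
    exact hz.trans (cube _ _ (by rw [hz']; exact d2 z))
  have c2 : ∀ᵐ z, ‖g₂ z‖ ≤ K * A / (1 + ‖z‖) ^ 3 := by
    filter_upwards [b2, e1] with z hz hz'
    exact hz.trans (cube _ _ (by rw [hz']; exact d1 z))
  have n1 := hC (K * A) g₁ (by positivity) m1 c1 fun z => (k1 z).1
  have n2 := hC (K * A) g₂ (by positivity) m2 c2 fun z => (k2 z).1
  have le1 : A ≤ A + C * (K * A) := le_add_of_nonneg_right (by positivity)
  have le2 : C * (K * A) ≤ A + C * (K * A) := le_add_of_nonneg_left hA0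
  refine ⟨_, _, e1, e2, fun z => (d1 z).trans ?_, fun z => (d2 z).trans ?_,
    fun z z' => (n1 z z').trans ?_, fun z z' => (n2 z z').trans ?_, h1.congr_ae e1 ?_,
    h2.congr_ae e2 ?_⟩
  · gcongr
  · gcongr
  · gcongr
  · gcongr
  · filter_upwards [e2] with z hz
    rw [← hz]
  · filter_upwards [e1] with z hz
    rw [← hz]

theorem exists_isRegularPair {p : ℝ} (hp : 2 < p) {K : ℝ} (hK : 0 ≤ K) :
    ∃ A : ℝ, 0 ≤ A ∧ ∀ q f w : ℂ → ℂ, (∀ z, ‖q z‖ ≤ K / (1 + ‖z‖) ^ 2) →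
      MemLp f (ENNReal.ofReal p) → MemLp w (ENNReal.ofReal p) →
      ¬ (f =ᵐ[volume] 0 ∧ w =ᵐ[volume] 0) →
      HasWeakDbar f (fun z => q z * conj (w z)) →
      HasWeakDbar w (fun z => -(q z * conj (f z))) →
      ∃ f' w' : ℂ → ℂ, IsRegularPair A q f' w' ∧
        ∫ z, (‖f' z‖ ^ p + ‖w' z‖ ^ p) = 1 := by
  have hp0 : 0 < p := by linarith
  obtain ⟨A, hA0, hA⟩ := exists_isRegularPair_of_normalized hp hK
  refine ⟨A, hA0, fun q f w hq hf hw hne h1 h2 => ?_⟩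
  have hi (v : ℂ → ℂ) (hv : MemLp v (ENNReal.ofReal p)) : Integrable (fun z => ‖v z‖ ^ p) := by
    have := hv.integrable_norm_rpow (by simp; linarith) (by simp)
    rwa [ENNReal.toReal_ofReal hp0.le] at this
  set a := ∫ z, ‖f z‖ ^ p with ha
  set b := ∫ z, ‖w z‖ ^ p with hb
  have ha0 : 0 ≤ a := integral_nonneg fun z => by positivity
  have hb0 : 0 ≤ b := integral_nonneg fun z => by positivity
  have hN : 0 < a + b := by
    rcases (add_nonneg ha0 hb0).eq_or_lt with h | h
    · exact absurd ⟨memLp_integral_norm_rpow_eq_zero hp0 hf (by linarith),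
        memLp_integral_norm_rpow_eq_zero hp0 hw (by linarith)⟩ hne
    · exact h
  -- The scaling factor is a positive real: conjugation makes the system only real-linear.
  set c := (a + b) ^ (-(1 / p)) with hc
  have hc0 : 0 < c := by positivity
  have hcp : c ^ p = (a + b)⁻¹ := by
    rw [hc, ← Real.rpow_mul hN.le, show -(1 / p) * p = -1 by field_simp, Real.rpow_neg_one]
  have scale (v : ℂ → ℂ) : ∫ z, ‖(c : ℂ) * v z‖ ^ p = (a + b)⁻¹ * ∫ z, ‖v z‖ ^ p := by
    rw [← integral_const_mul]
    congr 1
    funext z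
    rw [norm_mul, Complex.norm_real, Real.norm_of_nonneg hc0.le,
      Real.mul_rpow hc0.le (norm_nonneg _), hcp]
  have sf := scale f
  have sw := scale w
  rw [← ha] at sf
  rw [← hb] at sw
  have d1 := h1.const_mul c
  have d2 := h2.const_mul c
  obtain ⟨f', w', e1, e2, hr⟩ := hA q (fun z => c * f z) (fun z => c * w z) hq
    (hf.const_mul _) (hw.const_mul _)
    (by rw [sf, inv_mul_le_iff₀ hN]; linarith) (by rw [sw, inv_mul_le_iff₀ hN]; linarith)
    (by convert d1 using 2 with z; simp; ring) (by convert d2 using 2 with z; simp; ring)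
  refine ⟨f', w', hr, ?_⟩
  have e3 : (fun z => ‖f' z‖ ^ p + ‖w' z‖ ^ p) =ᵐ[volume]
      fun z => ‖(c : ℂ) * f z‖ ^ p + ‖(c : ℂ) * w z‖ ^ p := by
    filter_upwards [e1, e2] with z h3 h4
    rw [h3, h4]
  rw [integral_congr_ae e3, integral_add (hi _ (hf.const_mul _)) (hi _ (hw.const_mul _)), sf, sw,
    ← mul_add, inv_mul_cancel₀ hN.ne']

/-! ### The unimodular exponentials -/

theorem ek_eq (k z : ℂ) : ek k z = Complex.exp (Complex.I * (k * z + conj k * conj z)) := rfl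

theorem norm_ek (k z : ℂ) : ‖ek k z‖ = 1 := by
  have : k * z + conj k * conj z = ((2 * (k * z).re : ℝ) : ℂ) := by
    rw [← map_mul, Complex.add_conj]
  rw [ek_eq, this, mul_comm, Complex.norm_exp_ofReal_mul_I]

theorem ek_zero_left (z : ℂ) : ek 0 z = 1 := by simp [ek]

theorem ek_add_left (k l z : ℂ) : ek (k + l) z = ek k z * ek l z := by
  rw [ek_eq, ek_eq, ek_eq, ← Complex.exp_add, map_add]
  ring_nf

theorem ek_add_right (k z z' : ℂ) : ek k (z + z') = ek k z * ek k z' := by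
  rw [ek_eq, ek_eq, ek_eq, ← Complex.exp_add, map_add]
  ring_nf

theorem ek_mul_ek_neg (k z : ℂ) : ek k z * ek (-k) z = 1 := by
  rw [← ek_add_left, add_neg_cancel, ek_zero_left]

theorem ek_ne_zero (k z : ℂ) : ek k z ≠ 0 := Complex.exp_ne_zero _

theorem conj_ek (k z : ℂ) : conj (ek k z) = ek (-k) z := by
  rw [ek_eq, ek_eq, ← Complex.exp_conj]
  simp
  ring_nf

theorem contDiff_ek (k : ℂ) : ContDiff ℝ (⊤ : ℕ∞) (ek k) := by
  have h : ContDiff ℝ (⊤ : ℕ∞) (fun z : ℂ => conj z) := contDiff_conj_comp contDiff_id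
  have : ContDiff ℝ (⊤ : ℕ∞)
      (fun z : ℂ => Complex.exp (Complex.I * (k * z + conj k * conj z))) := by fun_prop
  exact this

theorem continuous_ek (k : ℂ) : Continuous (ek k) := (contDiff_ek k).continuous

theorem continuous_ek_left (z : ℂ) : Continuous (fun k => ek k z) := by
  simp only [ek_eq]
  fun_prop

theorem hasFDerivAt_ek (k z : ℂ) : HasFDerivAt (ek k)
    (Complex.exp (Complex.I * (k * z + conj k * conj z)) •
      (Complex.I • (k • ContinuousLinearMap.id ℝ ℂ + conj k • (Complex.conjCLE : ℂ →L[ℝ] ℂ)))) z := by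
  have h1 : HasFDerivAt (fun z : ℂ => Complex.I * (k * z + conj k * conj z))
      (Complex.I • (k • ContinuousLinearMap.id ℝ ℂ + conj k • (Complex.conjCLE : ℂ →L[ℝ] ℂ))) z :=
    (((hasFDerivAt_id (𝕜 := ℝ) z).const_mul k).add
      (((Complex.conjCLE : ℂ →L[ℝ] ℂ).hasFDerivAt (x := z)).const_mul (conj k))).const_mul Complex.I
  exact h1.cexp

theorem wirtingerD_ek (k z : ℂ) : wirtingerD (ek k) z = Complex.I * k * ek k z := by
  rw [wirtingerD_eq_of_hasFDerivAt (hasFDerivAt_ek k z), ek_eq]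
  simp
  linear_combination (- Complex.I / 2 * k * Complex.exp (Complex.I * (k * z + conj k * conj z))
    + Complex.I / 2 * conj k * Complex.exp (Complex.I * (k * z + conj k * conj z)))
    * Complex.I_sq

theorem wirtingerDbar_ek (k z : ℂ) : wirtingerDbar (ek k) z = Complex.I * conj k * ek k z := by
  rw [wirtingerDbar_eq_of_hasFDerivAt (hasFDerivAt_ek k z), ek_eq]
  simp
  linear_combination (Complex.I / 2 * k * Complex.exp (Complex.I * (k * z + conj k * conj z))
    - Complex.I / 2 * conj k * Complex.exp (Complex.I * (k * z + conj k * conj z)))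
    * Complex.I_sq

theorem wirtingerDbar_conj_id (z : ℂ) : wirtingerDbar (fun x : ℂ => conj x) z = 1 := by
  rw [wirtingerDbar_conj differentiableAt_fun_id, wirtingerD_of_differentiableAt differentiableAt_fun_id]
  simp

theorem wirtingerD_conj_id (z : ℂ) : wirtingerD (fun x : ℂ => conj x) z = 0 := by
  rw [wirtingerD_conj differentiableAt_fun_id, wirtingerDbar_of_differentiableAt differentiableAt_fun_id]
  simp

/-! ### A Liouville theorem for `(∂ + iℓ) ∂̄` -/

theorem eq_const_of_wirtingerDbar_eq_zero {S : ℂ → ℂ} {B : ℝ} (hS : ContDiff ℝ (⊤ : ℕ∞) S)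
    (hB : ∀ z, ‖S z‖ ≤ B) (h : ∀ z, wirtingerDbar S z = 0) : ∃ c, ∀ z, S z = c := by
  have hd : Differentiable ℂ S := fun z =>
    differentiableAt_complex_of_wirtingerDbar_eq_zero (differentiableAt_of_contDiff hS) (h z)
  refine ⟨S 0, fun z => hd.apply_eq_apply_of_bounded ?_ z 0⟩
  exact (Metric.isBounded_closedBall (x := (0 : ℂ)) (r := B)).subset
    (by rintro _ ⟨z, rfl⟩; simpa using hB z)

theorem eq_const_of_wirtingerD_eq_zero {S : ℂ → ℂ} {B : ℝ} (hS : ContDiff ℝ (⊤ : ℕ∞) S)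
    (hB : ∀ z, ‖S z‖ ≤ B) (h : ∀ z, wirtingerD S z = 0) : ∃ c, ∀ z, S z = c := by
  obtain ⟨c, hc⟩ := eq_const_of_wirtingerDbar_eq_zero (contDiff_conj_comp hS)
    (B := B) (fun z => by simpa using hB z)
    (fun z => by rw [wirtingerDbar_conj (differentiableAt_of_contDiff hS), h, map_zero])
  exact ⟨conj c, fun z => by rw [← hc z, Complex.conj_conj]⟩

theorem eq_zero_of_norm_natCast_mul_le {x : ℂ} {B : ℝ} (h : ∀ n : ℕ, ‖(n : ℂ) * x‖ ≤ B) :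
    x = 0 := by
  by_contra hx
  obtain ⟨n, hn⟩ := exists_nat_gt (B / ‖x‖)
  rw [div_lt_iff₀ (norm_pos_iff.2 hx)] at hn
  have := h n
  rw [norm_mul, Complex.norm_natCast] at this
  linarith

/-- Such a function is real-affine, and a bounded affine function is constant. -/
theorem eq_const_of_wirtinger_eq_const {S : ℂ → ℂ} {a b : ℂ} {M : ℝ}
    (hS : ContDiff ℝ (⊤ : ℕ∞) S) (hM : ∀ z, ‖S z‖ ≤ M) (ha : ∀ z, wirtingerDbar S z = a)
    (hb : ∀ z, wirtingerD S z = b) : ∃ c, ∀ z, S z = c := by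
  set L : ℂ →L[ℝ] ℂ := fderiv ℝ S 0
  have hL (z : ℂ) : fderiv ℝ S z = L := by
    ext v <;> simp only [L, fderiv_apply_eq_wirtinger, ha, hb]
  have hd : Differentiable ℝ S := hS.differentiable (by simp)
  have h0 (z : ℂ) : fderiv ℝ (fun z => S z - L z) z = 0 := by
    have : HasFDerivAt (fun z => S z - L z) (fderiv ℝ S z - L) z :=
      (hd z).hasFDerivAt.sub L.hasFDerivAt
    rw [this.fderiv, hL, sub_self]
  have hconst (z : ℂ) : S z - L z = S 0 - L 0 :=
    is_const_of_fderiv_eq_zero (𝕜 := ℝ) (hd.sub L.differentiable) h0 z 0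
  have hLz (v : ℂ) : L v = 0 := by
    refine eq_zero_of_norm_natCast_mul_le (B := M + M) fun n => ?_
    have h1 := hconst (n • v)
    have h2 : (n : ℂ) * L v = S (n • v) - S 0 := by
      rw [map_nsmul, map_zero, sub_zero] at h1
      rw [← h1, nsmul_eq_mul (n : ℕ) (L v)]
      ring
    rw [h2]
    exact (norm_sub_le _ _).trans (add_le_add (hM _) (hM _))
  exact ⟨S 0, fun z => by simpa [hLz] using hconst z⟩

/-- The function e_ℓ ∂̄S is bounded and antiholomorphic, hence constant, so ∂̄S = a e_{-ℓ}. For ℓ ≠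
0 an explicit multiple of e_{-ℓ} is a ∂̄-primitive, and the remainder is bounded and entire. For ℓ =
0 the derivative ∂S is also constant and S is bounded and affine. -/
theorem liouville_smooth {S : ℂ → ℂ} {B B₁ B₂ : ℝ} (ℓ : ℂ) (hS : ContDiff ℝ (⊤ : ℕ∞) S)
    (hB : ∀ z, ‖S z‖ ≤ B) (hB₁ : ∀ z, ‖wirtingerDbar S z‖ ≤ B₁)
    (hB₂ : ∀ z, ‖wirtingerD S z‖ ≤ B₂)
    (h : ∀ z, wirtingerD (wirtingerDbar S) z + Complex.I * ℓ * wirtingerDbar S z = 0) :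
    ∃ c a, ∀ z, S z = c + a * ek (-ℓ) z := by
  have hG := contDiff_wirtingerDbar hS
  obtain ⟨a, ha⟩ := eq_const_of_wirtingerD_eq_zero ((contDiff_ek ℓ).mul hG) (B := B₁)
    (fun z => by rw [norm_mul, norm_ek, one_mul]; exact hB₁ z)
    (fun z => by
      rw [wirtingerD_mul (differentiableAt_of_contDiff (contDiff_ek ℓ))
        (differentiableAt_of_contDiff hG), wirtingerD_ek]
      linear_combination (ek ℓ z) * h z)
  have ha' (z : ℂ) : wirtingerDbar S z = a * ek (-ℓ) z := by
    rw [← ha z]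
    linear_combination (- wirtingerDbar S z) * ek_mul_ek_neg ℓ z
  rcases eq_or_ne ℓ 0 with rfl | hℓ
  · have hD := contDiff_wirtingerD hS
    simp only [neg_zero, ek_zero_left, mul_one] at ha' ⊢
    obtain ⟨b, hb⟩ := eq_const_of_wirtingerDbar_eq_zero hD hB₂ (fun z => by
      rw [← wirtinger_comm hS, show wirtingerDbar S = fun _ => a from funext ha']
      exact wirtingerD_const a)
    obtain ⟨c, hc⟩ := eq_const_of_wirtinger_eq_const hS hB ha' hb
    exact ⟨c, 0, fun z => by rw [hc, add_zero]⟩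
  · have hcℓ : conj ℓ ≠ 0 := by simpa using hℓ
    set d : ℂ := a / (Complex.I * conj ℓ)
    have hek := contDiff_ek (-ℓ)
    obtain ⟨c, hc⟩ := eq_const_of_wirtingerDbar_eq_zero (hS.add (contDiff_const.mul hek))
      (S := fun z => S z + d * ek (-ℓ) z) (B := B + ‖d‖)
      (fun z => by
        refine (norm_add_le _ _).trans (add_le_add (hB z) ?_)
        rw [norm_mul, norm_ek, mul_one])
      (fun z => by
        rw [wirtingerDbar_add (differentiableAt_of_contDiff hS)
          ((differentiableAt_of_contDiff hek).const_mul d),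
          wirtingerDbar_const_mul _ (differentiableAt_of_contDiff hek), wirtingerDbar_ek, ha',
          map_neg]
        have hI := Complex.I_ne_zero
        simp only [d]
        field_simp
        ring)
    exact ⟨c, -d, fun z => by rw [← hc z]; ring⟩

theorem wirtinger_comp_const_sub {η : ℂ → ℂ} (hη : Differentiable ℝ η) (z t : ℂ) :
    wirtingerDbar (fun x => η (z - x)) t = -wirtingerDbar η (z - t) ∧
    wirtingerD (fun x => η (z - x)) t = -wirtingerD η (z - t) := by
  have h1 : HasFDerivAt (fun x : ℂ => z - x) (-ContinuousLinearMap.id ℝ ℂ) t :=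
    (hasFDerivAt_id t).const_sub z
  have h2 : HasFDerivAt (fun x => η (z - x)) _ t := (hη (z - t)).hasFDerivAt.comp t h1
  rw [wirtingerDbar_eq_of_hasFDerivAt h2, wirtingerD_eq_of_hasFDerivAt h2, wirtingerDbar,
    wirtingerD]
  constructor <;> simp <;> ring

theorem norm_convolution_le {η X : ℂ → ℂ} {B : ℝ} (hη : IsTestFunction η) (hB : ∀ z, ‖X z‖ ≤ B)
    (z : ℂ) : ‖MeasureTheory.convolution η X (ContinuousLinearMap.mul ℝ ℂ) volume z‖ ≤
      (∫ t, ‖η t‖) * B := by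
  rw [← integral_mul_const]
  refine norm_integral_le_of_norm_le (hη.integrable.norm.mul_const B) (.of_forall fun t => ?_)
  simp only [ContinuousLinearMap.mul_apply', norm_mul]
  exact mul_le_mul_of_nonneg_left (hB _) (norm_nonneg _)

/-- Convolution with a test function gives a smooth bounded solution with bounded derivatives, to
which `liouville_smooth` applies. Mollifiers then recover X as a pointwise limit. -/
theorem liouville_weak {X : ℂ → ℂ} {B : ℝ} (ℓ : ℂ) (hX : Continuous X) (hB : ∀ z, ‖X z‖ ≤ B)
    (h : ∀ η, IsTestFunction η → ∫ z, X z *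
      (wirtingerDbar (wirtingerD η) z - Complex.I * ℓ * wirtingerDbar η z) = 0) :
    ∃ c a, ∀ z, X z = c + a * ek (-ℓ) z := by
  have hXl : LocallyIntegrable X := hX.locallyIntegrable
  set V : Submodule ℂ (ℂ → ℂ) := Submodule.span ℂ {fun _ => 1, ek (-ℓ)} with hV
  have hVmem (f : ℂ → ℂ) : f ∈ V ↔ ∃ c a, ∀ z, f z = c + a * ek (-ℓ) z := by
    rw [hV, Submodule.mem_span_pair]
    refine exists_congr fun c => exists_congr fun a => ?_
    rw [funext_iff]
    refine forall_congr' fun z => ?_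
    simp [eq_comm]
  have hVfin : FiniteDimensional ℂ V :=
    FiniteDimensional.span_of_finite ℂ (by simp)
  -- A finite-dimensional subspace is closed for pointwise convergence, so the coefficients of the
  -- mollified functions need not be tracked.
  have hclosed : IsClosed (V : Set (ℂ → ℂ)) := Submodule.closed_of_finiteDimensional V
  have key (η : ℂ → ℂ) (hη : IsTestFunction η) :
      MeasureTheory.convolution η X (ContinuousLinearMap.mul ℝ ℂ) volume ∈ V := by
    rw [hVmem]
    have e1 : wirtingerDbar (MeasureTheory.convolution η X (ContinuousLinearMap.mul ℝ ℂ) volume)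
        = MeasureTheory.convolution (wirtingerDbar η) X (ContinuousLinearMap.mul ℝ ℂ) volume :=
      funext fun z => (wirtinger_convolution hη hXl z).1
    have e2 : wirtingerD (MeasureTheory.convolution η X (ContinuousLinearMap.mul ℝ ℂ) volume)
        = MeasureTheory.convolution (wirtingerD η) X (ContinuousLinearMap.mul ℝ ℂ) volume :=
      funext fun z => (wirtinger_convolution hη hXl z).2
    refine liouville_smooth ℓ (contDiff_convolution hη hXl) (norm_convolution_le hη hB)
      (B₁ := (∫ t, ‖wirtingerDbar η t‖) * B) (B₂ := (∫ t, ‖wirtingerD η t‖) * B)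
      (fun z => by rw [e1]; exact norm_convolution_le hη.wirtingerDbar hB z)
      (fun z => by rw [e2]; exact norm_convolution_le hη.wirtingerD hB z) (fun z => ?_)
    rw [e1, (wirtinger_convolution hη.wirtingerDbar hXl z).2]
    have hη' : IsTestFunction (fun x => η (z - x)) :=
      ⟨hη.1.comp (contDiff_const.sub contDiff_id),
        hη.2.comp_homeomorph (Homeomorph.subLeft z)⟩
    have h1 := h _ hη'
    have hd := hη.1.differentiable (by simp)
    have hDd := hη.wirtingerD.1.differentiable (by simp)
    have e3 : wirtingerD (fun x => η (z - x)) = fun t => (-1) * wirtingerD η (z - t) :=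
      funext fun t => by rw [(wirtinger_comp_const_sub hd z t).2, neg_one_mul]
    have e4 (t : ℂ) : wirtingerDbar (wirtingerD (fun x => η (z - x))) t
        = wirtingerDbar (wirtingerD η) (z - t) := by
      have hd' : DifferentiableAt ℝ (fun x => wirtingerD η (z - x)) t :=
        (hDd (z - t)).comp t (by fun_prop)
      rw [e3, wirtingerDbar_const_mul _ hd',
        (wirtinger_comp_const_sub hDd z t).1]
      ring
    simp_rw [e4, (wirtinger_comp_const_sub hd z _).1] at h1
    have i1 : Integrable (fun t => wirtingerD (wirtingerDbar η) t * X (z - t)) :=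
      hη.wirtingerDbar.wirtingerD.2.convolutionExists_left (ContinuousLinearMap.mul ℝ ℂ)
        hη.wirtingerDbar.wirtingerD.continuous hXl z
    have i2 : Integrable (fun t => wirtingerDbar η t * X (z - t)) :=
      hη.wirtingerDbar.2.convolutionExists_left (ContinuousLinearMap.mul ℝ ℂ)
        hη.wirtingerDbar.continuous hXl z
    simp only [MeasureTheory.convolution, ContinuousLinearMap.mul_apply']
    rw [← integral_const_mul, ← integral_add i1 (i2.const_mul _), ← h1,
      ← integral_sub_left_eq_self _ volume z]
    congr 1
    funext t
    rw [wirtinger_comm hη.1, sub_sub_cancel]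
    ring
  let φ : ℕ → ContDiffBump (0 : ℂ) := fun n =>
    ⟨1 / ((n : ℝ) + 1), 2 * (1 / ((n : ℝ) + 1)), by positivity, by
      have : (0 : ℝ) < 1 / ((n : ℝ) + 1) := by positivity
      linarith⟩
  have hφ : Tendsto (fun n => (φ n).rOut) atTop (𝓝 0) := by
    simpa [φ] using (tendsto_one_div_add_atTop_nhds_zero_nat (𝕜 := ℝ)).const_mul 2
  rw [← hVmem]
  refine hclosed.mem_of_tendsto (b := atTop) (f := fun n => MeasureTheory.convolution
    (fun x => (((φ n).normed volume x : ℝ) : ℂ)) X (ContinuousLinearMap.mul ℝ ℂ) volume) ?_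
    (.of_forall fun n => key _ ⟨Complex.ofRealCLM.contDiff.comp (φ n).contDiff_normed,
      (φ n).hasCompactSupport_normed.comp_left (g := fun x : ℝ => (x : ℂ)) (by simp)⟩)
  rw [tendsto_pi_nhds]
  intro z
  have h1 := ContDiffBump.convolution_tendsto_right_of_continuous (μ := volume) hφ hX z
  refine h1.congr fun n => ?_
  simp [MeasureTheory.convolution]

/-! ### The soliton profile -/

/-- `|z + μ|² + |ν|²` as a complex number. -/
noncomputable def solDenom (ν μ z : ℂ) : ℂ := (z + μ) * conj (z + μ) + ν * conj ν

/-- The oscillating factor `e_{-ℓ}(z + μ)`. -/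
noncomputable def phase (ℓ μ z : ℂ) : ℂ := ek (-ℓ) (z + μ)

theorem solDenom_eq (ν μ z : ℂ) :
    solDenom ν μ z = ((‖z + μ‖ ^ 2 + ‖ν‖ ^ 2 : ℝ) : ℂ) := by
  rw [solDenom, Complex.mul_conj, Complex.mul_conj, Complex.normSq_eq_norm_sq,
    Complex.normSq_eq_norm_sq, Complex.ofReal_add]

theorem norm_solDenom (ν μ z : ℂ) : ‖solDenom ν μ z‖ = ‖z + μ‖ ^ 2 + ‖ν‖ ^ 2 := by
  rw [solDenom_eq, Complex.norm_real, Real.norm_of_nonneg (by positivity)]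

theorem solDenom_ne_zero {ν : ℂ} (hν : ν ≠ 0) (μ z : ℂ) : solDenom ν μ z ≠ 0 := by
  rw [← norm_pos_iff, norm_solDenom]
  have := norm_pos_iff.2 hν
  positivity

theorem conj_solDenom (ν μ z : ℂ) : conj (solDenom ν μ z) = solDenom ν μ z := by
  rw [solDenom_eq, Complex.conj_ofReal]

theorem contDiff_add_const (μ : ℂ) : ContDiff ℝ (⊤ : ℕ∞) (fun z : ℂ => z + μ) :=
  contDiff_id.add contDiff_const

theorem contDiff_conj_add_const (μ : ℂ) : ContDiff ℝ (⊤ : ℕ∞) (fun z : ℂ => conj (z + μ)) :=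
  contDiff_conj_comp (contDiff_add_const μ)

theorem contDiff_solDenom (ν μ : ℂ) : ContDiff ℝ (⊤ : ℕ∞) (solDenom ν μ) :=
  ((contDiff_add_const μ).mul (contDiff_conj_add_const μ)).add contDiff_const

theorem wirtingerDbar_add_const (μ z : ℂ) : wirtingerDbar (fun z => z + μ) z = 0 :=
  wirtingerDbar_of_differentiableAt (by fun_prop)

theorem wirtingerD_conj_add_const (μ z : ℂ) : wirtingerD (fun z => conj (z + μ)) z = 0 := by
  rw [wirtingerD_comp_add (f := fun z => conj z), wirtingerD_conj_id]

theorem wirtingerDbar_conj_add_const (μ z : ℂ) : wirtingerDbar (fun z => conj (z + μ)) z = 1 := by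
  rw [wirtingerDbar_comp_add (f := fun z => conj z), wirtingerDbar_conj_id]

theorem wirtingerD_add_const (μ z : ℂ) : wirtingerD (fun z => z + μ) z = 1 := by
  rw [wirtingerD_comp_add (f := fun z => z), wirtingerD_of_differentiableAt (by fun_prop)]
  simp

theorem wirtingerDbar_solDenom (ν μ z : ℂ) : wirtingerDbar (solDenom ν μ) z = z + μ := by
  have h1 := differentiableAt_of_contDiff (contDiff_add_const μ) (z := z)
  have h2 := differentiableAt_of_contDiff (contDiff_conj_add_const μ) (z := z)
  have : solDenom ν μ = fun z => (z + μ) * conj (z + μ) + ν * conj ν := rfl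
  rw [this, wirtingerDbar_add (h1.fun_mul h2) (differentiableAt_const _), wirtingerDbar_mul h1 h2,
    wirtingerDbar_const, wirtingerDbar_add_const, wirtingerDbar_conj_add_const]
  ring

theorem contDiff_phase (ℓ μ : ℂ) : ContDiff ℝ (⊤ : ℕ∞) (phase ℓ μ) :=
  (contDiff_ek _).comp (contDiff_add_const μ)

theorem norm_phase (ℓ μ z : ℂ) : ‖phase ℓ μ z‖ = 1 := norm_ek _ _

theorem phase_mul_conj (ℓ μ z : ℂ) : phase ℓ μ z * conj (phase ℓ μ z) = 1 := by
  rw [Complex.mul_conj, Complex.normSq_eq_norm_sq, norm_phase]; simp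

theorem phase_zero (μ z : ℂ) : phase 0 μ z = 1 := by rw [phase, neg_zero, ek_zero_left]

theorem wirtingerDbar_phase (ℓ μ z : ℂ) :
    wirtingerDbar (phase ℓ μ) z = -(Complex.I * conj ℓ) * phase ℓ μ z := by
  have : phase ℓ μ = fun z => ek (-ℓ) (z + μ) := rfl
  rw [this, wirtingerDbar_comp_add (f := ek (-ℓ)), wirtingerDbar_ek, map_neg]
  ring

theorem wirtingerD_phase (ℓ μ z : ℂ) :
    wirtingerD (phase ℓ μ) z = -(Complex.I * ℓ) * phase ℓ μ z := by
  have : phase ℓ μ = fun z => ek (-ℓ) (z + μ) := rfl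
  rw [this, wirtingerD_comp_add (f := ek (-ℓ)), wirtingerD_ek]
  ring

theorem contDiff_conj_phase (ℓ μ : ℂ) : ContDiff ℝ (⊤ : ℕ∞) (fun z => conj (phase ℓ μ z)) :=
  contDiff_conj_comp (contDiff_phase ℓ μ)

theorem wirtingerDbar_conj_phase (ℓ μ z : ℂ) :
    wirtingerDbar (fun z => conj (phase ℓ μ z)) z
      = Complex.I * conj ℓ * conj (phase ℓ μ z) := by
  rw [wirtingerDbar_conj (differentiableAt_of_contDiff (contDiff_phase ℓ μ)), wirtingerD_phase]
  simp

theorem ek_neg_eq_phase (ℓ μ z : ℂ) : ek (-ℓ) z = ek ℓ μ * phase ℓ μ z := by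
  rw [phase, ek_add_right]
  linear_combination (- ek (-ℓ) z) * ek_mul_ek_neg ℓ μ

/-! ### Uniqueness of weak derivatives -/

theorem ae_eq_zero_of_integral_mul_testFunction {g : ℂ → ℂ} (hg : LocallyIntegrable g)
    (h : ∀ η, IsTestFunction η → ∫ z, g z * η z = 0) : g =ᵐ[volume] 0 := by
  refine ae_eq_zero_of_integral_contDiff_smul_eq_zero hg fun θ hθ hθc => ?_
  have hη : IsTestFunction (fun z => ((θ z : ℝ) : ℂ)) :=
    ⟨Complex.ofRealCLM.contDiff.comp hθ,
      hθc.comp_left (g := fun x : ℝ => (x : ℂ)) (by simp)⟩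
  rw [← h _ hη]
  congr 1
  funext z
  simp only [Complex.real_smul]
  ring

/-- Weak and classical derivatives agree almost everywhere, and two continuous functions that agree
almost everywhere are equal. -/
theorem HasWeakDbar.eq_wirtingerDbar {S g : ℂ → ℂ} (h : HasWeakDbar S g)
    (hS : ContDiff ℝ (⊤ : ℕ∞) S) (hg : Continuous g) (z : ℂ) : wirtingerDbar S z = g z := by
  have hc := (contDiff_wirtingerDbar hS).continuous
  have h0 : (fun z => wirtingerDbar S z - g z) =ᵐ[volume] 0 := by
    refine ae_eq_zero_of_integral_mul_testFunction (hc.sub hg).locallyIntegrable fun η hη => ?_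
    simp_rw [sub_mul]
    rw [integral_sub (hη.integrable_mul hc.locallyIntegrable) (hη.integrable_mul h.2.1)]
    have h1 := h.2.2 η hη
    have h2 := integral_mul_wirtingerDbar hS hη
    linear_combination h2 - h1
  have h1 := ((hc.sub hg).ae_eq_iff_eq volume continuous_const).1 h0
  exact sub_eq_zero.1 (congrFun h1 z)

/-! ### Solutions for the soliton potential -/

section Classification

variable {ν μ ℓ : ℂ} {X Y : ℂ → ℂ}

/-- For a test function `κ`, `∂̄ (Ē ∂κ) = Ē ∂ ((∂̄ + i ℓ̄) κ)`. -/
theorem wirtingerDbar_conj_phase_mul_wirtingerD {κ : ℂ → ℂ} (hκ : IsTestFunction κ) (z : ℂ) :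
    wirtingerDbar (fun z => conj (phase ℓ μ z) * wirtingerD κ z) z =
      conj (phase ℓ μ z) *
        wirtingerD (fun z => wirtingerDbar κ z + Complex.I * conj ℓ * κ z) z := by
  rw [wirtingerDbar_mul (differentiableAt_of_contDiff (contDiff_conj_phase ℓ μ))
    hκ.wirtingerD.differentiableAt, wirtingerDbar_conj_phase,
    wirtingerD_add hκ.wirtingerDbar.differentiableAt (hκ.differentiableAt.const_mul _),
    wirtingerD_const_mul _ hκ.differentiableAt]
  simp only [wirtinger_comm hκ.1]
  ring

theorem integral_mul_testFunction_add {X η η' : ℂ → ℂ} (hX : Continuous X)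
    (hη : IsTestFunction η) (hη' : IsTestFunction η') :
    ∫ z, X z * (η z + η' z) = (∫ z, X z * η z) + ∫ z, X z * η' z := by
  simp_rw [mul_add]
  exact integral_add (hη.integrable_mul hX.locallyIntegrable)
    (hη'.integrable_mul hX.locallyIntegrable)

theorem isTestFunction_const_mul {η : ℂ → ℂ} (c : ℂ) (hη : IsTestFunction η) :
    IsTestFunction (fun z => c * η z) := hη.mul contDiff_const

variable (hX : Continuous X) (hY : Continuous Y)
  -- In the weak sense, `h1` says ν̄ ∂̄Y + conj(z+μ) ∂̄X = 0 and `h2` says ν ∂(Ē X) = (z+μ) ∂(Ē Y).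
  (h1 : ∀ η, IsTestFunction η → conj ν * (∫ z, Y z * wirtingerDbar η z) +
    ∫ z, X z * wirtingerDbar (fun z => conj (z + μ) * η z) z = 0)
  (h2 : ∀ η, IsTestFunction η → ν * (∫ z, X z * (conj (phase ℓ μ z) * wirtingerD η z)) -
    ∫ z, Y z * (conj (phase ℓ μ z) * wirtingerD (fun z => (z + μ) * η z) z) = 0)

include h2 in
-- Because z+μ is holomorphic, `h2` survives a further ∂̄-type derivative: weakly, ν ∂(Ē ∂̄X) =
-- (z+μ) ∂(Ē ∂̄Y).
theorem cross_relation {κ : ℂ → ℂ} (hκ : IsTestFunction κ) :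
    ν * (∫ z, X z * wirtingerDbar (fun z => conj (phase ℓ μ z) * wirtingerD κ z) z) -
      ∫ z, Y z * wirtingerDbar (fun z => conj (phase ℓ μ z) *
        wirtingerD (fun z => (z + μ) * κ z) z) z = 0 := by
  have hs := hκ.mul (contDiff_add_const μ)
  have h := h2 _ (hκ.wirtingerDbar.add (isTestFunction_const_mul (Complex.I * conj ℓ) hκ))
  simp_rw [wirtingerDbar_conj_phase_mul_wirtingerD hκ, wirtingerDbar_conj_phase_mul_wirtingerD hs]
  have e : (fun z => wirtingerDbar (fun z => (z + μ) * κ z) z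
      + Complex.I * conj ℓ * ((z + μ) * κ z))
      = fun z => (z + μ) * (wirtingerDbar κ z + Complex.I * conj ℓ * κ z) := by
    funext z
    rw [wirtingerDbar_mul (differentiableAt_of_contDiff (contDiff_add_const μ))
      hκ.differentiableAt, wirtingerDbar_add_const]
    ring
  rw [e]
  exact h

theorem wirtingerD_conj_add_const_mul {κ : ℂ → ℂ} (hκ : IsTestFunction κ) (z : ℂ) :
    wirtingerD (fun z => conj (z + μ) * κ z) z = conj (z + μ) * wirtingerD κ z := by
  rw [wirtingerD_mul (differentiableAt_of_contDiff (contDiff_conj_add_const μ))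
    hκ.differentiableAt, wirtingerD_conj_add_const]
  ring

theorem wirtingerD_solDenom_mul {κ : ℂ → ℂ} (hκ : IsTestFunction κ) (z : ℂ) :
    wirtingerD (fun z => solDenom ν μ z * κ z) z =
      conj (z + μ) * wirtingerD (fun z => (z + μ) * κ z) z + ν * conj ν * wirtingerD κ z := by
  have hs := hκ.mul (contDiff_add_const μ)
  rw [← wirtingerD_conj_add_const_mul hs, ← wirtingerD_const_mul _ hκ.differentiableAt,
    ← wirtingerD_add (hs.mul (contDiff_conj_add_const μ)).differentiableAt
      (hκ.differentiableAt.const_mul _)]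
  congr 1
  funext z
  rw [solDenom]
  ring

include hX h1 h2 in
-- Weak form of ρ ∂(Ē ∂̄X) = 0. Multiplying `cross_relation` by ν̄ and replacing ν̄ ∂̄Y by
-- -conj(z+μ) ∂̄X turns |ν|² ∂(Ē ∂̄X) into -|z+μ|² ∂(Ē ∂̄X), since ∂ does not see conj(z+μ).
theorem integral_fst_eq_zero {κ : ℂ → ℂ} (hκ : IsTestFunction κ) :
    ∫ z, X z * wirtingerDbar (fun z => conj (phase ℓ μ z) *
      wirtingerD (fun z => solDenom ν μ z * κ z) z) z = 0 := by
  have hs := hκ.mul (contDiff_add_const μ)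
  have t1 := h1 _ (hs.wirtingerD.mul (contDiff_conj_phase ℓ μ))
  have t2 := cross_relation h2 hκ
  have hη1 := (hs.wirtingerD.mul (contDiff_conj_phase ℓ μ)).mul (contDiff_conj_add_const μ)
  have hη2 := hκ.wirtingerD.mul (contDiff_conj_phase ℓ μ)
  have e : (fun z => conj (phase ℓ μ z) * wirtingerD (fun z => solDenom ν μ z * κ z) z)
      = fun z => conj (z + μ) * (conj (phase ℓ μ z) * wirtingerD (fun z => (z + μ) * κ z) z)
        + ν * conj ν * (conj (phase ℓ μ z) * wirtingerD κ z) := by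
    funext z
    rw [wirtingerD_solDenom_mul hκ]
    ring
  have e2 (z : ℂ) : wirtingerDbar (fun z => conj (phase ℓ μ z) *
      wirtingerD (fun z => solDenom ν μ z * κ z) z) z
      = wirtingerDbar (fun z => conj (z + μ) *
        (conj (phase ℓ μ z) * wirtingerD (fun z => (z + μ) * κ z) z)) z
        + ν * conj ν * wirtingerDbar (fun z => conj (phase ℓ μ z) * wirtingerD κ z) z := by
    rw [e, wirtingerDbar_add hη1.differentiableAt (hη2.differentiableAt.const_mul _),
      wirtingerDbar_const_mul _ hη2.differentiableAt]
  simp_rw [e2]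
  rw [integral_mul_testFunction_add hX hη1.wirtingerDbar
    (isTestFunction_const_mul _ hη2.wirtingerDbar)]
  simp_rw [mul_left_comm (X _) (ν * conj ν)]
  rw [integral_const_mul]
  linear_combination t1 + conj ν * t2

include hY h1 h2 in
-- The same elimination with X removed: `cross_relation` is tested with conj(z+μ) κ, and ν times
-- `h1` replaces conj(z+μ) ∂̄X.
theorem integral_snd_eq_zero {κ : ℂ → ℂ} (hκ : IsTestFunction κ) :
    ∫ z, Y z * wirtingerDbar (fun z => conj (phase ℓ μ z) *
      wirtingerD (fun z => solDenom ν μ z * κ z) z) z = 0 := by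
  have hs := hκ.mul (contDiff_conj_add_const μ)
  have hss := hs.mul (contDiff_add_const μ)
  have t1 := h1 _ (hκ.wirtingerD.mul (contDiff_conj_phase ℓ μ))
  have t2 := cross_relation h2 hs
  have hη1 := hss.wirtingerD.mul (contDiff_conj_phase ℓ μ)
  have hη2 := hκ.wirtingerD.mul (contDiff_conj_phase ℓ μ)
  have e : (fun z => conj (phase ℓ μ z) * wirtingerD (fun z => solDenom ν μ z * κ z) z)
      = fun z => conj (phase ℓ μ z) * wirtingerD (fun z => (z + μ) * (conj (z + μ) * κ z)) z
        + ν * conj ν * (conj (phase ℓ μ z) * wirtingerD κ z) := by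
    funext z
    have e0 : (fun z => (z + μ) * (conj (z + μ) * κ z))
        = fun z => conj (z + μ) * ((z + μ) * κ z) := by funext z; ring
    rw [wirtingerD_solDenom_mul hκ, e0,
      wirtingerD_conj_add_const_mul (hκ.mul (contDiff_add_const μ))]
    ring
  have e2 (z : ℂ) : wirtingerDbar (fun z => conj (phase ℓ μ z) *
      wirtingerD (fun z => solDenom ν μ z * κ z) z) z
      = wirtingerDbar (fun z =>
        conj (phase ℓ μ z) * wirtingerD (fun z => (z + μ) * (conj (z + μ) * κ z)) z) z
        + ν * conj ν * wirtingerDbar (fun z => conj (phase ℓ μ z) * wirtingerD κ z) z := by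
    rw [e, wirtingerDbar_add hη1.differentiableAt (hη2.differentiableAt.const_mul _),
      wirtingerDbar_const_mul _ hη2.differentiableAt]
  have e3 : (fun z => conj (phase ℓ μ z) * wirtingerD (fun z => conj (z + μ) * κ z) z)
      = fun z => conj (z + μ) * (conj (phase ℓ μ z) * wirtingerD κ z) := by
    funext z
    rw [wirtingerD_conj_add_const_mul hκ]
    ring
  rw [e3] at t2
  simp_rw [e2]
  rw [integral_mul_testFunction_add hY hη1.wirtingerDbar
    (isTestFunction_const_mul _ hη2.wirtingerDbar)]
  simp_rw [mul_left_comm (Y _) (ν * conj ν)]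
  rw [integral_const_mul]
  linear_combination ν * t1 - t2

/-- The factor ρ never vanishes and can be divided out: κ = E η/ρ is a test function, and
conjugating ∂ by E produces the shift -iℓ. -/
theorem wirtinger_div_solDenom (hν : ν ≠ 0) {η : ℂ → ℂ} (hη : IsTestFunction η) :
    ∃ κ, IsTestFunction κ ∧ ∀ z, wirtingerDbar (fun z => conj (phase ℓ μ z) *
      wirtingerD (fun z => solDenom ν μ z * κ z) z) z =
      wirtingerDbar (wirtingerD η) z - Complex.I * ℓ * wirtingerDbar η z := by
  have hρ : ContDiff ℝ (⊤ : ℕ∞) (fun z => phase ℓ μ z * (solDenom ν μ z)⁻¹) :=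
    (contDiff_phase ℓ μ).mul ((contDiff_solDenom ν μ).inv (solDenom_ne_zero hν μ))
  refine ⟨_, hη.mul hρ, fun z => ?_⟩
  have e1 : (fun z => solDenom ν μ z * (phase ℓ μ z * (solDenom ν μ z)⁻¹ * η z))
      = fun z => phase ℓ μ z * η z := by
    funext z
    have := solDenom_ne_zero hν μ z
    field_simp
  have e2 : (fun z => conj (phase ℓ μ z) * wirtingerD (fun z => phase ℓ μ z * η z) z)
      = fun z => wirtingerD η z + (-(Complex.I * ℓ)) * η z := by
    funext z
    rw [wirtingerD_mul (differentiableAt_of_contDiff (contDiff_phase ℓ μ)) hη.differentiableAt,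
      wirtingerD_phase]
    linear_combination (wirtingerD η z - Complex.I * ℓ * η z) * phase_mul_conj ℓ μ z
  rw [e1, e2, wirtingerDbar_add hη.wirtingerD.differentiableAt (hη.differentiableAt.const_mul _),
    wirtingerDbar_const_mul _ hη.differentiableAt]
  ring

end Classification

/-! ### Explicit solutions for the soliton coefficient -/

theorem norm_add_le_mul (μ z : ℂ) : ‖z + μ‖ ≤ (1 + ‖μ‖) * (1 + ‖z‖) := by
  have := norm_add_le z μ
  nlinarith [norm_nonneg z, norm_nonneg μ]

theorem norm_add_mul_le {μ z x : ℂ} {A : ℝ} (h : ‖x‖ ≤ A / (1 + ‖z‖)) :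
    ‖z + μ‖ * ‖x‖ ≤ (1 + ‖μ‖) * A := by
  calc ‖z + μ‖ * ‖x‖ ≤ ((1 + ‖μ‖) * (1 + ‖z‖)) * (A / (1 + ‖z‖)) := by
        gcongr
        exact norm_add_le_mul μ z
    _ = _ := by field_simp

/-- The matrix taking (f, E w̄) to (X, Y) has determinant -ρ, and with it the system multiplied by ρ
loses its denominators: `H1` and `H2` have polynomial coefficients apart from the phase. X and Y are
bounded because the linear growth of z+μ is compensated by the decay of f and w, so `liouville_weak`
applies to both. -/
theorem IsRegularPair.exists_representation {ν μ ℓ : ℂ} (hν : ν ≠ 0) {A : ℝ} {f w : ℂ → ℂ}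
    (h : IsRegularPair A (fun z => phase ℓ μ z * (conj ν / solDenom ν μ z)) f w) :
    ∃ c a c' a', (∀ z, (z + μ) * f z + conj ν * phase ℓ μ z * conj (w z) = c + a * phase ℓ μ z) ∧
      ∀ z, ν * f z - conj (z + μ) * phase ℓ μ z * conj (w z) = c' + a' * phase ℓ μ z := by
  set X : ℂ → ℂ := fun z => (z + μ) * f z + conj ν * phase ℓ μ z * conj (w z) with hXdef
  set Y : ℂ → ℂ := fun z => ν * f z - conj (z + μ) * phase ℓ μ z * conj (w z) with hYdef
  have hfc := continuous_of_holder h.holder_fst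
  have hwc := continuous_of_holder h.holder_snd
  have hpc := (contDiff_phase ℓ μ).continuous
  have hX : Continuous X := by fun_prop
  have hY : Continuous Y := by fun_prop
  have hA : 0 ≤ A := by simpa using (norm_nonneg _).trans (h.norm_fst_le 0)
  have le_A {x z : ℂ} (hx : ‖x‖ ≤ A / (1 + ‖z‖)) : ‖x‖ ≤ A :=
    hx.trans (div_le_self hA (by linarith [norm_nonneg z]))
  have bX (z : ℂ) : ‖X z‖ ≤ (1 + ‖μ‖) * A + ‖ν‖ * A := by
    refine (norm_add_le _ _).trans (add_le_add ?_ ?_)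
    · rw [norm_mul]
      exact norm_add_mul_le (h.norm_fst_le z)
    · rw [norm_mul, norm_mul, norm_phase, mul_one, RCLike.norm_conj, RCLike.norm_conj]
      exact mul_le_mul_of_nonneg_left (le_A (h.norm_snd_le z)) (norm_nonneg _)
  have bY (z : ℂ) : ‖Y z‖ ≤ ‖ν‖ * A + (1 + ‖μ‖) * A := by
    refine (norm_sub_le _ _).trans (add_le_add ?_ ?_)
    · rw [norm_mul]
      exact mul_le_mul_of_nonneg_left (le_A (h.norm_fst_le z)) (norm_nonneg _)
    · rw [norm_mul, norm_mul, norm_phase, mul_one, RCLike.norm_conj, RCLike.norm_conj]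
      exact norm_add_mul_le (h.norm_snd_le z)
  have H1 : HasWeakDbar (fun z => conj (z + μ) * X z + conj ν * Y z) X := by
    refine (h.dbar_fst.mul (contDiff_solDenom ν μ)).congr_ae (.of_forall fun z => ?_)
      (.of_forall fun z => ?_)
    · simp only [hXdef, hYdef, solDenom]
      ring
    · have := solDenom_ne_zero hν μ z
      simp only [hXdef, wirtingerDbar_solDenom]
      field_simp
      ring
  have H2 : HasWeakDbar (fun z => phase ℓ μ z * (conj ν * conj (X z) - conj (z + μ) * conj (Y z)))
      (fun z => -(phase ℓ μ z * conj (Y z))) := by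
    refine (h.dbar_snd.mul (contDiff_solDenom ν μ)).congr_ae (.of_forall fun z => ?_)
      (.of_forall fun z => ?_)
    · simp only [hXdef, hYdef, solDenom, map_add, map_sub, map_mul, Complex.conj_conj]
      linear_combination (-(w z) * ((z + μ) * (conj z + conj μ) + ν * conj ν)) *
        phase_mul_conj ℓ μ z
    · have := solDenom_ne_zero hν μ z
      simp only [hYdef, wirtingerDbar_solDenom, map_sub, map_mul, Complex.conj_conj]
      field_simp
      linear_combination (-(z + μ) * w z) * phase_mul_conj ℓ μ z
  have h1 (η : ℂ → ℂ) (hη : IsTestFunction η) : conj ν * (∫ z, Y z * wirtingerDbar η z) +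
      ∫ z, X z * wirtingerDbar (fun z => conj (z + μ) * η z) z = 0 := by
    have t := H1.2.2 η hη
    have e (z : ℂ) : wirtingerDbar (fun z => conj (z + μ) * η z) z
        = conj (z + μ) * wirtingerDbar η z + η z := by
      rw [wirtingerDbar_mul (differentiableAt_of_contDiff (contDiff_conj_add_const μ))
        hη.differentiableAt, wirtingerDbar_conj_add_const]
      ring
    simp_rw [e]
    have hη2 := hη.wirtingerDbar.mul (contDiff_conj_add_const μ)
    rw [integral_mul_testFunction_add hX hη2 hη, ← integral_const_mul, ← add_assoc,
      ← integral_add ((hη.wirtingerDbar.integrable_mul hY.locallyIntegrable).const_mul _)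
      (hη2.integrable_mul hX.locallyIntegrable), add_eq_zero_iff_eq_neg, ← t]
    congr 1
    funext z
    ring
  have h2 (η : ℂ → ℂ) (hη : IsTestFunction η) :
      ν * (∫ z, X z * (conj (phase ℓ μ z) * wirtingerD η z)) -
      ∫ z, Y z * (conj (phase ℓ μ z) * wirtingerD (fun z => (z + μ) * η z) z) = 0 := by
    have t := H2.conj.2.2 η hη
    have e (z : ℂ) : conj (phase ℓ μ z) * wirtingerD (fun z => (z + μ) * η z) z
        = (z + μ) * (conj (phase ℓ μ z) * wirtingerD η z) + conj (phase ℓ μ z) * η z := by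
      rw [wirtingerD_mul (differentiableAt_of_contDiff (contDiff_add_const μ))
        hη.differentiableAt, wirtingerD_add_const]
      ring
    simp_rw [e]
    have hη1 := hη.wirtingerD.mul (contDiff_conj_phase ℓ μ)
    have hη2 := hη1.mul (contDiff_add_const μ)
    have hη3 := hη.mul (contDiff_conj_phase ℓ μ)
    rw [integral_mul_testFunction_add hY hη2 hη3, ← integral_const_mul, ← sub_sub,
      ← integral_sub ((hη1.integrable_mul hX.locallyIntegrable).const_mul _)
      (hη2.integrable_mul hY.locallyIntegrable), sub_eq_zero]
    convert t using 1
    · congr 1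
      funext z
      simp only [map_mul, map_sub, Complex.conj_conj]
      ring
    · rw [← integral_neg]
      congr 1
      funext z
      simp only [map_mul, map_neg, Complex.conj_conj]
      ring
  obtain ⟨c, a, hca⟩ := liouville_weak ℓ hX bX fun η hη => by
    obtain ⟨κ, hκ, e⟩ := wirtinger_div_solDenom (μ := μ) (ℓ := ℓ) hν hη
    simp_rw [← e]
    exact integral_fst_eq_zero hX h1 h2 hκ
  obtain ⟨c', a', hca'⟩ := liouville_weak ℓ hY bY fun η hη => by
    obtain ⟨κ, hκ, e⟩ := wirtinger_div_solDenom (μ := μ) (ℓ := ℓ) hν hη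
    simp_rw [← e]
    exact integral_snd_eq_zero hY h1 h2 hκ
  refine ⟨c, a * ek ℓ μ, c', a' * ek ℓ μ, fun z => ?_, fun z => ?_⟩
  · rw [mul_assoc a, ← ek_neg_eq_phase]
    exact hca z
  · rw [mul_assoc a', ← ek_neg_eq_phase]
    exact hca' z

theorem solDenom_mul_fst (ν μ ℓ z x y : ℂ) :
    solDenom ν μ z * x = conj (z + μ) * ((z + μ) * x + conj ν * phase ℓ μ z * conj y) +
      conj ν * (ν * x - conj (z + μ) * phase ℓ μ z * conj y) := by
  rw [solDenom]
  ring

theorem solDenom_mul_snd (ν μ ℓ z x y : ℂ) :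
    solDenom ν μ z * y = phase ℓ μ z *
      (conj ν * conj ((z + μ) * x + conj ν * phase ℓ μ z * conj y) -
        conj (z + μ) * conj (ν * x - conj (z + μ) * phase ℓ μ z * conj y)) := by
  rw [solDenom]
  simp only [map_add, map_sub, map_mul, Complex.conj_conj]
  linear_combination (-y * ((z + μ) * (conj z + conj μ) + ν * conj ν)) * phase_mul_conj ℓ μ z

theorem IsRegularPair.eq_of_phase_zero {ν μ : ℂ} (hν : ν ≠ 0) {A : ℝ} {f w : ℂ → ℂ}
    (h : IsRegularPair A (fun z => conj ν / solDenom ν μ z) f w) :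
    ∃ c d, ∀ z, f z = (conj (z + μ) * c + conj ν * d) / solDenom ν μ z ∧
      w z = (conj ν * conj c - conj (z + μ) * conj d) / solDenom ν μ z := by
  have h' : IsRegularPair A (fun z => phase 0 μ z * (conj ν / solDenom ν μ z)) f w := by
    simpa only [phase_zero, one_mul] using h
  obtain ⟨c, a, c', a', hc, hc'⟩ := h'.exists_representation hν
  refine ⟨c + a, c' + a', fun z => ?_⟩
  have hρ := solDenom_ne_zero hν μ z
  rw [eq_div_iff hρ, eq_div_iff hρ, mul_comm (f z), mul_comm (w z),
    solDenom_mul_fst ν μ 0 z (f z) (w z), solDenom_mul_snd ν μ 0 z (f z) (w z), hc, hc',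
    phase_zero]
  simp

/-- The representation carries four constants. Each of the two equations, differentiated with iℓ̄ ≠
0, forces an affine function of conj(z+μ) to vanish identically and so removes two of them. -/
theorem IsRegularPair.eq_zero_of_phase {ν μ ℓ : ℂ} (hν : ν ≠ 0) (hℓ : ℓ ≠ 0) {A : ℝ}
    {f w : ℂ → ℂ}
    (h : IsRegularPair A (fun z => phase ℓ μ z * (conj ν / solDenom ν μ z)) f w) (z : ℂ) :
    f z = 0 ∧ w z = 0 := by
  obtain ⟨c, a, c', a', hc, hc'⟩ := h.exists_representation hν
  have hcℓ : Complex.I * conj ℓ ≠ 0 := mul_ne_zero Complex.I_ne_zero (by simpa using hℓ)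
  have hcν : conj ν ≠ 0 := by simpa using hν
  have hp := contDiff_phase ℓ μ
  have hpd (z : ℂ) := differentiableAt_of_contDiff hp (z := z)
  have hs := contDiff_conj_add_const μ
  have hsd (z : ℂ) := differentiableAt_of_contDiff hs (z := z)
  have hp0 (z : ℂ) : phase ℓ μ z ≠ 0 := ek_ne_zero _ _
  -- An affine function of conj(z+μ) is determined by its values at z = -μ and z = 1-μ.
  have lin {x y : ℂ} (hxy : ∀ z, conj (z + μ) * x + conj ν * y = 0) : x = 0 ∧ y = 0 := by
    have r1 : conj ν * y = 0 := by simpa using hxy (-μ)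
    have r2 := hxy (1 - μ)
    rw [r1, sub_add_cancel, map_one] at r2
    exact ⟨by simpa using r2, (mul_eq_zero.1 r1).resolve_left hcν⟩
  have e1 : HasWeakDbar (fun z => conj (z + μ) * (c + a * phase ℓ μ z)
      + conj ν * (c' + a' * phase ℓ μ z)) (fun z => c + a * phase ℓ μ z) := by
    refine (h.dbar_fst.mul (contDiff_solDenom ν μ)).congr_ae (.of_forall fun z => ?_)
      (.of_forall fun z => ?_)
    · simp only
      rw [solDenom_mul_fst ν μ ℓ z (f z) (w z), hc, hc']
    · have := solDenom_ne_zero hν μ z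
      simp only [wirtingerDbar_solDenom, ← hc]
      field_simp
      ring
  have d1 (z : ℂ) : conj (z + μ) * a + conj ν * a' = 0 := by
    have hXs : ContDiff ℝ (⊤ : ℕ∞) (fun z => c + a * phase ℓ μ z) :=
      contDiff_const.add (contDiff_const.mul hp)
    have hYs : ContDiff ℝ (⊤ : ℕ∞) (fun z => c' + a' * phase ℓ μ z) :=
      contDiff_const.add (contDiff_const.mul hp)
    have t := e1.eq_wirtingerDbar ((hs.mul hXs).add (contDiff_const.mul hYs)) hXs.continuous z
    have dX (c a : ℂ) : wirtingerDbar (fun z => c + a * phase ℓ μ z) z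
        = a * (-(Complex.I * conj ℓ) * phase ℓ μ z) := by
      rw [wirtingerDbar_add (differentiableAt_const _) ((hpd z).const_mul _),
        wirtingerDbar_const, wirtingerDbar_const_mul _ (hpd z), wirtingerDbar_phase, zero_add]
    have dd (c a : ℂ) : DifferentiableAt ℝ (fun z => c + a * phase ℓ μ z) z :=
      (differentiableAt_const _).add ((hpd z).const_mul _)
    rw [wirtingerDbar_add ((hsd z).fun_mul (dd c a)) ((dd c' a').const_mul _),
      wirtingerDbar_mul (hsd z) (dd c a), wirtingerDbar_const_mul _ (dd c' a'), dX, dX,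
      wirtingerDbar_conj_add_const] at t
    have t2 : (Complex.I * conj ℓ) * phase ℓ μ z * (conj (z + μ) * a + conj ν * a') = 0 := by
      linear_combination -t
    exact (mul_eq_zero.1 t2).resolve_left (mul_ne_zero hcℓ (hp0 z))
  obtain ⟨rfl, rfl⟩ := lin d1
  simp only [zero_mul, add_zero] at hc hc'
  have e2 : HasWeakDbar (fun z => phase ℓ μ z * (conj (z + μ) * (-conj c') + conj ν * conj c))
      (fun z => -(conj c') * phase ℓ μ z) := by
    refine (h.dbar_snd.mul (contDiff_solDenom ν μ)).congr_ae (.of_forall fun z => ?_)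
      (.of_forall fun z => ?_)
    · simp only
      rw [solDenom_mul_snd ν μ ℓ z (f z) (w z), hc, hc']
      ring
    · have := solDenom_ne_zero hν μ z
      simp only [wirtingerDbar_solDenom, ← hc' z, map_sub, map_mul, Complex.conj_conj]
      field_simp
      linear_combination (-(z + μ) * w z) * phase_mul_conj ℓ μ z
  have d2 (z : ℂ) : conj (z + μ) * (-conj c') + conj ν * conj c = 0 := by
    have hT : ContDiff ℝ (⊤ : ℕ∞) (fun z => conj (z + μ) * (-conj c') + conj ν * conj c) :=
      (hs.mul contDiff_const).add contDiff_const
    have t := e2.eq_wirtingerDbar (hp.mul hT) (contDiff_const.mul hp).continuous z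
    rw [wirtingerDbar_mul (hpd z) (differentiableAt_of_contDiff hT), wirtingerDbar_phase,
      wirtingerDbar_add ((hsd z).fun_mul (differentiableAt_const _)) (differentiableAt_const _),
      wirtingerDbar_mul (hsd z) (differentiableAt_const _), wirtingerDbar_conj_add_const,
      wirtingerDbar_const, wirtingerDbar_const] at t
    have t2 : (Complex.I * conj ℓ) * phase ℓ μ z *
        (conj (z + μ) * (-conj c') + conj ν * conj c) = 0 := by
      linear_combination -t
    exact (mul_eq_zero.1 t2).resolve_left (mul_ne_zero hcℓ (hp0 z))
  obtain ⟨r1, r2⟩ := lin d2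
  have hc0 : c = 0 := by simpa using r2
  have hc0' : c' = 0 := by simpa using r1
  have hρ := solDenom_ne_zero hν μ z
  have s1 := solDenom_mul_fst ν μ ℓ z (f z) (w z)
  have s2 := solDenom_mul_snd ν μ ℓ z (f z) (w z)
  rw [hc, hc', hc0, hc0'] at s1 s2
  constructor
  · simpa [hρ] using s1
  · simpa [hρ] using s2

/-! ### Compactness of regular pairs -/

/-- Arzelà–Ascoli for the compact-open topology: the uniform Hölder bound gives equicontinuity, and
the set of admissible functions is compact in the product topology. -/
theorem exists_subseq_tendsto {A : ℝ} {f : ℕ → ℂ → ℂ} (hb : ∀ n z, ‖f n z‖ ≤ A)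
    (hh : ∀ n z z', ‖f n z - f n z'‖ ≤ A * ‖z - z'‖ ^ (1 / 2 : ℝ)) :
    ∃ (g : ℂ → ℂ) (φ : ℕ → ℕ), StrictMono φ ∧ ∀ z, Tendsto (fun n => f (φ n) z) atTop (𝓝 (g z)) := by
  set S : Set C(ℂ, ℂ) :=
    {g | (∀ z, ‖g z‖ ≤ A) ∧ ∀ z z', ‖g z - g z'‖ ≤ A * ‖z - z'‖ ^ (1 / 2 : ℝ)} with hS
  have himage : ContinuousMap.toFun '' S = {g : ℂ → ℂ | (∀ z, ‖g z‖ ≤ A) ∧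
      ∀ z z', ‖g z - g z'‖ ≤ A * ‖z - z'‖ ^ (1 / 2 : ℝ)} := by
    ext g
    constructor
    · rintro ⟨h, hh, rfl⟩
      exact hh
    · intro hg
      exact ⟨⟨g, continuous_of_holder hg.2⟩, hg, rfl⟩
  have hcpt : IsCompact (ContinuousMap.toFun '' S) := by
    rw [himage]
    refine (isCompact_univ_pi fun _ : ℂ => isCompact_closedBall (0 : ℂ) A).of_isClosed_subset
      ?_ fun g hg z _ => by simpa using hg.1 z
    have e : {g : ℂ → ℂ | (∀ z, ‖g z‖ ≤ A) ∧ ∀ z z', ‖g z - g z'‖ ≤ A * ‖z - z'‖ ^ (1 / 2 : ℝ)}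
        = (⋂ z, {g : ℂ → ℂ | ‖g z‖ ≤ A}) ∩
          ⋂ z, ⋂ z', {g : ℂ → ℂ | ‖g z - g z'‖ ≤ A * ‖z - z'‖ ^ (1 / 2 : ℝ)} := by
      ext g
      simp
    rw [e]
    refine IsClosed.inter ?_ ?_
    · exact isClosed_iInter fun z =>
        isClosed_le (continuous_apply z).norm continuous_const
    · exact isClosed_iInter fun z => isClosed_iInter fun z' =>
        isClosed_le ((continuous_apply z).sub (continuous_apply z')).norm continuous_const
  have hequi : Equicontinuous ((↑) : S → ℂ → ℂ) := by
    intro z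
    rw [Metric.equicontinuousAt_iff_right]
    intro ε hε
    have hc : Continuous (fun y => A * ‖z - y‖ ^ (1 / 2 : ℝ)) := by
      refine continuous_const.mul
        (Continuous.rpow_const (by fun_prop) fun x => Or.inr (by norm_num))
    have hlim : Tendsto (fun y => A * ‖z - y‖ ^ (1 / 2 : ℝ)) (𝓝 z) (𝓝 0) := by
      simpa using! hc.tendsto z
    filter_upwards [hlim.eventually (gt_mem_nhds hε)] with y hy g
    rw [dist_eq_norm]
    exact (g.2.2 z y).trans_lt hy
  have hSc : IsCompact S := ArzelaAscoli.isCompact_of_equicontinuous S hcpt hequi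
  set F : ℕ → C(ℂ, ℂ) := fun n => ⟨f n, continuous_of_holder (hh n)⟩
  obtain ⟨g, -, φ, hφ, hlim⟩ := hSc.isSeqCompact (x := F) fun n => ⟨hb n, hh n⟩
  refine ⟨g, φ, hφ, fun z => ?_⟩
  exact ((continuous_eval_const z).tendsto g).comp hlim

theorem IsRegularPair.nonneg {A : ℝ} {q f w : ℂ → ℂ} (h : IsRegularPair A q f w) : 0 ≤ A := by
  simpa using (norm_nonneg _).trans (h.norm_fst_le 0)

theorem exists_subseq_isRegularPair {A : ℝ} {q f w : ℕ → ℂ → ℂ}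
    (h : ∀ n, IsRegularPair A (q n) (f n) (w n)) :
    ∃ (f₀ w₀ : ℂ → ℂ) (φ : ℕ → ℕ), StrictMono φ ∧
      (∀ z, Tendsto (fun n => f (φ n) z) atTop (𝓝 (f₀ z))) ∧
      (∀ z, Tendsto (fun n => w (φ n) z) atTop (𝓝 (w₀ z))) := by
  have hA := (h 0).nonneg
  have le_A {x z : ℂ} (hx : ‖x‖ ≤ A / (1 + ‖z‖)) : ‖x‖ ≤ A :=
    hx.trans (div_le_self hA (by linarith [norm_nonneg z]))
  obtain ⟨f₀, φ, hφ, hf⟩ := exists_subseq_tendsto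
    (fun n z => le_A ((h n).norm_fst_le z)) (fun n => (h n).holder_fst)
  obtain ⟨w₀, ψ, hψ, hw⟩ := exists_subseq_tendsto (f := fun n => w (φ n))
    (fun n z => le_A ((h (φ n)).norm_snd_le z)) (fun n => (h (φ n)).holder_snd)
  exact ⟨f₀, w₀, φ ∘ ψ, hφ.comp hψ, fun z => (hf z).comp hψ.tendsto_atTop, hw⟩

theorem integrable_decay_rpow {A p : ℝ} (hp : 2 < p) (hA : 0 ≤ A) :
    Integrable (fun z : ℂ => (A / (1 + ‖z‖)) ^ p) := by
  refine ((integrable_one_add_norm_rpow hp).const_mul (A ^ p)).congr (.of_forall fun z => ?_)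
  simp only
  rw [Real.div_rpow hA (by positivity), Real.rpow_neg (by positivity), div_eq_mul_inv]

/-- The common bound (A/(1+|z|))^p is integrable since p > 2, so no mass escapes to infinity.
Normalised pairs therefore have a nonzero limit. -/
theorem tendsto_integral_norm_rpow {A p : ℝ} (hp : 2 < p) {q f w : ℕ → ℂ → ℂ} {f₀ w₀ : ℂ → ℂ}
    (h : ∀ n, IsRegularPair A (q n) (f n) (w n))
    (hf : ∀ z, Tendsto (fun n => f n z) atTop (𝓝 (f₀ z)))
    (hw : ∀ z, Tendsto (fun n => w n z) atTop (𝓝 (w₀ z))) :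
    Tendsto (fun n => ∫ z, (‖f n z‖ ^ p + ‖w n z‖ ^ p)) atTop
      (𝓝 (∫ z, (‖f₀ z‖ ^ p + ‖w₀ z‖ ^ p))) := by
  have hA := (h 0).nonneg
  have hp0 : 0 ≤ p := by linarith
  refine tendsto_integral_of_dominated_convergence
    (fun z => (A / (1 + ‖z‖)) ^ p + (A / (1 + ‖z‖)) ^ p) (fun n => ?_)
    ((integrable_decay_rpow hp hA).add (integrable_decay_rpow hp hA))
    (fun n => .of_forall fun z => ?_) (.of_forall fun z => ?_)
  · have h1 := continuous_of_holder (h n).holder_fst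
    have h2 := continuous_of_holder (h n).holder_snd
    exact ((h1.norm.rpow_const fun _ => Or.inr hp0).add
      (h2.norm.rpow_const fun _ => Or.inr hp0)).aestronglyMeasurable
  · rw [Real.norm_of_nonneg (by positivity)]
    have h1 := (h n).norm_fst_le z
    have h2 := (h n).norm_snd_le z
    gcongr
  · exact ((hf z).norm.rpow_const (Or.inr hp0)).add ((hw z).norm.rpow_const (Or.inr hp0))

theorem IsRegularPair.of_tendsto {A K : ℝ} {q f w : ℕ → ℂ → ℂ} {q₀ f₀ w₀ : ℂ → ℂ}
    (h : ∀ n, IsRegularPair A (q n) (f n) (w n)) (hqc : ∀ n, Continuous (q n))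
    (hq₀ : Continuous q₀) (hqK : ∀ n z, ‖q n z‖ ≤ K)
    (hq : ∀ z, Tendsto (fun n => q n z) atTop (𝓝 (q₀ z)))
    (hf : ∀ z, Tendsto (fun n => f n z) atTop (𝓝 (f₀ z)))
    (hw : ∀ z, Tendsto (fun n => w n z) atTop (𝓝 (w₀ z))) :
    IsRegularPair A q₀ f₀ w₀ := by
  have hA := (h 0).nonneg
  have hK : 0 ≤ K := (norm_nonneg _).trans (hqK 0 0)
  have le_A {x z : ℂ} (hx : ‖x‖ ≤ A / (1 + ‖z‖)) : ‖x‖ ≤ A :=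
    hx.trans (div_le_self hA (by linarith [norm_nonneg z]))
  have b1 (z : ℂ) : ‖f₀ z‖ ≤ A / (1 + ‖z‖) :=
    le_of_tendsto' (hf z).norm fun n => (h n).norm_fst_le z
  have b2 (z : ℂ) : ‖w₀ z‖ ≤ A / (1 + ‖z‖) :=
    le_of_tendsto' (hw z).norm fun n => (h n).norm_snd_le z
  have c1 (z z' : ℂ) : ‖f₀ z - f₀ z'‖ ≤ A * ‖z - z'‖ ^ (1 / 2 : ℝ) :=
    le_of_tendsto' ((hf z).sub (hf z')).norm fun n => (h n).holder_fst z z'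
  have c2 (z z' : ℂ) : ‖w₀ z - w₀ z'‖ ≤ A * ‖z - z'‖ ^ (1 / 2 : ℝ) :=
    le_of_tendsto' ((hw z).sub (hw z')).norm fun n => (h n).holder_snd z z'
  have lim (v : ℕ → ℂ → ℂ) (v₀ : ℂ → ℂ) (hvc : ∀ n, Continuous (v n)) (C : ℝ)
      (hv : ∀ n z, ‖v n z‖ ≤ C) (hvl : ∀ z, Tendsto (fun n => v n z) atTop (𝓝 (v₀ z)))
      (η : ℂ → ℂ) (hη : IsTestFunction η) :
      Tendsto (fun n => ∫ z, v n z * η z) atTop (𝓝 (∫ z, v₀ z * η z)) := by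
    refine tendsto_integral_of_dominated_convergence (fun z => C * ‖η z‖)
      (fun n => ((hvc n).mul hη.continuous).aestronglyMeasurable)
      (hη.integrable.norm.const_mul C) (fun n => .of_forall fun z => ?_)
      (.of_forall fun z => (hvl z).mul_const _)
    rw [norm_mul]
    exact mul_le_mul_of_nonneg_right (hv n z) (norm_nonneg _)
  have hfc (n : ℕ) := continuous_of_holder (h n).holder_fst
  have hwc (n : ℕ) := continuous_of_holder (h n).holder_snd
  have hf₀ := continuous_of_holder c1
  have hw₀ := continuous_of_holder c2
  refine ⟨b1, b2, c1, c2, ⟨hf₀.locallyIntegrable, Continuous.locallyIntegrable (by fun_prop),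
    fun η hη => ?_⟩, ⟨hw₀.locallyIntegrable, Continuous.locallyIntegrable (by fun_prop),
    fun η hη => ?_⟩⟩
  · refine tendsto_nhds_unique (lim f f₀ hfc A (fun n z => le_A ((h n).norm_fst_le z)) hf _
      hη.wirtingerDbar) ?_
    simp_rw [(h _).dbar_fst.2.2 η hη]
    refine (lim (fun n z => q n z * conj (w n z)) _ (fun n => by fun_prop) (K * A)
      (fun n z => ?_) (fun z => ?_) η hη).neg
    · rw [norm_mul, RCLike.norm_conj]
      exact mul_le_mul (hqK n z) (le_A ((h n).norm_snd_le z)) (norm_nonneg _) hK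
    · exact (hq z).mul ((Complex.continuous_conj.tendsto _).comp (hw z))
  · refine tendsto_nhds_unique (lim w w₀ hwc A (fun n z => le_A ((h n).norm_snd_le z)) hw _
      hη.wirtingerDbar) ?_
    simp_rw [(h _).dbar_snd.2.2 η hη]
    refine (lim (fun n z => -(q n z * conj (f n z))) _ (fun n => by fun_prop) (K * A)
      (fun n z => ?_) (fun z => ?_) η hη).neg
    · rw [norm_neg, norm_mul, RCLike.norm_conj]
      exact mul_le_mul (hqK n z) (le_A ((h n).norm_fst_le z)) (norm_nonneg _) hK
    · exact ((hq z).mul ((Complex.continuous_conj.tendsto _).comp (hf z))).neg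

/-! ### Reduction of the spectral problem -/

theorem memLp_of_decay {A p : ℝ} (hp : 2 < p) {f : ℂ → ℂ} (hf : AEStronglyMeasurable f)
    (hA : ∀ z, ‖f z‖ ≤ A / (1 + ‖z‖)) : MemLp f (ENNReal.ofReal p) := by
  have hA0 : 0 ≤ A := by simpa using (norm_nonneg _).trans (hA 0)
  have hp0 : 0 < p := by linarith
  rw [← integrable_norm_rpow_iff hf (by simpa using hp0) (by simp)]
  rw [ENNReal.toReal_ofReal hp0.le]
  refine (integrable_decay_rpow hp hA0).mono' ?_ (.of_forall fun z => ?_)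
  · exact (hf.norm.aemeasurable.pow_const p).aestronglyMeasurable
  · rw [Real.norm_of_nonneg (by positivity)]
    have := hA z
    gcongr

theorem MemLp.continuous_unimodular_mul {p : ENNReal} {f e : ℂ → ℂ} (hf : MemLp f p)
    (he : Continuous e) (h1 : ∀ z, ‖e z‖ = 1) : MemLp (fun z => e z * f z) p :=
  hf.congr_norm (he.aestronglyMeasurable.mul hf.aestronglyMeasurable)
    (.of_forall fun z => by rw [norm_mul, h1, one_mul])

theorem MemLp.conj {p : ENNReal} {f : ℂ → ℂ} (hf : MemLp f p) : MemLp (fun z => conj (f z)) p :=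
  hf.congr_norm (Complex.continuous_conj.comp_aestronglyMeasurable hf.aestronglyMeasurable)
    (.of_forall fun z => by rw [RCLike.norm_conj])

theorem rhs_zero_apply (u : ℂ → ℂ) (M : ℂ → Matrix (Fin 2) (Fin 2) ℂ) (z : ℂ) (j : Fin 2) :
    rhs u M z 0 j = 1 / 2 * (u z * M z 1 j) := by
  rw [rhs, Matrix.smul_apply, Matrix.mul_apply, Fin.sum_univ_two]
  simp [potentialMatrix]

theorem rhs_one_apply (u : ℂ → ℂ) (M : ℂ → Matrix (Fin 2) (Fin 2) ℂ) (z : ℂ) (j : Fin 2) :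
    rhs u M z 1 j = -(1 / 2 * (conj (u z) * M z 0 j)) := by
  rw [rhs, Matrix.smul_apply, Matrix.mul_apply, Fin.sum_univ_two]
  simp [potentialMatrix]

/-- Each column of M solves a closed system. If the first column is nonzero, (M₁₁, c e_{-k} conj
M₂₁) works; otherwise the second column is nonzero and (conj M₂₂, -c e_{-k} M₁₂) works. The
exponential absorbs the terms ik and -ik̄. The constant c is kept free so that it can later move the
phase to the centre -μ of the soliton. -/
theorem exists_pair_of_mem_exceptionalSet {p : ℝ} {u : ℂ → ℂ} {k c : ℂ} (hc : ‖c‖ = 1)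
    (h : k ∈ exceptionalSet p u) :
    ∃ f w : ℂ → ℂ, MemLp f (ENNReal.ofReal p) ∧ MemLp w (ENNReal.ofReal p) ∧
      ¬ (f =ᵐ[volume] 0 ∧ w =ᵐ[volume] 0) ∧
      HasWeakDbar f (fun z => 1 / 2 * c * u z * ek (-k) z * conj (w z)) ∧
      HasWeakDbar w (fun z => -(1 / 2 * c * u z * ek (-k) z * conj (f z))) := by
  obtain ⟨M, hM, hne, h00, h01, h10, h11⟩ := h
  have hcc : c * conj c = 1 := by
    rw [Complex.mul_conj, Complex.normSq_eq_norm_sq, hc]; simp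
  have hc0 : c ≠ 0 := by rw [← norm_pos_iff, hc]; exact one_pos
  have hek := contDiff_ek (-k)
  have hee (z : ℂ) : ek (-k) z * conj (ek (-k) z) = 1 := by
    rw [conj_ek, ek_mul_ek_neg]
  have hce : ContDiff ℝ (⊤ : ℕ∞) (fun z => c * ek (-k) z) := contDiff_const.mul hek
  have hce1 (z : ℂ) : ‖c * ek (-k) z‖ = 1 := by rw [norm_mul, hc, norm_ek, one_mul]
  have dce (z : ℂ) : wirtingerDbar (fun z => c * ek (-k) z) z
      = -(Complex.I * conj k) * (c * ek (-k) z) := by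
    rw [wirtingerDbar_const_mul _ (differentiableAt_of_contDiff hek), wirtingerDbar_ek, map_neg]
    ring
  by_cases h1 : (fun z => M z 0 0) =ᵐ[volume] 0 ∧ (fun z => M z 1 0) =ᵐ[volume] 0
  · refine ⟨fun z => conj (M z 1 1), fun z => -(c * ek (-k) z * M z 0 1), MemLp.conj (hM 1 1),
      (MemLp.continuous_unimodular_mul (hM 0 1) hce.continuous hce1).neg, ?_, ?_, ?_⟩
    · rintro ⟨h2, h3⟩
      apply hne
      filter_upwards [h1.1, h1.2, h2, h3] with z e1 e2 e3 e4
      ext i j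
      fin_cases i <;> fin_cases j
      · exact e1
      · simpa [hc0, ek_ne_zero] using e4
      · exact e2
      · simpa using e3
    · refine h11.conj.congr_ae .rfl (.of_forall fun z => ?_)
      simp only [rhs_one_apply, map_neg, map_mul, map_div₀, map_one, map_ofNat, Complex.conj_conj]
      linear_combination (1 / 2 * u z * conj (M z 0 1)) *
        (c * conj c * hee z + hcc)
    · refine ((h01.mul hce).const_mul (-1)).congr_ae (.of_forall fun z => by simp)
        (.of_forall fun z => ?_)
      simp [rhs_zero_apply, dce]
      ring
  · refine ⟨fun z => M z 0 0, fun z => c * ek (-k) z * conj (M z 1 0), hM 0 0,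
      MemLp.continuous_unimodular_mul (MemLp.conj (hM 1 0)) hce.continuous hce1, ?_, ?_, ?_⟩
    · rintro ⟨h2, h3⟩
      refine h1 ⟨h2, ?_⟩
      filter_upwards [h3] with z e
      simpa [hc0, ek_ne_zero] using e
    · refine h00.congr_ae .rfl (.of_forall fun z => ?_)
      simp only [rhs_zero_apply, map_mul, Complex.conj_conj]
      linear_combination (-1 / 2 * u z * M z 1 0) * (c * conj c * hee z + hcc)
    · refine (h10.conj.mul hce).congr_ae .rfl (.of_forall fun z => ?_)
      simp [rhs_one_apply, dce, map_ofNat]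
      ring

/-! ### The bound state of the soliton -/

theorem contDiff_inv_solDenom {ν : ℂ} (hν : ν ≠ 0) (μ : ℂ) :
    ContDiff ℝ (⊤ : ℕ∞) (fun z => (solDenom ν μ z)⁻¹) :=
  (contDiff_solDenom ν μ).inv (solDenom_ne_zero hν μ)

theorem wirtingerDbar_inv_solDenom {ν : ℂ} (hν : ν ≠ 0) (μ z : ℂ) :
    wirtingerDbar (fun z => (solDenom ν μ z)⁻¹) z = -(z + μ) / solDenom ν μ z ^ 2 := by
  have hρ := contDiff_solDenom ν μ
  have h := wirtingerDbar_mul (differentiableAt_of_contDiff hρ (z := z))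
    (differentiableAt_of_contDiff (contDiff_inv_solDenom hν μ) (z := z))
  have e : (fun z => solDenom ν μ z * (solDenom ν μ z)⁻¹) = fun _ => 1 :=
    funext fun z => mul_inv_cancel₀ (solDenom_ne_zero hν μ z)
  rw [e, wirtingerDbar_const, wirtingerDbar_solDenom] at h
  have hz := solDenom_ne_zero hν μ z
  field_simp at h ⊢
  linear_combination -h

theorem contDiff_conj_div_solDenom {ν : ℂ} (hν : ν ≠ 0) (μ : ℂ) :
    ContDiff ℝ (⊤ : ℕ∞) (fun z => conj (z + μ) / solDenom ν μ z) :=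
  (contDiff_conj_add_const μ).mul (contDiff_inv_solDenom hν μ)

theorem contDiff_const_div_solDenom {ν : ℂ} (hν : ν ≠ 0) (μ c : ℂ) :
    ContDiff ℝ (⊤ : ℕ∞) (fun z => c / solDenom ν μ z) :=
  contDiff_const.mul (contDiff_inv_solDenom hν μ)

theorem wirtingerDbar_const_div_solDenom {ν : ℂ} (hν : ν ≠ 0) (μ c z : ℂ) :
    wirtingerDbar (fun z => c / solDenom ν μ z) z = -c * (z + μ) / solDenom ν μ z ^ 2 := by
  simp_rw [div_eq_mul_inv c]
  rw [wirtingerDbar_const_mul _ (differentiableAt_of_contDiff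
    (contDiff_inv_solDenom hν μ)), wirtingerDbar_inv_solDenom hν]
  ring

theorem wirtingerDbar_conj_div_solDenom {ν : ℂ} (hν : ν ≠ 0) (μ z : ℂ) :
    wirtingerDbar (fun z => conj (z + μ) / solDenom ν μ z) z
      = ν * conj ν / solDenom ν μ z ^ 2 := by
  simp_rw [div_eq_mul_inv (conj (_ + μ))]
  rw [wirtingerDbar_mul (differentiableAt_of_contDiff (contDiff_conj_add_const μ))
    (differentiableAt_of_contDiff (contDiff_inv_solDenom hν μ)),
    wirtingerDbar_inv_solDenom hν, wirtingerDbar_conj_add_const]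
  have hz := solDenom_ne_zero hν μ z
  field_simp
  rw [solDenom]
  ring

theorem exists_le_norm_solDenom {ν : ℂ} (hν : ν ≠ 0) (μ : ℂ) :
    ∃ C : ℝ, 0 < C ∧ ∀ z, (1 + ‖z‖) ^ 2 ≤ C * ‖solDenom ν μ z‖ := by
  have hν' := norm_pos_iff.2 hν
  refine ⟨2 * ((1 + ‖μ‖) ^ 2 / ‖ν‖ ^ 2 + 1), by positivity, fun z => ?_⟩
  rw [norm_solDenom]
  have h1 : ‖z‖ ≤ ‖z + μ‖ + ‖μ‖ := by
    simpa using norm_sub_le (z + μ) μ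
  have h2 : (1 + ‖z‖) ^ 2 ≤ (1 + ‖μ‖ + ‖z + μ‖) ^ 2 := by
    gcongr ?_ ^ 2
    linarith
  have h3 : (1 + ‖μ‖ + ‖z + μ‖) ^ 2 ≤ 2 * ((1 + ‖μ‖) ^ 2 + ‖z + μ‖ ^ 2) := by
    nlinarith [sq_nonneg (1 + ‖μ‖ - ‖z + μ‖)]
  have h4 : 2 * ((1 + ‖μ‖) ^ 2 / ‖ν‖ ^ 2 + 1) * (‖z + μ‖ ^ 2 + ‖ν‖ ^ 2)
      = 2 * ((1 + ‖μ‖) ^ 2 + ‖z + μ‖ ^ 2)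
        + 2 * ((1 + ‖μ‖) ^ 2 / ‖ν‖ ^ 2 * ‖z + μ‖ ^ 2 + ‖ν‖ ^ 2) := by
    field_simp
    ring
  have h5 : 0 ≤ 2 * ((1 + ‖μ‖) ^ 2 / ‖ν‖ ^ 2 * ‖z + μ‖ ^ 2 + ‖ν‖ ^ 2) := by positivity
  linarith

theorem exists_norm_const_div_solDenom_le {ν : ℂ} (hν : ν ≠ 0) (μ c : ℂ) :
    ∃ K : ℝ, 0 ≤ K ∧ ∀ z, ‖c / solDenom ν μ z‖ ≤ K / (1 + ‖z‖) ^ 2 := by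
  obtain ⟨C, hC, h⟩ := exists_le_norm_solDenom hν μ
  refine ⟨‖c‖ * C, by positivity, fun z => ?_⟩
  have hρ : 0 < ‖solDenom ν μ z‖ := norm_pos_iff.2 (solDenom_ne_zero hν μ z)
  rw [norm_div, div_le_div_iff₀ hρ (by positivity)]
  have := mul_le_mul_of_nonneg_left (h z) (norm_nonneg c)
  linarith

theorem exists_norm_conj_div_solDenom_le {ν : ℂ} (hν : ν ≠ 0) (μ : ℂ) :
    ∃ K : ℝ, 0 ≤ K ∧ ∀ z, ‖conj (z + μ) / solDenom ν μ z‖ ≤ K / (1 + ‖z‖) := by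
  obtain ⟨K, hK, h⟩ := exists_norm_const_div_solDenom_le hν μ 1
  refine ⟨(1 + ‖μ‖) * K, by positivity, fun z => ?_⟩
  have e : conj (z + μ) / solDenom ν μ z = conj (z + μ) * (1 / solDenom ν μ z) := by ring
  rw [e, norm_mul, RCLike.norm_conj]
  calc ‖z + μ‖ * ‖1 / solDenom ν μ z‖
      ≤ ((1 + ‖μ‖) * (1 + ‖z‖)) * (K / (1 + ‖z‖) ^ 2) := by
        gcongr
        exacts [norm_add_le_mul μ z, h z]
    _ = _ := by field_simp

theorem soliton_eq (k₀ ν μ z : ℂ) :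
    soliton k₀ ν μ z = 2 * conj ν * ek k₀ z / solDenom ν μ z := by
  rw [soliton, solDenom_eq]
  rfl

/-- The witness has the bound state as first column and zero as second. Its slowest entry decays
like |z|⁻¹, which lies in L^p because p > 2. -/
theorem mem_exceptionalSet_soliton {p : ℝ} (hp : 2 < p) {ν : ℂ} (hν : ν ≠ 0) (k₀ μ : ℂ) :
    k₀ ∈ exceptionalSet p (soliton k₀ ν μ) := by
  have hρ := solDenom_ne_zero hν μ
  have hf := contDiff_conj_div_solDenom hν μ
  have hw := contDiff_const_div_solDenom hν μ (conj ν)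
  have hg := (contDiff_ek k₀).mul hw
  obtain ⟨K, -, hK⟩ := exists_norm_conj_div_solDenom_le hν μ
  obtain ⟨K', hK0, hK'⟩ := exists_norm_const_div_solDenom_le hν μ (conj ν)
  have hz : HasWeakDbar (fun _ => (0 : ℂ)) (fun _ => 0) :=
    ⟨continuous_const.locallyIntegrable, continuous_const.locallyIntegrable, by simp⟩
  have hz' : HasWeakD (fun _ => (0 : ℂ)) (fun _ => 0) := by
    simpa using hz.conj
  refine ⟨fun z => !![conj (z + μ) / solDenom ν μ z, 0;
    conj (ek k₀ z * (conj ν / solDenom ν μ z)), 0], ?_, ?_, ?_, ?_, ?_, ?_⟩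
  · intro i j
    fin_cases i <;> fin_cases j
    · exact memLp_of_decay hp hf.continuous.aestronglyMeasurable hK
    · exact MemLp.zero
    · refine MemLp.conj (memLp_of_decay (A := K') hp hg.continuous.aestronglyMeasurable
        fun z => ?_)
      rw [norm_mul, norm_ek, one_mul]
      refine (hK' z).trans ?_
      gcongr
      exact le_self_pow₀ (by linarith [norm_nonneg z]) two_ne_zero
    · exact MemLp.zero
  · intro h
    have h1 : ∀ᵐ z : ℂ, False := by
      filter_upwards [h] with z hz
      have := congrFun (congrFun hz 1) 0
      simp [ek_ne_zero, hν, hρ z] at this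
    exact h1.exists.elim fun _ h2 => h2
  · refine (hasWeakDbar_of_contDiff hf).congr_ae (.of_forall fun z => by simp)
      (.of_forall fun z => ?_)
    have hz := hρ z
    simp only [rhs_zero_apply, wirtingerDbar_conj_div_solDenom hν, soliton_eq]
    simp [conj_solDenom, conj_ek]
    field_simp
    linear_combination (- conj ν) * ek_mul_ek_neg k₀ z
  · refine hz.congr_ae (.of_forall fun z => by simp) (.of_forall fun z => ?_)
    simp [rhs_zero_apply]
  · convert (hasWeakDbar_of_contDiff hg).conj using 2
    · simp
    rename_i z
    have hz := hρ z
    rw [wirtingerDbar_mul (differentiableAt_of_contDiff (contDiff_ek k₀))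
      (differentiableAt_of_contDiff hw), wirtingerDbar_const_div_solDenom hν, wirtingerDbar_ek]
    simp [rhs_one_apply, soliton_eq, conj_solDenom, conj_ek, map_ofNat]
    field_simp
    ring
  · convert hz' using 2 with z
    · simp
    · simp [rhs_one_apply]

/-! ### Solvability conditions -/

theorem integrable_of_cubic_decay {F : ℂ → ℂ} {C : ℝ} (hF : Continuous F)
    (h : ∀ z, ‖F z‖ ≤ C / (1 + ‖z‖) ^ 3) : Integrable F :=
  (integrable_const_div_one_add_norm_pow C (by norm_num)).mono' hF.aestronglyMeasurable
    (.of_forall h)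

theorem tendsto_integral_of_cubic_decay {F : ℕ → ℂ → ℂ} {F₀ : ℂ → ℂ} {C : ℝ}
    (hF : ∀ n, Continuous (F n)) (h : ∀ n z, ‖F n z‖ ≤ C / (1 + ‖z‖) ^ 3)
    (hlim : ∀ z, Tendsto (fun n => F n z) atTop (𝓝 (F₀ z))) :
    Tendsto (fun n => ∫ z, F n z) atTop (𝓝 (∫ z, F₀ z)) :=
  tendsto_integral_of_dominated_convergence (fun z => C / (1 + ‖z‖) ^ 3)
    (fun n => (hF n).aestronglyMeasurable) (integrable_const_div_one_add_norm_pow C (by norm_num))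
    (fun n => .of_forall (h n)) (.of_forall hlim)

theorem decay_mul {x y z : ℂ} {A B : ℝ} {m n : ℕ} (hx : ‖x‖ ≤ A / (1 + ‖z‖) ^ m)
    (hy : ‖y‖ ≤ B / (1 + ‖z‖) ^ n) : ‖x * y‖ ≤ A * B / (1 + ‖z‖) ^ (m + n) := by
  rw [norm_mul, pow_add, ← div_mul_div_comm]
  exact mul_le_mul hx hy (norm_nonneg _) ((norm_nonneg _).trans hx)

theorem decay_mono {x z : ℂ} {A : ℝ} {m n : ℕ} (hmn : m ≤ n) (hx : ‖x‖ ≤ A / (1 + ‖z‖) ^ n) :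
    ‖x‖ ≤ A / (1 + ‖z‖) ^ m := by
  have h1 : 0 < (1 + ‖z‖) ^ n := by positivity
  have hA : 0 ≤ A := by
    by_contra hA
    exact absurd ((norm_nonneg x).trans hx) (not_le.2 (div_neg_of_neg_of_pos (not_le.1 hA) h1))
  refine hx.trans ?_
  gcongr
  linarith [norm_nonneg z]

section Solvability

variable {A K : ℝ} {q f w : ℂ → ℂ}

theorem IsRegularPair.integral_of_decay (h : IsRegularPair A q f w)
    (hqc : Continuous q) (hq : ∀ z, ‖q z‖ ≤ K / (1 + ‖z‖) ^ 2) {η : ℂ → ℂ} {C C' : ℝ}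
    (hη : ContDiff ℝ (⊤ : ℕ∞) η) (hC : ∀ z, ‖η z‖ ≤ C / (1 + ‖z‖))
    (hC' : ∀ z, ‖wirtingerDbar η z‖ ≤ C' / (1 + ‖z‖) ^ 2) :
    ∫ z, f z * wirtingerDbar η z = -∫ z, q z * conj (w z) * η z := by
  have hA := h.nonneg
  have hfc := continuous_of_holder h.holder_fst
  have hwc := continuous_of_holder h.holder_snd
  have hdc := (contDiff_wirtingerDbar hη).continuous
  have hf1 (z : ℂ) : ‖f z‖ ≤ A / (1 + ‖z‖) ^ 1 := by simpa using h.norm_fst_le z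
  have hw1 (z : ℂ) : ‖conj (w z)‖ ≤ A / (1 + ‖z‖) ^ 1 := by simpa using h.norm_snd_le z
  have hC1 (z : ℂ) : ‖η z‖ ≤ C / (1 + ‖z‖) ^ 1 := by simpa using hC z
  refine h.dbar_fst.integral_mul_of_decay hη hC ?_ ?_ ?_
  · exact MemLp.integrable_norm_mul_rpow (p := 3) (by norm_num)
      (memLp_of_decay (by norm_num) hfc.aestronglyMeasurable h.norm_fst_le)
  · exact integrable_of_cubic_decay (hfc.mul hdc) fun z => decay_mul (hf1 z) (hC' z)
  · exact integrable_of_cubic_decay (by fun_prop) fun z =>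
      decay_mono (by norm_num) (decay_mul (decay_mul (hq z) (hw1 z)) (hC1 z))

/-- A quaternionic symmetry replacing the complex linearity that conjugation destroys: α q w̄ - β q
f̄ = q · conj(ᾱ w - β̄ f). It serves to swap the components and to bring a limit to normal form. -/
theorem IsRegularPair.rotate {A : ℝ} {q f w : ℂ → ℂ} (h : IsRegularPair A q f w) (α β : ℂ) :
    IsRegularPair ((‖α‖ + ‖β‖) * A) q (fun z => α * f z + β * w z)
      (fun z => conj α * w z + -conj β * f z) := by
  have bd {a b x y : ℂ} {B : ℝ} (hx : ‖x‖ ≤ B) (hy : ‖y‖ ≤ B) :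
      ‖a * x + b * y‖ ≤ (‖a‖ + ‖b‖) * B := by
    refine (norm_add_le _ _).trans ?_
    rw [norm_mul, norm_mul, add_mul]
    gcongr
  refine ⟨fun z => ?_, fun z => ?_, fun z z' => ?_, fun z z' => ?_, ?_, ?_⟩
  · rw [mul_div_assoc]
    exact bd (h.norm_fst_le z) (h.norm_snd_le z)
  · rw [mul_div_assoc]
    simpa using bd (a := conj α) (b := -conj β) (h.norm_snd_le z) (h.norm_fst_le z)
  · rw [mul_assoc]
    convert! bd (a := α) (b := β) (h.holder_fst z z') (h.holder_snd z z') using 2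
    ring
  · rw [mul_assoc]
    have := bd (a := conj α) (b := -conj β) (h.holder_snd z z') (h.holder_fst z z')
    rw [norm_neg, RCLike.norm_conj, RCLike.norm_conj] at this
    convert! this using 2
    ring
  · refine ((h.dbar_fst.const_mul α).add (h.dbar_snd.const_mul β)).congr_ae .rfl
      (.of_forall fun z => ?_)
    simp
    ring
  · refine ((h.dbar_snd.const_mul (conj α)).add (h.dbar_fst.const_mul (-conj β))).congr_ae .rfl
      (.of_forall fun z => ?_)
    simp
    ring

/-- With a = conj(z+μ)/ρ, b = ν/ρ and q₀ = ν̄/ρ one has ∂̄a = q₀ b and ∂̄b = -b ā. Integration by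
parts against a and b therefore cancels the contribution of q₀ when the two equations are combined,
leaving only q - q₀. The decay of a, b, f and w makes every integrand at least cubically small. -/
theorem IsRegularPair.solvability (h : IsRegularPair A q f w) {ν : ℂ} (hν : ν ≠ 0) (μ : ℂ)
    (hqc : Continuous q) (hq : ∀ z, ‖q z‖ ≤ K / (1 + ‖z‖) ^ 2) :
    (∫ z, ((q z - conj ν / solDenom ν μ z) * conj (w z) * conj (z + μ) -
      conj (q z - conj ν / solDenom ν μ z) * f z * conj ν) / solDenom ν μ z = 0) ∧
    ∫ z, ((q z - conj ν / solDenom ν μ z) * conj (w z) * ν +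
      conj (q z - conj ν / solDenom ν μ z) * f z * (z + μ)) / solDenom ν μ z = 0 := by
  have hA := h.nonneg
  have hfc := continuous_of_holder h.holder_fst
  have hwc := continuous_of_holder h.holder_snd
  have hρc := (contDiff_solDenom ν μ).continuous
  have hρ0 := solDenom_ne_zero hν μ
  have ha := contDiff_conj_div_solDenom hν μ
  have hb := contDiff_const_div_solDenom hν μ ν
  obtain ⟨Ca, hCa0, hCa⟩ := exists_norm_conj_div_solDenom_le hν μ
  obtain ⟨Cb, hCb0, hCb⟩ := exists_norm_const_div_solDenom_le hν μ ν
  have hCa1 (z : ℂ) : ‖conj (z + μ) / solDenom ν μ z‖ ≤ Ca / (1 + ‖z‖) ^ 1 := by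
    simpa using hCa z
  have hCb1 (z : ℂ) : ‖ν / solDenom ν μ z‖ ≤ Cb / (1 + ‖z‖) := by
    simpa using decay_mono (m := 1) (by norm_num) (hCb z)
  have conj_a (z : ℂ) : conj (conj (z + μ) / solDenom ν μ z) = (z + μ) / solDenom ν μ z := by
    rw [map_div₀, Complex.conj_conj, conj_solDenom]
  have conj_b (z : ℂ) : conj (ν / solDenom ν μ z) = conj ν / solDenom ν μ z := by
    rw [map_div₀, conj_solDenom]
  have conj_a' (z : ℂ) : conj ((z + μ) / solDenom ν μ z) = conj (z + μ) / solDenom ν μ z := by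
    rw [map_div₀, conj_solDenom]
  have conj_b' (z : ℂ) : conj (conj ν / solDenom ν μ z) = ν / solDenom ν μ z := by
    rw [map_div₀, Complex.conj_conj, conj_solDenom]
  have hCa2 (z : ℂ) : ‖(z + μ) / solDenom ν μ z‖ ≤ Ca / (1 + ‖z‖) ^ 1 := by
    rw [← conj_a, RCLike.norm_conj]; exact hCa1 z
  have hCb2 (z : ℂ) : ‖conj ν / solDenom ν μ z‖ ≤ Cb / (1 + ‖z‖) ^ 2 := by
    rw [← conj_b, RCLike.norm_conj]; exact hCb z
  have da (z : ℂ) : wirtingerDbar (fun z => conj (z + μ) / solDenom ν μ z) z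
      = (ν / solDenom ν μ z) * (conj ν / solDenom ν μ z) := by
    rw [wirtingerDbar_conj_div_solDenom hν]; ring
  have db (z : ℂ) : wirtingerDbar (fun z => ν / solDenom ν μ z) z
      = -((ν / solDenom ν μ z) * ((z + μ) / solDenom ν μ z)) := by
    rw [wirtingerDbar_const_div_solDenom hν]; ring
  have bda (z : ℂ) : ‖wirtingerDbar (fun z => conj (z + μ) / solDenom ν μ z) z‖
      ≤ Cb * Cb / (1 + ‖z‖) ^ 2 := by
    rw [da]
    exact decay_mono (by norm_num) (decay_mul (hCb z) (hCb2 z))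
  have bdb (z : ℂ) : ‖wirtingerDbar (fun z => ν / solDenom ν μ z) z‖
      ≤ Cb * Ca / (1 + ‖z‖) ^ 2 := by
    rw [db, norm_neg]
    exact decay_mono (by norm_num) (decay_mul (hCb z) (hCa2 z))
  -- The pair (w, -f) solves the same system, so its first equation supplies the second equation of
  -- (f, w).
  have hr := h.rotate 0 1
  have e1a := h.integral_of_decay hqc hq ha hCa bda
  have e1b := h.integral_of_decay hqc hq hb hCb1 bdb
  have e2a := congrArg conj (hr.integral_of_decay hqc hq ha hCa bda)
  have e2b := congrArg conj (hr.integral_of_decay hqc hq hb hCb1 bdb)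
  simp only [da, db, zero_mul, one_mul, zero_add, map_zero, map_one, neg_mul, map_neg,
    ← integral_conj, map_mul, conj_a, conj_b, conj_a', conj_b', Complex.conj_conj, mul_neg, integral_neg,
    neg_neg, neg_inj] at e1a e1b e2a e2b
  have hf1 (z : ℂ) : ‖f z‖ ≤ A / (1 + ‖z‖) ^ 1 := by simpa using h.norm_fst_le z
  have hw1 (z : ℂ) : ‖conj (w z)‖ ≤ A / (1 + ‖z‖) ^ 1 := by simpa using h.norm_snd_le z
  have hq' (z : ℂ) : ‖conj (q z)‖ ≤ K / (1 + ‖z‖) ^ 2 := by simpa using hq z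
  have ca : Continuous fun z => conj (z + μ) / solDenom ν μ z := ha.continuous
  have cb : Continuous fun z => ν / solDenom ν μ z := hb.continuous
  have ca2 : Continuous fun z => (z + μ) / solDenom ν μ z := by
    refine (Complex.continuous_conj.comp ca).congr fun z => conj_a z
  have cb2 : Continuous fun z => conj ν / solDenom ν μ z := by
    refine (Complex.continuous_conj.comp cb).congr fun z => conj_b z
  have i1 : Integrable fun z => q z * conj (w z) * (conj (z + μ) / solDenom ν μ z) :=
    integrable_of_cubic_decay (by fun_prop) fun z =>
      decay_mono (by norm_num) (decay_mul (decay_mul (hq z) (hw1 z)) (hCa1 z))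
  have i2 : Integrable fun z => q z * conj (w z) * (ν / solDenom ν μ z) :=
    integrable_of_cubic_decay (by fun_prop) fun z =>
      decay_mono (by norm_num) (decay_mul (decay_mul (hq z) (hw1 z)) (hCb z))
  have i3 : Integrable fun z => conj (q z) * f z * (conj ν / solDenom ν μ z) :=
    integrable_of_cubic_decay (by fun_prop) fun z =>
      decay_mono (by norm_num) (decay_mul (decay_mul (hq' z) (hf1 z)) (hCb2 z))
  have i4 : Integrable fun z => conj (q z) * f z * ((z + μ) / solDenom ν μ z) :=
    integrable_of_cubic_decay (by fun_prop) fun z =>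
      decay_mono (by norm_num) (decay_mul (decay_mul (hq' z) (hf1 z)) (hCa2 z))
  have j1 : Integrable fun z => f z * (ν / solDenom ν μ z * (conj ν / solDenom ν μ z)) :=
    integrable_of_cubic_decay (by fun_prop) fun z =>
      decay_mono (by norm_num) (decay_mul (hf1 z) (decay_mul (hCb z) (hCb2 z)))
  have j2 : Integrable fun z => f z * (ν / solDenom ν μ z * ((z + μ) / solDenom ν μ z)) :=
    integrable_of_cubic_decay (by fun_prop) fun z =>
      decay_mono (by norm_num) (decay_mul (hf1 z) (decay_mul (hCb z) (hCa2 z)))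
  have j3 : Integrable fun z => conj (w z) * (conj ν / solDenom ν μ z * (ν / solDenom ν μ z)) :=
    integrable_of_cubic_decay (by fun_prop) fun z =>
      decay_mono (by norm_num) (decay_mul (hw1 z) (decay_mul (hCb2 z) (hCb z)))
  have j4 : Integrable fun z =>
      conj (w z) * (conj ν / solDenom ν μ z * (conj (z + μ) / solDenom ν μ z)) :=
    integrable_of_cubic_decay (by fun_prop) fun z =>
      decay_mono (by norm_num) (decay_mul (hw1 z) (decay_mul (hCb2 z) (hCa1 z)))
  have fsub {F G : ℂ → ℂ} (hF : Integrable F) (hG : Integrable G) :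
      Integrable fun z => F z - G z := hF.sub hG
  constructor
  · have e (z : ℂ) : ((q z - conj ν / solDenom ν μ z) * conj (w z) * conj (z + μ) -
        conj (q z - conj ν / solDenom ν μ z) * f z * conj ν) / solDenom ν μ z
        = (q z * conj (w z) * (conj (z + μ) / solDenom ν μ z)
          - conj (w z) * (conj ν / solDenom ν μ z * (conj (z + μ) / solDenom ν μ z)))
          - (conj (q z) * f z * (conj ν / solDenom ν μ z)
          - f z * (ν / solDenom ν μ z * (conj ν / solDenom ν μ z))) := by
      rw [map_sub, map_div₀, Complex.conj_conj, conj_solDenom]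
      ring
    simp_rw [e]
    rw [integral_sub (fsub i1 j4) (fsub i3 j1), integral_sub i1 j4, integral_sub i3 j1]
    linear_combination e1a + e2b
  · have e (z : ℂ) : ((q z - conj ν / solDenom ν μ z) * conj (w z) * ν +
        conj (q z - conj ν / solDenom ν μ z) * f z * (z + μ)) / solDenom ν μ z
        = (q z * conj (w z) * (ν / solDenom ν μ z)
          - conj (w z) * (conj ν / solDenom ν μ z * (ν / solDenom ν μ z)))
          + (conj (q z) * f z * ((z + μ) / solDenom ν μ z)
          - f z * (ν / solDenom ν μ z * ((z + μ) / solDenom ν μ z))) := by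
      rw [map_sub, map_div₀, Complex.conj_conj, conj_solDenom]
      ring
    simp_rw [e]
    rw [integral_add (fsub i2 j3) (fsub i4 j2), integral_sub i2 j3, integral_sub i4 j2]
    linear_combination -e1b - e2a

end Solvability

/-! ### The two solvability functionals -/

/-- The obstruction of a perturbation `g` paired with the first element of the cokernel. -/
noncomputable def pairingFst (ν μ : ℂ) (g f w : ℂ → ℂ) : ℂ :=
  ∫ z, (g z * conj (w z) * conj (z + μ) - conj (g z) * f z * conj ν) / solDenom ν μ z

/-- The obstruction of a perturbation `g` paired with the second element of the cokernel. -/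
noncomputable def pairingSnd (ν μ : ℂ) (g f w : ℂ → ℂ) : ℂ :=
  ∫ z, (g z * conj (w z) * ν + conj (g z) * f z * (z + μ)) / solDenom ν μ z

theorem continuous_div_solDenom {ν : ℂ} (hν : ν ≠ 0) (μ : ℂ) {F : ℂ → ℂ} (hF : Continuous F) :
    Continuous fun z => F z / solDenom ν μ z :=
  hF.div (contDiff_solDenom ν μ).continuous (solDenom_ne_zero hν μ)

/-- Only first-order decay of g is required: the difference quotient of the phase grows linearly and
consumes one of the two powers in ν̄/ρ. The other two factors bring the total to three powers. -/
theorem exists_norm_pairing_integrand_le {ν : ℂ} (hν : ν ≠ 0) (μ : ℂ) (A D : ℝ) :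
    ∃ C, ∀ g f w : ℂ → ℂ, (∀ z, ‖g z‖ ≤ D / (1 + ‖z‖)) → (∀ z, ‖f z‖ ≤ A / (1 + ‖z‖)) →
      (∀ z, ‖w z‖ ≤ A / (1 + ‖z‖)) → ∀ z,
      ‖(g z * conj (w z) * conj (z + μ) - conj (g z) * f z * conj ν) / solDenom ν μ z‖
        ≤ C / (1 + ‖z‖) ^ 3 ∧
      ‖(g z * conj (w z) * ν + conj (g z) * f z * (z + μ)) / solDenom ν μ z‖
        ≤ C / (1 + ‖z‖) ^ 3 := by
  obtain ⟨Ca, -, hCa⟩ := exists_norm_conj_div_solDenom_le hν μ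
  obtain ⟨Cb, -, hCb⟩ := exists_norm_const_div_solDenom_le hν μ ν
  refine ⟨D * A * Ca + D * A * Cb, fun g f w hg hf hw z => ?_⟩
  have hg1 : ‖g z‖ ≤ D / (1 + ‖z‖) ^ 1 := by simpa using hg z
  have hg2 : ‖conj (g z)‖ ≤ D / (1 + ‖z‖) ^ 1 := by simpa using hg z
  have hf1 : ‖f z‖ ≤ A / (1 + ‖z‖) ^ 1 := by simpa using hf z
  have hw1 : ‖conj (w z)‖ ≤ A / (1 + ‖z‖) ^ 1 := by simpa using hw z
  have ha : ‖conj (z + μ) / solDenom ν μ z‖ ≤ Ca / (1 + ‖z‖) ^ 1 := by simpa using hCa z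
  have ha' : ‖(z + μ) / solDenom ν μ z‖ ≤ Ca / (1 + ‖z‖) ^ 1 := by
    simpa only [norm_div, RCLike.norm_conj] using ha
  have hb : ‖ν / solDenom ν μ z‖ ≤ Cb / (1 + ‖z‖) ^ 1 := decay_mono (by norm_num) (hCb z)
  have hb' : ‖conj ν / solDenom ν μ z‖ ≤ Cb / (1 + ‖z‖) ^ 1 := by
    simpa only [norm_div, RCLike.norm_conj] using hb
  constructor
  · rw [sub_div, mul_div_assoc, mul_div_assoc, add_div]
    exact (norm_sub_le _ _).trans (add_le_add (decay_mul (decay_mul hg1 hw1) ha)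
      (decay_mul (decay_mul hg2 hf1) hb'))
  · rw [add_div (_ * _), mul_div_assoc, mul_div_assoc, add_comm,
      add_div (D * A * Ca)]
    exact (norm_add_le _ _).trans
      (add_le_add (decay_mul (decay_mul hg2 hf1) ha') (decay_mul (decay_mul hg1 hw1) hb))

theorem continuous_pairing_integrand {ν : ℂ} (hν : ν ≠ 0) (μ : ℂ) {g f w : ℂ → ℂ}
    (hg : Continuous g) (hf : Continuous f) (hw : Continuous w) :
    Continuous (fun z =>
      (g z * conj (w z) * conj (z + μ) - conj (g z) * f z * conj ν) / solDenom ν μ z) ∧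
    Continuous (fun z =>
      (g z * conj (w z) * ν + conj (g z) * f z * (z + μ)) / solDenom ν μ z) :=
  ⟨continuous_div_solDenom hν μ (by fun_prop), continuous_div_solDenom hν μ (by fun_prop)⟩

theorem pairing_add_smul {ν : ℂ} (hν : ν ≠ 0) (μ : ℂ) {A D : ℝ} {g g' f w : ℂ → ℂ}
    (hg : Continuous g) (hg' : Continuous g') (hf : Continuous f) (hw : Continuous w)
    (bg : ∀ z, ‖g z‖ ≤ D / (1 + ‖z‖)) (bg' : ∀ z, ‖g' z‖ ≤ D / (1 + ‖z‖))
    (bf : ∀ z, ‖f z‖ ≤ A / (1 + ‖z‖)) (bw : ∀ z, ‖w z‖ ≤ A / (1 + ‖z‖)) (a b : ℝ) :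
    pairingFst ν μ (fun z => a * g z + b * g' z) f w
      = a * pairingFst ν μ g f w + b * pairingFst ν μ g' f w ∧
    pairingSnd ν μ (fun z => a * g z + b * g' z) f w
      = a * pairingSnd ν μ g f w + b * pairingSnd ν μ g' f w := by
  obtain ⟨C, hC⟩ := exists_norm_pairing_integrand_le hν μ A D
  have c := continuous_pairing_integrand hν μ hg hf hw
  have c' := continuous_pairing_integrand hν μ hg' hf hw
  have i1 := integrable_of_cubic_decay c.1 fun z => (hC g f w bg bf bw z).1
  have i2 := integrable_of_cubic_decay c.2 fun z => (hC g f w bg bf bw z).2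
  have i1' := integrable_of_cubic_decay c'.1 fun z => (hC g' f w bg' bf bw z).1
  have i2' := integrable_of_cubic_decay c'.2 fun z => (hC g' f w bg' bf bw z).2
  constructor
  · rw [pairingFst, pairingFst, pairingFst, ← integral_const_mul, ← integral_const_mul,
      ← integral_add (i1.const_mul _) (i1'.const_mul _)]
    congr 1
    funext z
    simp only [map_add, map_mul, Complex.conj_ofReal]
    ring
  · rw [pairingSnd, pairingSnd, pairingSnd, ← integral_const_mul, ← integral_const_mul,
      ← integral_add (i2.const_mul _) (i2'.const_mul _)]
    congr 1
    funext z
    simp only [map_add, map_mul, Complex.conj_ofReal]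
    ring

theorem tendsto_pairing {ν : ℂ} (hν : ν ≠ 0) (μ : ℂ) {A D : ℝ} {g f w : ℕ → ℂ → ℂ}
    {g₀ f₀ w₀ : ℂ → ℂ}
    (hg : ∀ n, Continuous (g n)) (hf : ∀ n, Continuous (f n)) (hw : ∀ n, Continuous (w n))
    (bg : ∀ n z, ‖g n z‖ ≤ D / (1 + ‖z‖))
    (bf : ∀ n z, ‖f n z‖ ≤ A / (1 + ‖z‖)) (bw : ∀ n z, ‖w n z‖ ≤ A / (1 + ‖z‖))
    (lg : ∀ z, Tendsto (fun n => g n z) atTop (𝓝 (g₀ z)))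
    (lf : ∀ z, Tendsto (fun n => f n z) atTop (𝓝 (f₀ z)))
    (lw : ∀ z, Tendsto (fun n => w n z) atTop (𝓝 (w₀ z))) :
    Tendsto (fun n => pairingFst ν μ (g n) (f n) (w n)) atTop (𝓝 (pairingFst ν μ g₀ f₀ w₀)) ∧
    Tendsto (fun n => pairingSnd ν μ (g n) (f n) (w n)) atTop (𝓝 (pairingSnd ν μ g₀ f₀ w₀)) := by
  obtain ⟨C, hC⟩ := exists_norm_pairing_integrand_le hν μ A D
  have cj {x : ℕ → ℂ} {y : ℂ} (h : Tendsto x atTop (𝓝 y)) :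
      Tendsto (fun n => conj (x n)) atTop (𝓝 (conj y)) :=
    (Complex.continuous_conj.tendsto y).comp h
  constructor
  · refine tendsto_integral_of_cubic_decay
      (fun n => (continuous_pairing_integrand hν μ (hg n) (hf n) (hw n)).1)
      (fun n z => (hC _ _ _ (bg n) (bf n) (bw n) z).1) fun z => ?_
    exact ((((lg z).mul (cj (lw z))).mul_const _).sub
      (((cj (lg z)).mul (lf z)).mul_const _)).div_const _
  · refine tendsto_integral_of_cubic_decay
      (fun n => (continuous_pairing_integrand hν μ (hg n) (hf n) (hw n)).2)
      (fun n z => (hC _ _ _ (bg n) (bf n) (bw n) z).2) fun z => ?_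
    exact ((((lg z).mul (cj (lw z))).mul_const _).add
      (((cj (lg z)).mul (lf z)).mul_const _)).div_const _

/-! ### Difference quotients of the phase -/

theorem phase_eq_exp (ℓ μ z : ℂ) :
    phase ℓ μ z = Complex.exp (Complex.I * ((-(2 * (ℓ * (z + μ)).re) : ℝ) : ℂ)) := by
  rw [phase, ek_eq]
  congr 2
  have := Complex.add_conj (ℓ * (z + μ))
  rw [map_mul] at this
  rw [Complex.ofReal_neg, ← this, map_neg]
  ring

theorem norm_phase_sub_one_div_le {ℓ : ℂ} (hℓ : ℓ ≠ 0) (μ z : ℂ) :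
    ‖(phase ℓ μ z - 1) / (‖ℓ‖ : ℂ)‖ ≤ 2 * ‖z + μ‖ := by
  have h0 := norm_pos_iff.2 hℓ
  rw [norm_div, Complex.norm_real, norm_norm, div_le_iff₀ h0, phase_eq_exp]
  refine (Real.norm_exp_I_mul_ofReal_sub_one_le).trans ?_
  rw [norm_neg, norm_mul, Real.norm_two, mul_assoc, mul_comm ‖z + μ‖, ← norm_mul]
  gcongr
  exact Complex.abs_re_le_norm _

/-- First-order Taylor expansion of the exponential: with y its exponent, the remainder |y|²/|ℓ_n|
is at most 2|z+μ||y|, which tends to 0. -/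
theorem tendsto_phase_sub_one_div {ℓ : ℕ → ℂ} {κ : ℂ} (hℓ : ∀ n, ℓ n ≠ 0)
    (hlim : Tendsto ℓ atTop (𝓝 0)) (hκ : Tendsto (fun n => ℓ n / (‖ℓ n‖ : ℂ)) atTop (𝓝 κ))
    (μ z : ℂ) :
    Tendsto (fun n => (phase (ℓ n) μ z - 1) / (‖ℓ n‖ : ℂ)) atTop
      (𝓝 (-Complex.I * (κ * (z + μ) + conj (κ * (z + μ))))) := by
  have hy : Tendsto (fun n => -Complex.I * (ℓ n * (z + μ) + conj (ℓ n * (z + μ)))) atTop (𝓝 0) := by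
    have h : Continuous fun l : ℂ => -Complex.I * (l * (z + μ) + conj (l * (z + μ))) := by
      fun_prop
    simpa [Function.comp_def] using (h.tendsto 0).comp hlim
  have hmain : Tendsto (fun n => -Complex.I * (ℓ n / (‖ℓ n‖ : ℂ) * (z + μ)
      + conj (ℓ n / (‖ℓ n‖ : ℂ) * (z + μ)))) atTop
      (𝓝 (-Complex.I * (κ * (z + μ) + conj (κ * (z + μ))))) := by
    have h : Continuous fun l : ℂ => -Complex.I * (l * (z + μ) + conj (l * (z + μ))) := by
      fun_prop
    exact (h.tendsto κ).comp hκ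
  refine (tendsto_iff_of_dist ?_).1 hmain
  have hb : ∀ᶠ n in atTop, dist (-Complex.I * (ℓ n / (‖ℓ n‖ : ℂ) * (z + μ)
      + conj (ℓ n / (‖ℓ n‖ : ℂ) * (z + μ)))) ((phase (ℓ n) μ z - 1) / (‖ℓ n‖ : ℂ))
      ≤ ‖-Complex.I * (ℓ n * (z + μ) + conj (ℓ n * (z + μ)))‖ * (2 * ‖z + μ‖) := by
    have hsmall := (tendsto_zero_iff_norm_tendsto_zero.1 hy).eventually_le_const one_pos
    filter_upwards [hsmall] with n hn
    have h0 := norm_pos_iff.2 (hℓ n)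
    have h0' : (‖ℓ n‖ : ℂ) ≠ 0 := by exact_mod_cast h0.ne'
    set y := -Complex.I * (ℓ n * (z + μ) + conj (ℓ n * (z + μ))) with hydef
    have e1 : phase (ℓ n) μ z = Complex.exp y := by
      rw [phase, ek_eq, hydef, map_mul]
      congr 1
      rw [map_neg]
      ring
    have e2 : -Complex.I * (ℓ n / (‖ℓ n‖ : ℂ) * (z + μ)
        + conj (ℓ n / (‖ℓ n‖ : ℂ) * (z + μ))) = y / (‖ℓ n‖ : ℂ) := by
      rw [hydef, map_mul, map_mul, map_div₀, Complex.conj_ofReal]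
      ring
    have e3 : ‖y‖ ≤ 2 * ‖z + μ‖ * ‖ℓ n‖ := by
      rw [hydef, norm_mul, norm_neg, Complex.norm_I, one_mul]
      refine (norm_add_le _ _).trans ?_
      rw [RCLike.norm_conj, norm_mul]
      linarith
    rw [e1, e2, dist_comm, dist_eq_norm, ← sub_div, norm_div, Complex.norm_real, norm_norm,
      div_le_iff₀ h0]
    refine (Complex.norm_exp_sub_one_sub_id_le hn).trans ?_
    rw [pow_two, mul_assoc]
    gcongr
  refine squeeze_zero' (.of_forall fun n => dist_nonneg) hb ?_
  simpa using (tendsto_zero_iff_norm_tendsto_zero.1 hy).mul_const (2 * ‖z + μ‖)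

/-! ### Values of the functionals on the limiting profile -/

theorem integrable_cube {ν : ℂ} (hν : ν ≠ 0) (μ κ a : ℂ) :
    Integrable fun z => (κ * (z + μ) + conj (κ * (z + μ))) * a * conj (z + μ)
      / solDenom ν μ z ^ 3 := by
  obtain ⟨Ca, -, hCa⟩ := exists_norm_conj_div_solDenom_le hν μ
  obtain ⟨Cb, -, hCb⟩ := exists_norm_const_div_solDenom_le hν μ a
  have ha (z : ℂ) : ‖conj (z + μ) / solDenom ν μ z‖ ≤ Ca / (1 + ‖z‖) ^ 1 := by simpa using hCa z
  have hL (z : ℂ) : ‖(κ * (z + μ) + conj (κ * (z + μ))) / solDenom ν μ z‖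
      ≤ 2 * ‖κ‖ * Ca / (1 + ‖z‖) ^ 1 := by
    have h1 : ‖κ * (z + μ) + conj (κ * (z + μ))‖ ≤ 2 * ‖κ‖ * ‖conj (z + μ)‖ := by
      refine (norm_add_le _ _).trans ?_
      rw [RCLike.norm_conj, RCLike.norm_conj, norm_mul]
      linarith
    have h2 := ha z
    rw [norm_div] at h2 ⊢
    rw [mul_div_assoc]
    refine le_trans ?_ (mul_le_mul_of_nonneg_left h2 (by positivity))
    rw [← mul_div_assoc]
    gcongr
  refine integrable_of_cubic_decay (C := 2 * ‖κ‖ * Ca * Cb * Ca)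
    (Continuous.div (by fun_prop) ((contDiff_solDenom ν μ).continuous.pow 3)
      fun z => pow_ne_zero 3 (solDenom_ne_zero hν μ z)) fun z => ?_
  have e : (κ * (z + μ) + conj (κ * (z + μ))) * a * conj (z + μ) / solDenom ν μ z ^ 3
      = (κ * (z + μ) + conj (κ * (z + μ))) / solDenom ν μ z * (a / solDenom ν μ z)
        * (conj (z + μ) / solDenom ν μ z) := by ring
  rw [e]
  exact decay_mono (by norm_num) (decay_mul (decay_mul (hL z) (hCb z)) (ha z))

/-- Multiplication by κ̄ and addition of the conjugate turn the integrand into (2 Re κ(z+μ))²/ρ³,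
which is continuous, nonnegative and not identically zero. -/
theorem integral_linear_mul_conj_ne_zero {ν : ℂ} (hν : ν ≠ 0) (μ : ℂ) {κ : ℂ} (hκ : κ ≠ 0) :
    ∫ z, (κ * (z + μ) + conj (κ * (z + μ))) * conj (z + μ) / solDenom ν μ z ^ 3 ≠ 0 := by
  intro h0
  have i1 : Integrable fun z => (κ * (z + μ) + conj (κ * (z + μ))) * conj (z + μ)
      / solDenom ν μ z ^ 3 := by simpa using integrable_cube hν μ κ 1
  have e (z : ℂ) : (((2 * (κ * (z + μ)).re) ^ 2 / (‖z + μ‖ ^ 2 + ‖ν‖ ^ 2) ^ 3 : ℝ) : ℂ)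
      = conj κ * ((κ * (z + μ) + conj (κ * (z + μ))) * conj (z + μ) / solDenom ν μ z ^ 3)
        + conj (conj κ *
          ((κ * (z + μ) + conj (κ * (z + μ))) * conj (z + μ) / solDenom ν μ z ^ 3)) := by
    have h1 := Complex.add_conj (κ * (z + μ))
    rw [Complex.ofReal_div, Complex.ofReal_pow, Complex.ofReal_pow, ← h1, ← solDenom_eq]
    simp only [map_mul, map_add, map_div₀, map_pow, conj_solDenom, Complex.conj_conj]
    ring
  have i2 : Integrable fun z => conj κ *
      ((κ * (z + μ) + conj (κ * (z + μ))) * conj (z + μ) / solDenom ν μ z ^ 3) :=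
    i1.const_mul _
  have i3 : Integrable fun z => conj (conj κ *
      ((κ * (z + μ) + conj (κ * (z + μ))) * conj (z + μ) / solDenom ν μ z ^ 3)) :=
    (Complex.conjCLE.toContinuousLinearMap).integrable_comp i2
  have hpos (z : ℂ) : 0 < (‖z + μ‖ ^ 2 + ‖ν‖ ^ 2) ^ 3 := by
    have := norm_pos_iff.2 hν
    positivity
  have hi : Integrable fun z => (2 * (κ * (z + μ)).re) ^ 2 / (‖z + μ‖ ^ 2 + ‖ν‖ ^ 2) ^ 3 := by
    have : Integrable fun z =>
        (((2 * (κ * (z + μ)).re) ^ 2 / (‖z + μ‖ ^ 2 + ‖ν‖ ^ 2) ^ 3 : ℝ) : ℂ) := by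
      simp_rw [e]
      exact i2.add i3
    exact this.re
  have hz : ∫ z : ℂ, (2 * (κ * (z + μ)).re) ^ 2 / (‖z + μ‖ ^ 2 + ‖ν‖ ^ 2) ^ 3 = 0 := by
    rw [← Complex.ofReal_eq_zero, ← integral_complex_ofReal]
    simp_rw [e]
    rw [integral_add i2 i3, integral_conj, integral_const_mul, h0]
    simp
  have hc : Continuous fun z : ℂ => (2 * (κ * (z + μ)).re) ^ 2 / (‖z + μ‖ ^ 2 + ‖ν‖ ^ 2) ^ 3 :=
    Continuous.div (by fun_prop) (by fun_prop) fun z => (hpos z).ne'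
  have h1 := (integral_eq_zero_iff_of_nonneg (fun z => by have := hpos z; positivity) hi).1 hz
  -- At z = κ̄ - μ the product κ(z+μ) equals |κ|² > 0.
  have h2 := congrFun ((hc.ae_eq_iff_eq volume continuous_const).1 h1) (conj κ - μ)
  have h3 : (2 * (κ * (conj κ - μ + μ)).re) ^ 2 ≠ 0 := by
    rw [sub_add_cancel, Complex.mul_conj, Complex.ofReal_re]
    have := Complex.normSq_pos.2 hκ
    positivity
  exact div_ne_zero h3 (hpos _).ne' h2

theorem integral_eq_zero_of_odd {F : ℂ → ℂ} (a : ℂ) (h : ∀ z, F (a - z) = -F z) :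
    ∫ z, F z = 0 := by
  have h1 := integral_sub_left_eq_self F volume a
  simp_rw [h, integral_neg] at h1
  exact self_eq_neg.1 h1.symm

/-- The factor -i makes the two halves of the integrand add up instead of cancelling, so the pairing
is a nonzero multiple of the preceding integral. -/
theorem pairingFst_profile_ne_zero {ν : ℂ} (hν : ν ≠ 0) (μ : ℂ) {κ : ℂ} (hκ : κ ≠ 0) :
    pairingFst ν μ
      (fun z => -Complex.I * (κ * (z + μ) + conj (κ * (z + μ))) * (conj ν / solDenom ν μ z))
      (fun z => conj (z + μ) / solDenom ν μ z) (fun z => conj ν / solDenom ν μ z) ≠ 0 := by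
  have e (z : ℂ) : (-Complex.I * (κ * (z + μ) + conj (κ * (z + μ))) * (conj ν / solDenom ν μ z)
      * conj (conj ν / solDenom ν μ z) * conj (z + μ)
      - conj (-Complex.I * (κ * (z + μ) + conj (κ * (z + μ))) * (conj ν / solDenom ν μ z))
        * (conj (z + μ) / solDenom ν μ z) * conj ν) / solDenom ν μ z
      = (-2 * Complex.I * ν * conj ν) *
        ((κ * (z + μ) + conj (κ * (z + μ))) * conj (z + μ) / solDenom ν μ z ^ 3) := by
    simp only [map_mul, map_add, map_div₀, map_neg, conj_solDenom, Complex.conj_conj,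
      Complex.conj_I]
    ring
  rw [pairingFst]
  simp_rw [e]
  rw [integral_const_mul]
  have := integral_linear_mul_conj_ne_zero hν μ hκ
  have h2 : conj ν ≠ 0 := (map_ne_zero _).2 hν
  simp_all

/-- Under reflection in -μ the linear factor changes sign while ρ and the other products are even.
-/
theorem pairingSnd_profile (ν μ κ : ℂ) :
    pairingSnd ν μ
      (fun z => -Complex.I * (κ * (z + μ) + conj (κ * (z + μ))) * (conj ν / solDenom ν μ z))
      (fun z => conj (z + μ) / solDenom ν μ z) (fun z => conj ν / solDenom ν μ z) = 0 := by
  refine integral_eq_zero_of_odd (-(2 * μ)) fun z => ?_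
  have e : -(2 * μ) - z + μ = -(z + μ) := by ring
  have e' : solDenom ν μ (-(2 * μ) - z) = solDenom ν μ z := by
    simp only [solDenom, e, map_neg]
    ring
  simp only [e, e', map_mul, map_add, map_div₀, map_neg, conj_solDenom, Complex.conj_conj,
    Complex.conj_I]
  ring

/-- The coefficient differs from ν̄/ρ by |ℓ_n| T_n + ε_n X_n, where T_n is the difference quotient
of the phase times ν̄/ρ. The solvability conditions are two real-linear relations in (|ℓ_n|, ε_n),
and passing to the limit in their determinant requires no comparison between the sizes of |ℓ_n| and
ε_n. -/
theorem splittingIntegral_eq_zero_of_degenerate {ν : ℂ} (hν : ν ≠ 0) {μ κ : ℂ} (hκ : κ ≠ 0)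
    {χ : ℂ → ℂ} (hχc : Continuous χ) {K : ℝ} (hχ : ∀ z, ‖χ z‖ ≤ K / (1 + ‖z‖) ^ 2) {A : ℝ}
    {ε : ℕ → ℝ} {ℓ : ℕ → ℂ} {f w : ℕ → ℂ → ℂ}
    (hε : ∀ n, ε n ≠ 0) (hℓ : ∀ n, ℓ n ≠ 0) (hlim : Tendsto ℓ atTop (𝓝 0))
    (hℓκ : Tendsto (fun n => ℓ n / (‖ℓ n‖ : ℂ)) atTop (𝓝 κ))
    (h : ∀ n, IsRegularPair A
      (fun z => phase (ℓ n) μ z * (conj ν / solDenom ν μ z + 1 / 2 * (ε n * χ z))) (f n) (w n))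
    (hf : ∀ z, Tendsto (fun n => f n z) atTop (𝓝 (conj (z + μ) / solDenom ν μ z)))
    (hw : ∀ z, Tendsto (fun n => w n z) atTop (𝓝 (conj ν / solDenom ν μ z))) :
    ∫ z, (ν ^ 2 * χ z + (z + μ) * conj (z + μ) * conj (χ z)) / solDenom ν μ z ^ 2 = 0 := by
  set q₀ : ℂ → ℂ := fun z => conj ν / solDenom ν μ z with hq₀
  set T : ℕ → ℂ → ℂ := fun n z => (phase (ℓ n) μ z - 1) / (‖ℓ n‖ : ℂ) * q₀ z with hT
  set X : ℕ → ℂ → ℂ := fun n z => phase (ℓ n) μ z * (1 / 2 * χ z) with hX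
  obtain ⟨Ca, hCa0, hCa⟩ := exists_norm_conj_div_solDenom_le hν μ
  obtain ⟨Cb, hCb0, hCb⟩ := exists_norm_const_div_solDenom_le hν μ (conj ν)
  have hpc (n : ℕ) : Continuous (phase (ℓ n) μ) := (contDiff_phase _ _).continuous
  have hq₀c : Continuous q₀ := continuous_div_solDenom hν μ continuous_const
  have hTc (n : ℕ) : Continuous (T n) := by fun_prop
  have hXc (n : ℕ) : Continuous (X n) := by fun_prop
  have hTb (n : ℕ) (z : ℂ) : ‖T n z‖ ≤ 2 * ‖ν‖ * Ca / (1 + ‖z‖) := by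
    have h1 := hCa z
    rw [norm_div, RCLike.norm_conj] at h1
    simp only [hT, hq₀]
    rw [norm_mul, norm_div (conj ν), RCLike.norm_conj]
    calc _ ≤ 2 * ‖z + μ‖ * (‖ν‖ / ‖solDenom ν μ z‖) := by
          gcongr
          exact norm_phase_sub_one_div_le (hℓ n) μ z
      _ = 2 * ‖ν‖ * (‖z + μ‖ / ‖solDenom ν μ z‖) := by ring
      _ ≤ 2 * ‖ν‖ * (Ca / (1 + ‖z‖)) := by gcongr
      _ = _ := by ring
  have hXb (n : ℕ) (z : ℂ) : ‖X n z‖ ≤ K / (1 + ‖z‖) := by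
    have h1 : ‖χ z‖ ≤ K / (1 + ‖z‖) ^ 1 := decay_mono (by norm_num) (hχ z)
    rw [pow_one] at h1
    simp only [hX]
    rw [norm_mul, norm_phase, norm_mul, one_mul]
    norm_num
    linarith [norm_nonneg (χ z)]
  set D := max (2 * ‖ν‖ * Ca) K
  have hTb' (n : ℕ) (z : ℂ) : ‖T n z‖ ≤ D / (1 + ‖z‖) :=
    (hTb n z).trans (by gcongr; exact le_max_left _ _)
  have hXb' (n : ℕ) (z : ℂ) : ‖X n z‖ ≤ D / (1 + ‖z‖) :=
    (hXb n z).trans (by gcongr; exact le_max_right _ _)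
  have hfc (n : ℕ) : Continuous (f n) := continuous_of_holder (h n).holder_fst
  have hwc (n : ℕ) : Continuous (w n) := continuous_of_holder (h n).holder_snd
  have bf (n : ℕ) := (h n).norm_fst_le
  have bw (n : ℕ) := (h n).norm_snd_le
  have key (n : ℕ) : ‖ℓ n‖ * pairingFst ν μ (T n) (f n) (w n)
        + ε n * pairingFst ν μ (X n) (f n) (w n) = 0 ∧
      ‖ℓ n‖ * pairingSnd ν μ (T n) (f n) (w n)
        + ε n * pairingSnd ν μ (X n) (f n) (w n) = 0 := by
    have hq (z : ℂ) : ‖phase (ℓ n) μ z * (conj ν / solDenom ν μ z + 1 / 2 * (ε n * χ z))‖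
        ≤ (Cb + |ε n| * K) / (1 + ‖z‖) ^ 2 := by
      rw [norm_mul, norm_phase, one_mul, add_div]
      refine (norm_add_le _ _).trans (add_le_add (hCb z) ?_)
      have h1 := mul_le_mul_of_nonneg_left (hχ z) (abs_nonneg (ε n))
      rw [norm_mul, norm_mul, Complex.norm_real, Real.norm_eq_abs, mul_div_assoc]
      norm_num
      linarith [mul_nonneg (abs_nonneg (ε n)) (norm_nonneg (χ z))]
    have hqc : Continuous fun z =>
        phase (ℓ n) μ z * (conj ν / solDenom ν μ z + 1 / 2 * (ε n * χ z)) := by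
      simp only [hq₀] at hq₀c
      fun_prop
    have hs := (h n).solvability hν μ hqc hq
    have hl := pairing_add_smul hν μ (hTc n) (hXc n) (hfc n) (hwc n) (hTb' n) (hXb' n) (bf n)
      (bw n) ‖ℓ n‖ (ε n)
    have h0 : (‖ℓ n‖ : ℂ) ≠ 0 := by exact_mod_cast norm_ne_zero_iff.2 (hℓ n)
    have e : (fun z => (‖ℓ n‖ : ℂ) * T n z + ε n * X n z) = fun z =>
        phase (ℓ n) μ z * (conj ν / solDenom ν μ z + 1 / 2 * (ε n * χ z))
          - conj ν / solDenom ν μ z := by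
      funext z
      simp only [hT, hX, hq₀]
      field_simp
      ring
    rw [e] at hl
    exact ⟨hl.1.symm.trans hs.1, hl.2.symm.trans hs.2⟩
  -- Eliminating |ℓ_n| from the two relations leaves ε_n times the determinant, and ε_n ≠ 0.
  have hdet (n : ℕ) : pairingFst ν μ (T n) (f n) (w n) * pairingSnd ν μ (X n) (f n) (w n)
      = pairingSnd ν μ (T n) (f n) (w n) * pairingFst ν μ (X n) (f n) (w n) := by
    obtain ⟨k1, k2⟩ := key n
    have h0 : (‖ℓ n‖ : ℂ) ≠ 0 := by exact_mod_cast norm_ne_zero_iff.2 (hℓ n)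
    have h1 : (ε n : ℂ) ≠ 0 := by exact_mod_cast hε n
    refine mul_left_cancel₀ h1 ?_
    linear_combination pairingFst ν μ (T n) (f n) (w n) * k2
      - pairingSnd ν μ (T n) (f n) (w n) * k1
  have hTlim := tendsto_pairing hν μ hTc hfc hwc hTb' bf bw
    (fun z => (tendsto_phase_sub_one_div hℓ hlim hℓκ μ z).mul_const (q₀ z)) hf hw
  have hph (z : ℂ) : Tendsto (fun n => phase (ℓ n) μ z) atTop (𝓝 1) := by
    have h1 := (((continuous_ek_left (z + μ)).comp continuous_neg).tendsto 0).comp hlim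
    simpa [phase, Function.comp_def, ek_zero_left] using h1
  have hXlim := tendsto_pairing hν μ hXc hfc hwc hXb' bf bw
    (fun z => (hph z).mul_const (1 / 2 * χ z)) hf hw
  have hlim2 := tendsto_nhds_unique (hTlim.1.mul hXlim.2)
    ((hTlim.2.mul hXlim.1).congr fun n => (hdet n).symm)
  rw [pairingSnd_profile, zero_mul] at hlim2
  have h0 := (mul_eq_zero.1 hlim2).resolve_left (pairingFst_profile_ne_zero hν μ hκ)
  have e (z : ℂ) : (1 * (1 / 2 * χ z) * conj (conj ν / solDenom ν μ z) * ν
      + conj (1 * (1 / 2 * χ z)) * (conj (z + μ) / solDenom ν μ z) * (z + μ)) / solDenom ν μ z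
      = 1 / 2 * ((ν ^ 2 * χ z + (z + μ) * conj (z + μ) * conj (χ z)) / solDenom ν μ z ^ 2) := by
    simp only [map_mul, map_div₀, conj_solDenom, Complex.conj_conj, map_one, map_ofNat]
    ring
  rw [pairingSnd] at h0
  simp_rw [e] at h0
  rw [integral_const_mul] at h0
  exact (mul_eq_zero.1 h0).resolve_left (by norm_num)

/-! ### High frequencies -/

/-- Riemann–Lebesgue. For non-integrable F both sides are the default value 0, since the phase is
continuous and unimodular. -/
theorem tendsto_integral_phase_mul {ℓ : ℕ → ℂ} (hℓ : Tendsto (fun n => ‖ℓ n‖) atTop atTop)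
    (μ : ℂ) (F : ℂ → ℂ) : Tendsto (fun n => ∫ z, phase (ℓ n) μ z * F z) atTop (𝓝 0) := by
  -- The phase contains exp(-2i Re ℓz), and the Fourier character is exp(-2πi⟨z, v⟩), whence the
  -- frequency v = ℓ̄/π.
  have h1 : Tendsto (fun n => conj (ℓ n) / (π : ℂ)) atTop (cocompact ℂ) := by
    rw [← Metric.cobounded_eq_cocompact, ← tendsto_norm_atTop_iff_cobounded]
    simp only [norm_div, RCLike.norm_conj, Complex.norm_real]
    exact hℓ.atTop_div_const (by rw [Real.norm_of_nonneg Real.pi_nonneg]; exact Real.pi_pos)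
  have h2 := (tendsto_integral_exp_inner_smul_cocompact (V := ℂ) F).comp h1
  have e (n : ℕ) : ∫ z, phase (ℓ n) μ z * F z = ek (-ℓ n) μ *
      ∫ v, Real.fourierChar (-(inner ℝ v (conj (ℓ n) / (π : ℂ)))) • F v := by
    rw [← integral_const_mul]
    congr 1
    funext z
    have e1 : ((inner ℝ z (conj (ℓ n) / (π : ℂ)) : ℝ) : ℂ)
        = (ℓ n * z + conj (ℓ n) * conj z) / (2 * π) := by
      have h := Complex.add_conj (conj (ℓ n) / (π : ℂ) * conj z)
      simp only [map_mul, map_div₀, Complex.conj_conj, Complex.conj_ofReal, Complex.ofReal_mul,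
        Complex.ofReal_ofNat] at h
      rw [Complex.inner]
      have hπ : (π : ℂ) ≠ 0 := by exact_mod_cast Real.pi_ne_zero
      field_simp
      field_simp at h
      linear_combination -h
    have e2 : (Real.fourierChar (-(inner ℝ z (conj (ℓ n) / (π : ℂ)))) : ℂ) = ek (-ℓ n) z := by
      rw [Real.fourierChar_apply, ek_eq]
      congr 1
      push_cast
      rw [e1]
      have hπ : (π : ℂ) ≠ 0 := by exact_mod_cast Real.pi_ne_zero
      field_simp
      rw [map_neg]
      ring
    rw [Circle.smul_def, e2, smul_eq_mul, phase, ek_add_right]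
    ring
  rw [tendsto_zero_iff_norm_tendsto_zero] at h2 ⊢
  refine h2.congr fun n => ?_
  rw [e, norm_mul, norm_ek, one_mul]
  rfl

theorem HasWeakDbar.eq_zero_of_decay {A : ℝ} {f : ℂ → ℂ} (hf : Continuous f)
    (hb : ∀ z, ‖f z‖ ≤ A / (1 + ‖z‖)) (h : HasWeakDbar f fun _ => 0) (z : ℂ) : f z = 0 := by
  have e : cauchyTransform (fun _ => 0) = fun _ => 0 := by
    funext z
    simp [cauchyTransform]
  have h1 := HasWeakDbar.ae_eq_cauchyTransform (p := 3) (K := 0) (w := fun _ => 0) (by norm_num)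
    le_rfl (memLp_of_decay (by norm_num) hf.aestronglyMeasurable hb) MemLp.zero (by simp) h
    (by simp) (by rw [e]; exact continuous_const.locallyIntegrable)
  rw [e] at h1
  exact congrFun ((hf.ae_eq_iff_eq volume continuous_const).1 h1) z

/-- In the weak equation the limiting source is isolated: the difference from it vanishes by
dominated convergence, and the limit multiplied by the fast phase vanishes by Riemann–Lebesgue.
Hence ∂̄f₀ = 0, and decay forces f₀ = 0. -/
theorem eq_zero_of_norm_tendsto_atTop {A K : ℝ} {ℓ : ℕ → ℂ} {g f w : ℕ → ℂ → ℂ}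
    {g₀ f₀ w₀ : ℂ → ℂ} (hℓ : Tendsto (fun n => ‖ℓ n‖) atTop atTop) (μ : ℂ)
    (h : ∀ n, IsRegularPair A (fun z => phase (ℓ n) μ z * g n z) (f n) (w n))
    (hgc : ∀ n, Continuous (g n)) (hgK : ∀ n z, ‖g n z‖ ≤ K)
    (hg : ∀ z, Tendsto (fun n => g n z) atTop (𝓝 (g₀ z)))
    (hf : ∀ z, Tendsto (fun n => f n z) atTop (𝓝 (f₀ z)))
    (hw : ∀ z, Tendsto (fun n => w n z) atTop (𝓝 (w₀ z))) (z : ℂ) : f₀ z = 0 := by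
  have hA := (h 0).nonneg
  have hbf (z : ℂ) : ‖f₀ z‖ ≤ A / (1 + ‖z‖) :=
    le_of_tendsto (hf z).norm (.of_forall fun n => (h n).norm_fst_le z)
  have hfc (n : ℕ) : Continuous (f n) := continuous_of_holder (h n).holder_fst
  have hwc (n : ℕ) : Continuous (w n) := continuous_of_holder (h n).holder_snd
  have hf₀c : Continuous f₀ := continuous_of_holder (A := A) fun z z' =>
    le_of_tendsto ((hf z).sub (hf z')).norm (.of_forall fun n => (h n).holder_fst z z')
  have hle (z : ℂ) : A / (1 + ‖z‖) ≤ A := div_le_self hA (by linarith [norm_nonneg z])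
  refine HasWeakDbar.eq_zero_of_decay hf₀c hbf ⟨hf₀c.locallyIntegrable,
    continuous_const.locallyIntegrable, fun η hη => ?_⟩ z
  have hηc := hη.continuous
  have hηi : Integrable η := hη.integrable
  have l1 : Tendsto (fun n => ∫ z, f n z * wirtingerDbar η z) atTop
      (𝓝 (∫ z, f₀ z * wirtingerDbar η z)) := by
    have hd := hη.wirtingerDbar
    refine tendsto_integral_of_dominated_convergence (fun z => A * ‖wirtingerDbar η z‖)
      (fun n => ((hfc n).mul hd.continuous).aestronglyMeasurable)
      (hd.integrable.norm.const_mul A) (fun n => .of_forall fun z => ?_)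
      (.of_forall fun z => (hf z).mul_const _)
    rw [norm_mul]
    gcongr
    exact ((h n).norm_fst_le z).trans (hle z)
  set G : ℕ → ℂ → ℂ := fun n z => g n z * conj (w n z) * η z with hG
  set G₀ : ℂ → ℂ := fun z => g₀ z * conj (w₀ z) * η z with hG₀
  have hGc (n : ℕ) : Continuous (G n) := by fun_prop
  have hGb (n : ℕ) (z : ℂ) : ‖G n z‖ ≤ K * A * ‖η z‖ := by
    simp only [hG]
    rw [norm_mul, norm_mul, RCLike.norm_conj]
    gcongr
    · exact (norm_nonneg _).trans (hgK n z)
    · exact hgK n z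
    · exact ((h n).norm_snd_le z).trans (hle z)
  have hGlim (z : ℂ) : Tendsto (fun n => G n z) atTop (𝓝 (G₀ z)) :=
    ((hg z).mul ((Complex.continuous_conj.tendsto _).comp (hw z))).mul_const _
  have hG₀b (z : ℂ) : ‖G₀ z‖ ≤ K * A * ‖η z‖ :=
    le_of_tendsto (hGlim z).norm (.of_forall fun n => hGb n z)
  have hG₀m : AEStronglyMeasurable G₀ volume :=
    aestronglyMeasurable_of_tendsto_ae atTop (fun n => (hGc n).aestronglyMeasurable)
      (.of_forall hGlim)
  have hi₀ : Integrable G₀ := (hηi.norm.const_mul _).mono' hG₀m (.of_forall hG₀b)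
  have hi (n : ℕ) : Integrable (G n) :=
    (hηi.norm.const_mul _).mono' (hGc n).aestronglyMeasurable (.of_forall (hGb n))
  have hph (n : ℕ) : Continuous (phase (ℓ n) μ) := (contDiff_phase _ _).continuous
  have mulph (n : ℕ) {F : ℂ → ℂ} (hF : Integrable F) :
      Integrable fun z => phase (ℓ n) μ z * F z :=
    hF.norm.mono' ((hph n).aestronglyMeasurable.mul hF.1)
      (.of_forall fun z => by rw [Pi.mul_apply, norm_mul, norm_phase, one_mul])
  have l2 : Tendsto (fun n => ∫ z, phase (ℓ n) μ z * (G n z - G₀ z)) atTop (𝓝 0) := by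
    have : Tendsto (fun n => ∫ z, phase (ℓ n) μ z * (G n z - G₀ z)) atTop
        (𝓝 (∫ _ : ℂ, (0 : ℂ))) := by
      refine tendsto_integral_of_dominated_convergence (fun z => K * A * ‖η z‖ + K * A * ‖η z‖)
        (fun n => (mulph n ((hi n).sub hi₀)).1)
        ((hηi.norm.const_mul _).add (hηi.norm.const_mul _)) (fun n => .of_forall fun z => ?_)
        (.of_forall fun z => ?_)
      · rw [norm_mul, norm_phase, one_mul]
        exact (norm_sub_le _ _).trans (add_le_add (hGb n z) (hG₀b z))
      · rw [tendsto_zero_iff_norm_tendsto_zero]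
        simp only [norm_mul, norm_phase, one_mul]
        have := ((hGlim z).sub_const (G₀ z)).norm
        simpa using this
    simpa using this
  have hsub (n : ℕ) : Integrable fun z => G n z - G₀ z := (hi n).sub hi₀
  have l3 := (l2.add (tendsto_integral_phase_mul hℓ μ G₀)).neg
  rw [add_zero, neg_zero] at l3
  have e (n : ℕ) : -((∫ z, phase (ℓ n) μ z * (G n z - G₀ z)) + ∫ z, phase (ℓ n) μ z * G₀ z)
      = ∫ z, f n z * wirtingerDbar η z := by
    rw [(h n).dbar_fst.2.2 η hη, ← integral_add (mulph n (hsub n)) (mulph n hi₀)]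
    congr 2
    funext z
    simp only [hG, hG₀]
    ring
  simp_rw [e] at l3
  simpa using tendsto_nhds_unique l1 l3

/-! ### The perturbed soliton -/

/-- The coefficient of the reduced system for the soliton perturbed by `ε χ`. -/
noncomputable def perturbedCoeff (ν μ : ℂ) (χ : ℂ → ℂ) (ε : ℝ) (ℓ z : ℂ) : ℂ :=
  phase ℓ μ z * (conj ν / solDenom ν μ z + 1 / 2 * (ε * χ z))

theorem continuous_perturbedCoeff {ν : ℂ} (hν : ν ≠ 0) (μ : ℂ) {χ : ℂ → ℂ} (hχ : Continuous χ)
    (ε : ℝ) (ℓ : ℂ) : Continuous (perturbedCoeff ν μ χ ε ℓ) := by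
  have h1 := (contDiff_phase ℓ μ).continuous
  have h2 := continuous_div_solDenom hν μ (continuous_const (y := conj ν))
  unfold perturbedCoeff
  fun_prop

theorem exists_norm_amplitude_le {ν : ℂ} (hν : ν ≠ 0) (μ : ℂ) {χ : ℂ → ℂ} {K : ℝ}
    (hK : 0 ≤ K) (hχ : ∀ z, ‖χ z‖ ≤ K / (1 + ‖z‖) ^ 2) :
    ∃ C, 0 ≤ C ∧ ∀ ε : ℝ, 0 ≤ ε → ε ≤ 1 → ∀ z,
      ‖conj ν / solDenom ν μ z + 1 / 2 * (ε * χ z)‖ ≤ C / (1 + ‖z‖) ^ 2 := by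
  obtain ⟨Cb, hCb0, hCb⟩ := exists_norm_const_div_solDenom_le hν μ (conj ν)
  refine ⟨Cb + K, by positivity, fun ε h0 h1 z => ?_⟩
  rw [add_div]
  refine (norm_add_le _ _).trans (add_le_add (hCb z) (le_trans ?_ (hχ z)))
  rw [norm_mul, norm_mul, Complex.norm_real, Real.norm_of_nonneg h0]
  norm_num
  nlinarith [norm_nonneg (χ z)]

/-- One A serves all k and all ε in [0,1], because the modulus of the coefficient does not depend on
k. The constant e_{-(k-k₀)}(μ) converts e_{-(k-k₀)}(z) into the phase centred at -μ. -/
theorem exists_isRegularPair_of_mem_exceptionalSet {p : ℝ} (hp : 2 < p) {ν : ℂ} (hν : ν ≠ 0)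
    (k₀ μ : ℂ) {φ : ℂ → ℂ} {K : ℝ} (hK : 0 ≤ K)
    (hφ : ∀ z, ‖φ z‖ ≤ K / (1 + ‖z‖) ^ 2) :
    ∃ A, ∀ ε : ℝ, 0 ≤ ε → ε ≤ 1 →
      ∀ k ∈ exceptionalSet p (fun z => soliton k₀ ν μ z + (ε : ℂ) * φ z),
      ∃ f w, IsRegularPair A (perturbedCoeff ν μ (fun z => ek (-k₀) z * φ z) ε (k - k₀)) f w ∧
        ∫ z, (‖f z‖ ^ p + ‖w z‖ ^ p) = 1 := by
  have hχ (z : ℂ) : ‖ek (-k₀) z * φ z‖ ≤ K / (1 + ‖z‖) ^ 2 := by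
    rw [norm_mul, norm_ek, one_mul]
    exact hφ z
  obtain ⟨C, hC0, hC⟩ := exists_norm_amplitude_le hν μ hK hχ
  obtain ⟨A, -, hA⟩ := exists_isRegularPair hp hC0
  refine ⟨A, fun ε h0 h1 k hk => ?_⟩
  obtain ⟨f, w, hf, hw, hne, d1, d2⟩ :=
    exists_pair_of_mem_exceptionalSet (norm_ek (-(k - k₀)) μ) hk
  have e (z : ℂ) : 1 / 2 * ek (-(k - k₀)) μ * (soliton k₀ ν μ z + ε * φ z) * ek (-k) z
      = perturbedCoeff ν μ (fun z => ek (-k₀) z * φ z) ε (k - k₀) z := by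
    have h2 : ek (-k) z = ek (-(k - k₀)) z * ek (-k₀) z := by
      rw [← ek_add_left]
      congr 1
      ring
    rw [soliton_eq, perturbedCoeff, phase, ek_add_right, h2]
    linear_combination (ek (-(k - k₀)) μ * conj ν / solDenom ν μ z * ek (-(k - k₀)) z)
      * ek_mul_ek_neg k₀ z
  simp_rw [e] at d1 d2
  refine hA _ f w (fun z => ?_) hf hw hne d1 d2
  rw [perturbedCoeff, norm_mul, norm_phase, one_mul]
  exact hC ε h0 h1 z

theorem pairingSnd_const_profile (ν μ : ℂ) (χ : ℂ → ℂ) :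
    pairingSnd ν μ (fun z => 1 * (1 / 2 * χ z)) (fun z => conj (z + μ) / solDenom ν μ z)
      (fun z => conj ν / solDenom ν μ z)
    = 1 / 2 * ∫ z, (ν ^ 2 * χ z + (z + μ) * conj (z + μ) * conj (χ z)) / solDenom ν μ z ^ 2 := by
  rw [pairingSnd, ← integral_const_mul]
  congr 1
  funext z
  simp only [map_mul, map_div₀, conj_solDenom, Complex.conj_conj, map_one, map_ofNat]
  ring

theorem splittingIntegral_eq_zero_of_frequency_zero {ν : ℂ} (hν : ν ≠ 0) {μ : ℂ}
    {χ : ℂ → ℂ} (hχc : Continuous χ) {K : ℝ} (hK : 0 ≤ K) (hχ : ∀ z, ‖χ z‖ ≤ K / (1 + ‖z‖) ^ 2)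
    {A : ℝ} {ε : ℕ → ℝ} {f w : ℕ → ℂ → ℂ} (hε : ∀ n, 0 < ε n) (hε1 : ∀ n, ε n ≤ 1)
    (h : ∀ n, IsRegularPair A (perturbedCoeff ν μ χ (ε n) 0) (f n) (w n))
    (hf : ∀ z, Tendsto (fun n => f n z) atTop (𝓝 (conj (z + μ) / solDenom ν μ z)))
    (hw : ∀ z, Tendsto (fun n => w n z) atTop (𝓝 (conj ν / solDenom ν μ z))) :
    ∫ z, (ν ^ 2 * χ z + (z + μ) * conj (z + μ) * conj (χ z)) / solDenom ν μ z ^ 2 = 0 := by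
  set g : ℂ → ℂ := fun z => 1 * (1 / 2 * χ z) with hg
  have hgc : Continuous g := by fun_prop
  have hgb (z : ℂ) : ‖g z‖ ≤ K / (1 + ‖z‖) := by
    have h1 : ‖χ z‖ ≤ K / (1 + ‖z‖) ^ 1 := decay_mono (by norm_num) (hχ z)
    rw [pow_one] at h1
    simp only [hg]
    rw [one_mul, norm_mul]
    norm_num
    linarith [norm_nonneg (χ z)]
  have hfc (n : ℕ) : Continuous (f n) := continuous_of_holder (h n).holder_fst
  have hwc (n : ℕ) : Continuous (w n) := continuous_of_holder (h n).holder_snd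
  obtain ⟨C, -, hC⟩ := exists_norm_amplitude_le hν μ hK hχ
  have key (n : ℕ) : pairingSnd ν μ g (f n) (w n) = 0 := by
    have hs := ((h n).solvability hν μ (continuous_perturbedCoeff hν μ hχc _ _) (K := C)
      fun z => by
        rw [perturbedCoeff, norm_mul, norm_phase, one_mul]
        exact hC _ (hε n).le (hε1 n) z).2
    -- The second coefficient 0 reduces additivity to homogeneity in ε_n.
    have hl := (pairing_add_smul hν μ hgc hgc (hfc n) (hwc n) hgb hgb (h n).norm_fst_le
      (h n).norm_snd_le (ε n) 0).2
    have e : (fun z => (ε n : ℂ) * g z + (0 : ℝ) * g z)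
        = fun z => perturbedCoeff ν μ χ (ε n) 0 z - conj ν / solDenom ν μ z := by
      funext z
      simp only [hg, perturbedCoeff, phase_zero, Complex.ofReal_zero]
      ring
    rw [e] at hl
    have h0 := hl.symm.trans hs
    rw [Complex.ofReal_zero, zero_mul, add_zero] at h0
    exact (mul_eq_zero.1 h0).resolve_left (by exact_mod_cast (hε n).ne')
  have hlim := (tendsto_pairing hν μ (g := fun _ => g) (fun _ => hgc) hfc hwc (fun _ => hgb)
    (fun n => (h n).norm_fst_le) (fun n => (h n).norm_snd_le) (fun z => tendsto_const_nhds)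
    hf hw).2
  simp_rw [key] at hlim
  have h0 := tendsto_nhds_unique hlim tendsto_const_nhds
  rw [hg, pairingSnd_const_profile] at h0
  exact (mul_eq_zero.1 h0).resolve_left (by norm_num)

/-- Along a subsequence either every ℓ_n vanishes, or none does and the directions ℓ_n/|ℓ_n|
converge on the unit circle. -/
theorem splittingIntegral_eq_zero_of_profile {ν : ℂ} (hν : ν ≠ 0) {μ : ℂ}
    {χ : ℂ → ℂ} (hχc : Continuous χ) {K : ℝ} (hK : 0 ≤ K) (hχ : ∀ z, ‖χ z‖ ≤ K / (1 + ‖z‖) ^ 2)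
    {A : ℝ} {ε : ℕ → ℝ} {ℓ : ℕ → ℂ} {f w : ℕ → ℂ → ℂ}
    (hε : ∀ n, 0 < ε n) (hε1 : ∀ n, ε n ≤ 1) (hℓ : Tendsto ℓ atTop (𝓝 0))
    (h : ∀ n, IsRegularPair A (perturbedCoeff ν μ χ (ε n) (ℓ n)) (f n) (w n))
    (hf : ∀ z, Tendsto (fun n => f n z) atTop (𝓝 (conj (z + μ) / solDenom ν μ z)))
    (hw : ∀ z, Tendsto (fun n => w n z) atTop (𝓝 (conj ν / solDenom ν μ z))) :
    ∫ z, (ν ^ 2 * χ z + (z + μ) * conj (z + μ) * conj (χ z)) / solDenom ν μ z ^ 2 = 0 := by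
  by_cases hfr : ∃ᶠ n in atTop, ℓ n = 0
  · obtain ⟨ψ, hψ, hψ0⟩ := extraction_of_frequently_atTop hfr
    have ht := hψ.tendsto_atTop
    refine splittingIntegral_eq_zero_of_frequency_zero hν hχc hK hχ (A := A)
      (fun n => hε (ψ n)) (fun n => hε1 (ψ n)) (f := fun n => f (ψ n)) (w := fun n => w (ψ n)) (fun n => ?_)
      (fun z => (hf z).comp ht) (fun z => (hw z).comp ht)
    rw [← hψ0 n]
    exact h (ψ n)
  · obtain ⟨ψ, hψ, hψ0⟩ := extraction_of_eventually_atTop (not_frequently.1 hfr)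
    have hs (n : ℕ) : ℓ (ψ n) / (‖ℓ (ψ n)‖ : ℂ) ∈ Metric.sphere (0 : ℂ) 1 := by
      rw [mem_sphere_zero_iff_norm, norm_div, Complex.norm_real, norm_norm,
        div_self (norm_ne_zero_iff.2 (hψ0 n))]
    obtain ⟨κ, hκ, τ, hτ, hlim⟩ := (isCompact_sphere (0 : ℂ) 1).tendsto_subseq hs
    have hκ0 : κ ≠ 0 := by
      rw [mem_sphere_zero_iff_norm] at hκ
      rw [← norm_pos_iff, hκ]
      exact one_pos
    have ht := (hψ.comp hτ).tendsto_atTop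
    exact splittingIntegral_eq_zero_of_degenerate hν hκ0 hχc hχ
      (fun n => (hε (ψ (τ n))).ne') (fun n => hψ0 (τ n)) (hℓ.comp ht) hlim
      (fun n => h (ψ (τ n))) (fun z => (hf z).comp ht) (fun z => (hw z).comp ht)

/-- The compactness argument: the limit is nonzero, so the frequencies neither diverge nor
accumulate at the selected nonzero value, and what remains is a limit solving the unperturbed
problem at ℓ = 0. -/
theorem splittingIntegral_eq_zero_of_sequence {p : ℝ} (hp : 2 < p) {ν : ℂ} (hν : ν ≠ 0) {μ : ℂ}
    {χ : ℂ → ℂ} (hχc : Continuous χ) {K : ℝ} (hK : 0 ≤ K) (hχ : ∀ z, ‖χ z‖ ≤ K / (1 + ‖z‖) ^ 2)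
    {A : ℝ} {ε : ℕ → ℝ} {ℓ : ℕ → ℂ} {f w : ℕ → ℂ → ℂ}
    (hε : ∀ n, 0 < ε n) (hε1 : ∀ n, ε n ≤ 1) (hε0 : Tendsto ε atTop (𝓝 0))
    (h : ∀ n, IsRegularPair A (perturbedCoeff ν μ χ (ε n) (ℓ n)) (f n) (w n))
    (h1 : ∀ n, ∫ z, (‖f n z‖ ^ p + ‖w n z‖ ^ p) = 1) :
    ∫ z, (ν ^ 2 * χ z + (z + μ) * conj (z + μ) * conj (χ z)) / solDenom ν μ z ^ 2 = 0 := by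
  obtain ⟨f₀, w₀, ψ, hψ, hf, hw⟩ := exists_subseq_isRegularPair h
  have htψ := hψ.tendsto_atTop
  have hne : ¬ ∀ z, f₀ z = 0 ∧ w₀ z = 0 := fun h0 => by
    have hl := tendsto_integral_norm_rpow hp (fun n => h (ψ n)) hf hw
    simp_rw [h1, fun z => (h0 z).1, fun z => (h0 z).2, norm_zero,
      Real.zero_rpow (by linarith : p ≠ 0), add_zero, integral_zero] at hl
    exact one_ne_zero (tendsto_nhds_unique tendsto_const_nhds hl)
  obtain ⟨C, hC0, hC⟩ := exists_norm_amplitude_le hν μ hK hχ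
  have hCb (n : ℕ) (z : ℂ) : ‖conj ν / solDenom ν μ z + 1 / 2 * (ε n * χ z)‖ ≤ C := by
    refine (hC _ (hε n).le (hε1 n) z).trans (div_le_self hC0 (one_le_pow₀ ?_))
    linarith [norm_nonneg z]
  have hlimq (z : ℂ) : Tendsto (fun n => conj ν / solDenom ν μ z + 1 / 2 * (ε n * χ z)) atTop
      (𝓝 (conj ν / solDenom ν μ z)) := by
    have h2 : Tendsto (fun n => (ε n : ℂ)) atTop (𝓝 0) :=
      (Complex.continuous_ofReal.tendsto' 0 0 Complex.ofReal_zero).comp hε0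
    have h3 := ((h2.mul_const (χ z)).const_mul (1 / 2)).const_add (conj ν / solDenom ν μ z)
    rwa [zero_mul, mul_zero, add_zero] at h3
  by_cases hb : Tendsto (fun n => ‖ℓ (ψ n)‖) atTop atTop
  · refine (hne fun z => ?_).elim
    have hgc (n : ℕ) : Continuous fun z => conj ν / solDenom ν μ z + 1 / 2 * (ε n * χ z) :=
      (continuous_div_solDenom hν μ continuous_const).add (by fun_prop)
    refine ⟨eq_zero_of_norm_tendsto_atTop hb μ (fun n => h (ψ n)) (fun n => hgc (ψ n))
      (fun n => hCb (ψ n)) (fun z => (hlimq z).comp htψ) hf hw z, ?_⟩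
    -- The rotated pair (w, -f) carries the vanishing over to the second component.
    have hr (n : ℕ) := (h (ψ n)).rotate 0 1
    simp only [zero_mul, one_mul, zero_add, map_zero, map_one, neg_mul] at hr
    exact eq_zero_of_norm_tendsto_atTop hb μ hr (fun n => hgc (ψ n))
      (fun n => hCb (ψ n)) (fun z => (hlimq z).comp htψ) hw (fun z => (hf z).neg) z
  · obtain ⟨R, hR⟩ : ∃ R, ∃ᶠ n in atTop, ‖ℓ (ψ n)‖ < R := by
      rw [tendsto_atTop] at hb
      push Not at hb
      exact hb
    obtain ⟨ℓ₀, -, τ, hτ, hℓ₀⟩ := tendsto_subseq_of_frequently_bounded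
      (Metric.isBounded_ball (x := (0 : ℂ)) (r := R))
      (hR.mono fun n hn => mem_ball_zero_iff.2 hn)
    set σ : ℕ → ℕ := fun n => ψ (τ n) with hσ
    have htσ : Tendsto σ atTop atTop := (hψ.comp hτ).tendsto_atTop
    have hfσ (z : ℂ) : Tendsto (fun n => f (σ n) z) atTop (𝓝 (f₀ z)) :=
      (hf z).comp hτ.tendsto_atTop
    have hwσ (z : ℂ) : Tendsto (fun n => w (σ n) z) atTop (𝓝 (w₀ z)) :=
      (hw z).comp hτ.tendsto_atTop
    have hph (z : ℂ) : Tendsto (fun n => phase (ℓ (σ n)) μ z) atTop (𝓝 (phase ℓ₀ μ z)) :=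
      (((continuous_ek_left (z + μ)).comp continuous_neg).tendsto ℓ₀).comp hℓ₀
    have hlim : IsRegularPair A (fun z => phase ℓ₀ μ z * (conj ν / solDenom ν μ z)) f₀ w₀ :=
      IsRegularPair.of_tendsto (fun n => h (σ n))
        (fun n => continuous_perturbedCoeff hν μ hχc _ _)
        ((contDiff_phase _ _).continuous.mul (continuous_div_solDenom hν μ continuous_const))
        (fun n z => by
          rw [perturbedCoeff, norm_mul, norm_phase, one_mul]
          exact hCb (σ n) z)
        (fun z => (hph z).mul ((hlimq z).comp htσ)) hfσ hwσ
    by_cases hℓ : ℓ₀ = 0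
    · subst hℓ
      simp_rw [phase_zero, one_mul] at hlim
      obtain ⟨c, d, hcd⟩ := hlim.eq_of_phase_zero hν
      have hN : c * conj c + d * conj d ≠ 0 := by
        intro h0
        rw [Complex.mul_conj, Complex.mul_conj, ← Complex.ofReal_add, Complex.ofReal_eq_zero] at h0
        have hc := Complex.normSq_nonneg c
        have hd := Complex.normSq_nonneg d
        have hc0 : c = 0 := Complex.normSq_eq_zero.1 (by linarith)
        have hd0 : d = 0 := Complex.normSq_eq_zero.1 (by linarith)
        exact hne fun z => by simp [(hcd z).1, (hcd z).2, hc0, hd0]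
      set N := c * conj c + d * conj d with hNdef
      have hNc : conj N = N := by
        simp only [hNdef, map_add, map_mul, Complex.conj_conj]
        ring
      -- The limit is determined by (c, d), and rotation by (c̄/N, -d/N) with N = |c|² + |d|² is the
      -- quaternionic inverse that sends it to the bound state.
      refine splittingIntegral_eq_zero_of_profile hν hχc hK hχ (fun n => hε (σ n))
        (fun n => hε1 (σ n)) hℓ₀ (fun n => (h (σ n)).rotate (conj c / N) (-d / N))
        (fun z => ?_) (fun z => ?_)
      · convert! ((hfσ z).const_mul (conj c / N)).add ((hwσ z).const_mul (-d / N)) using 2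
        rw [(hcd z).1, (hcd z).2]
        have := solDenom_ne_zero hν μ z
        field_simp
        rw [hNdef]
        ring
      · convert! ((hwσ z).const_mul (conj (conj c / N))).add
          ((hfσ z).const_mul (-conj (-d / N))) using 2
        rw [(hcd z).1, (hcd z).2, map_div₀, map_div₀, hNc, Complex.conj_conj, map_neg]
        have := solDenom_ne_zero hν μ z
        field_simp
        rw [hNdef]
        ring
    · exact (hne fun z => hlim.eq_zero_of_phase hν hℓ z).elim

/-! ### Proof of the two assertions -/

theorem exceptionalSet_soliton {p : ℝ} (hp : 2 < p) {ν : ℂ} (hν : ν ≠ 0) (k₀ μ : ℂ) :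
    exceptionalSet p (soliton k₀ ν μ) = {k₀} := by
  refine Set.Subset.antisymm (fun k hk => ?_)
    (Set.singleton_subset_iff.2 (mem_exceptionalSet_soliton hp hν k₀ μ))
  by_contra hne
  -- The unperturbed soliton is treated as the perturbation with φ = 0 and ε = 0.
  obtain ⟨A, hA⟩ := exists_isRegularPair_of_mem_exceptionalSet hp hν k₀ μ (φ := fun _ => 0) le_rfl
    (by simp)
  obtain ⟨f, w, h, h1⟩ := hA 0 le_rfl zero_le_one k (by simpa using hk)
  have e : perturbedCoeff ν μ (fun z => ek (-k₀) z * 0) 0 (k - k₀)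
      = fun z => phase (k - k₀) μ z * (conj ν / solDenom ν μ z) := by
    funext z
    simp [perturbedCoeff]
  rw [e] at h
  have h0 := h.eq_zero_of_phase hν (sub_ne_zero.2 hne)
  simp_rw [fun z => (h0 z).1, fun z => (h0 z).2, norm_zero,
    Real.zero_rpow (by linarith : p ≠ 0), add_zero, integral_zero] at h1
  exact zero_ne_one h1

theorem splittingIntegral_eq (k₀ ν μ : ℂ) (φ : ℂ → ℂ) :
    splittingIntegral k₀ ν μ φ = ∫ z, (ν ^ 2 * (ek (-k₀) z * φ z)
      + (z + μ) * conj (z + μ) * conj (ek (-k₀) z * φ z)) / solDenom ν μ z ^ 2 := by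
  rw [splittingIntegral]
  congr 1
  funext z
  rw [Complex.mul_conj, Complex.normSq_eq_norm_sq, solDenom_eq,
    ← Complex.ofReal_pow _ 2]
  rfl

theorem exceptionalSet_perturbed_eq_empty {p : ℝ} (hp : 2 < p) {ν : ℂ} (hν : ν ≠ 0) (k₀ μ : ℂ)
    {φ : ℂ → ℂ} (hφ : IsTestFunction φ) (hS : splittingIntegral k₀ ν μ φ ≠ 0) :
    ∃ ε₀ : ℝ, 0 < ε₀ ∧ ∀ ε : ℝ, 0 < ε → ε < ε₀ →
      exceptionalSet p (fun z => soliton k₀ ν μ z + (ε : ℂ) * φ z) = ∅ := by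
  obtain ⟨K, hK0, hK⟩ := exists_bound_of_hasCompactSupport hφ.continuous hφ.2 2
  obtain ⟨A, hA⟩ := exists_isRegularPair_of_mem_exceptionalSet hp hν k₀ μ hK0 hK
  -- Failure for every ε₀ = 1/(n+1) yields the sequences ε_n → 0 and k_n used in the compactness
  -- argument.
  by_contra! hcon
  have hpos (n : ℕ) : (0 : ℝ) < 1 / ((n : ℝ) + 1) := by positivity
  choose ε hε hεlt hne using fun n : ℕ => hcon (1 / ((n : ℝ) + 1)) (hpos n)
  choose k hk using hne
  have hε1 (n : ℕ) : ε n ≤ 1 :=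
    (hεlt n).le.trans ((div_le_one (by positivity)).2 (by linarith [n.cast_nonneg (α := ℝ)]))
  choose f w h h1 using fun n => hA (ε n) (hε n).le (hε1 n) (k n) (hk n)
  have hε0 : Tendsto ε atTop (𝓝 0) :=
    squeeze_zero (fun n => (hε n).le) (fun n => (hεlt n).le)
      tendsto_one_div_add_atTop_nhds_zero_nat
  refine hS ((splittingIntegral_eq k₀ ν μ φ).trans ?_)
  exact splittingIntegral_eq_zero_of_sequence hp hν
    ((continuous_ek _).mul hφ.continuous) hK0
    (fun z => by rw [norm_mul, norm_ek, one_mul]; exact hK z) hε hε1 hε0 h h1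

end DSII

theorem theorem1p1 (p : ℝ) (hp : 2 < p) (k₀ ν₀ μ₀ : ℂ) (hν₀ : ν₀ ≠ 0) :
    DSII.exceptionalSet p (DSII.soliton k₀ ν₀ μ₀) = {k₀} ∧
    ∀ φ : ℂ → ℂ, DSII.IsTestFunction φ →
      DSII.splittingIntegral k₀ ν₀ μ₀ φ ≠ 0 →
      ∃ ε₀ : ℝ, 0 < ε₀ ∧ ∀ ε : ℝ, 0 < ε → ε < ε₀ →
        DSII.exceptionalSet p (fun z => DSII.soliton k₀ ν₀ μ₀ z + (ε : ℂ) * φ z) = ∅ := by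
  exact ⟨DSII.exceptionalSet_soliton hp hν₀ k₀ μ₀, fun φ hφ hS =>
    DSII.exceptionalSet_perturbed_eq_empty hp hν₀ k₀ μ₀ hφ hS⟩
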